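/- Let $A$ be a unital complex algebra acting unitally by even bounded operators on a $\mathbb Z/2$-graded complex Hilbert space $H$ with grading operator $\gamma$, and let $p>0$. Write $\mathcal L^q$ $(q>0)$ for the Schatten ideals of $H$. Let $(H,F_0,\gamma)$ and $(H,F_1,\gamma)$ be even $p$-summable Fredholm modules over $A$: $F_0$ and $F_1$ are bounded, odd and selfadjoint, with $[F_i,a]\in\mathcal L^p$ for all $a\in A$ and $F_i^2-1\in\mathcal L^{p/2}$. Suppose that they are joined by a $C^1$ operator homotopy: a family $F_t$, $0\le t\le 1$, of odd bounded operators from $F_0$ to $F_1$, $C^1$ in operator norm, with $[F_t,a]\in\mathcal L^p$ $(a\in A)$ and $F_t^2-1\in\mathcal L^{p/2}$, both depending continuously on $t$ in the (quasi-)norms of these ideals. Let $m$ be an integer with $2m\ge p+1$; or, if moreover $\frac{dF_t}{dt}\in\mathcal L^p$ depends continuously on $t$ in $\mathcal L^p$, an integer with $2m\ge p$. For even $k$ with $0\le k\le 2m$ put $$\mathrm{Ch}^k_{2m}(F)(a_0,\dots,a_k)=\frac{m!}{(m+\frac k2)!}\sum_{i_0+\dots+i_k=m-\frac k2}\mathrm{Tr}\,\gamma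 a_0(1-F^2)^{i_0}[F,a_1](1-F^2)^{i_1}\cdots[F,a_k](1-F^2)^{i_k},$$ and for odd $k$ with $1\le k\le 2m-1$ put $$\mathrm{Tch}^k_{2m}(a_0,\dots,a_k)=-\frac{m!}{(m+\frac{k+1}2)!}\int_0^1\sum_{i_0+\dots+i_{k+1}=m-\frac{k+1}2}\ \sum_{l=0}^k(-1)^l\,\mathrm{Tr}\,\gamma a_0(1-F_t^2)^{i_0}[F_t,a_1](1-F_t^2)^{i_1}\cdots[F_t,a_l](1-F_t^2)^{i_l}\tfrac{dF_t}{dt}(1-F_t^2)^{i_{l+1}}\cdots[F_t,a_k](1-F_t^2)^{i_{k+1}}\,dt .$$ Then all operators under these traces (with $F=F_0,F_1$ in $\mathrm{Ch}_{2m}$) are of trace class, the traces under the integral are continuous in $t$, $\mathrm{Ch}_{2m}(F_0)$ and $\mathrm{Ch}_{2m}(F_1)$ are cyclic $2m$-cocycles in the $(b,B)$-bicomplex of $A$, $\mathrm{Tch}_{2m}$ is a $(2m-1)$-cochain in this bicomplex, $$\mathrm{Ch}_{2m}(F_1)-\mathrm{Ch}_{2m}(F_0)=(b+B)\,\mathrm{Tch}_{2m},$$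 and hence $\mathrm{Ch}_{2m}(F_0)=\mathrm{Ch}_{2m}(F_1)$ in $HC^{2m}(A)$. -/

import Mathlib

open Set Filter Topology
open scoped ENNReal

noncomputable section

namespace CyclicCohomology

/-! ### Cyclic cohomology of a unital complex algebra through the `(b, B)`-bicomplex

Cochains are algebraic: a `k`-cochain is a `(k+1)`-linear functional on `A`. -/

variable (A : Type*) [Ring A] [Algebra ℂ A]

/-- Families of functions `φ k : A^(k+1) → ℂ`, one for every `k`. -/
abbrev Family : Type _ := (k : ℕ) → ((Fin (k + 1) → A) → ℂ)

variable {A}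

/-- The Hochschild coboundary
`(b φ)(a₀,…,a_{k+1}) = ∑_{j ≤ k} (-1)^j φ(a₀,…,a_j a_{j+1},…,a_{k+1})
  + (-1)^(k+1) φ(a_{k+1} a₀, a₁,…,a_k)`. -/
def b {k : ℕ} (φ : (Fin (k + 1) → A) → ℂ) (a : Fin (k + 2) → A) : ℂ :=
  (∑ j : Fin (k + 1), (-1 : ℂ) ^ (j : ℕ) * φ (Fin.contractNth j.castSucc (· * ·) a))
    + (-1 : ℂ) ^ (k + 1) *
      φ (Fin.cons (a (Fin.last (k + 1)) * a 0) (fun j : Fin k => a j.succ.castSucc))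

/-- Connes' operator `B₀`:
`(B₀ φ)(a₀,…,a_k) = φ(1,a₀,…,a_k) - (-1)^(k+1) φ(a₀,…,a_k,1)`. -/
def B₀ {k : ℕ} (φ : (Fin (k + 2) → A) → ℂ) (a : Fin (k + 1) → A) : ℂ :=
  φ (Fin.cons 1 a) - (-1 : ℂ) ^ (k + 1) * φ (Fin.snoc a 1)

/-- Connes' operator `B`, the cyclic antisymmetrization of `B₀`:
`(B φ)(a₀,…,a_k) = ∑_{j ≤ k} (-1)^(k j) (B₀ φ)(a_j,…,a_k,a₀,…,a_{j-1})`
(the addition of indices in `Fin (k + 1)` is modulo `k + 1`). -/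
def B {k : ℕ} (φ : (Fin (k + 2) → A) → ℂ) (a : Fin (k + 1) → A) : ℂ :=
  ∑ j : Fin (k + 1), (-1 : ℂ) ^ (k * (j : ℕ)) * B₀ φ (fun i => a (i + j))

variable (A)

/-- The total differential `b + B`. -/
def d : Family A →ₗ[ℂ] Family A where
  toFun φ
    | 0 => B (φ 1)
    | k + 1 => b (φ k) + B (φ (k + 2))
  map_add' φ ψ := by
    funext k a
    cases k <;>
      simp only [b, B, B₀, Pi.add_apply, mul_add, mul_sub, Finset.sum_add_distrib,
        Finset.sum_sub_distrib] <;> ring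
  map_smul' c φ := by
    funext k a
    cases k <;>
      simp only [b, B, B₀, Pi.add_apply, Pi.smul_apply, smul_eq_mul, RingHom.id_apply, mul_add,
        mul_sub, Finset.mul_sum, mul_left_comm]

/-- The `(k+1)`-linear functionals, as a space of functions `A^(k+1) → ℂ`. -/
def cochains (k : ℕ) : Submodule ℂ ((Fin (k + 1) → A) → ℂ) where
  carrier := {f | ∃ φ : MultilinearMap ℂ (fun _ : Fin (k + 1) => A) ℂ, ⇑φ = f}
  add_mem' := by
    rintro _ _ ⟨φ, rfl⟩ ⟨ψ, rfl⟩
    exact ⟨φ + ψ, rfl⟩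
  zero_mem' := ⟨0, rfl⟩
  smul_mem' := by
    rintro c _ ⟨φ, rfl⟩
    exact ⟨c • φ, rfl⟩

/-- Cochains of total degree `n` in the cyclic bicomplex: the components are multilinear and live
in the degrees `k ≤ n` with `k ≡ n (mod 2)`. -/
def totCochains (n : ℕ) : Submodule ℂ (Family A) where
  carrier := {φ | ∀ k, φ k ∈ cochains A k ∧ (¬ (k ≤ n ∧ k ≡ n [MOD 2]) → φ k = 0)}
  add_mem' := by
    intro φ ψ hφ hψ k
    refine ⟨(cochains A k).add_mem (hφ k).1 (hψ k).1, fun h => ?_⟩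
    rw [Pi.add_apply, (hφ k).2 h, (hψ k).2 h, add_zero]
  zero_mem' := fun k => ⟨(cochains A k).zero_mem, fun _ => rfl⟩
  smul_mem' := by
    intro c φ hφ k
    refine ⟨(cochains A k).smul_mem c (hφ k).1, fun h => ?_⟩
    rw [Pi.smul_apply, (hφ k).2 h, smul_zero]

/-- Cyclic `n`-cocycles. -/
def cocycles (n : ℕ) : Submodule ℂ (Family A) := totCochains A n ⊓ LinearMap.ker (d A)

/-- Cyclic `n`-coboundaries. -/
def coboundaries : ℕ → Submodule ℂ (Family A)
  | 0 => ⊥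
  | n + 1 => (totCochains A n).map (d A)

/-- The cyclic cohomology `HC^n(A)`. -/
abbrev HC (n : ℕ) : Type _ :=
  ↥(cocycles A n) ⧸ (coboundaries A n).submoduleOf (cocycles A n)

variable {A}

/-- The class of a cyclic cocycle in `HC^n(A)`. -/
def HC.mk {n : ℕ} (φ : Family A) (h : φ ∈ cocycles A n) : HC A n :=
  Submodule.Quotient.mk ⟨φ, h⟩

end CyclicCohomology

/-! ### Schatten classes and the trace -/

namespace Schatten

variable {H : Type*} [NormedAddCommGroup H] [InnerProductSpace ℂ H] [CompleteSpace H]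

/-- The singular values `s₀ ≥ s₁ ≥ …` of a bounded operator on a Hilbert space, as its
approximation numbers: `s_n(T)` is the distance of `T` from the operators of rank at most `n`. -/
def singularValue (T : H →L[ℂ] H) (n : ℕ) : ℝ :=
  Metric.infDist T {R : H →L[ℂ] H | LinearMap.rank (R : H →ₗ[ℂ] H) ≤ (n : Cardinal)}

/-- The Schatten `p`-(quasi-)norm `(∑ s_n(T)^p)^(1/p)`, for `0 < p < ∞`. -/
def eNorm (p : ℝ) (T : H →L[ℂ] H) : ℝ≥0∞ :=
  (∑' n, ENNReal.ofReal (singularValue T n) ^ p) ^ (1 / p)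

/-- `T` belongs to the Schatten ideal `ℒ^p`. -/
def Mem (p : ℝ) (T : H →L[ℂ] H) : Prop := eNorm p T < ∞

/-- The family `X` is continuous on `[0,1]` as a map into `ℒ^p`. -/
def ContinuousOnUnit (p : ℝ) (X : ℝ → H →L[ℂ] H) : Prop :=
  (∀ t ∈ Icc (0 : ℝ) 1, Mem p (X t)) ∧
    ∀ t₀ ∈ Icc (0 : ℝ) 1,
      Tendsto (fun t => eNorm p (X t - X t₀)) (𝓝[Icc (0 : ℝ) 1] t₀) (𝓝 0)

/-- The trace `∑ ⟪e_i, T e_i⟫` with respect to a fixed orthonormal basis; on `ℒ^1` the sum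
converges absolutely and does not depend on the basis. -/
def trace (T : H →L[ℂ] H) : ℂ :=
  let e := (exists_hilbertBasis ℂ H).choose_spec.choose
  ∑' i, inner ℂ (e i) (T (e i))

end Schatten

/-! ### Even Fredholm modules and their characters -/

/-- A `ℤ/2`-graded Hilbert space `H`, with grading operator `γ`, on which the unital algebra `A`
acts by even bounded operators. -/
structure GradedRep (A H : Type*) [Ring A] [Algebra ℂ A]
    [NormedAddCommGroup H] [InnerProductSpace ℂ H] [CompleteSpace H] where
  γ : H →L[ℂ] H
  γ_selfAdjoint : IsSelfAdjoint γ
  γ_sq : γ * γ = 1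
  ρ : A →ₐ[ℂ] (H →L[ℂ] H)
  even : ∀ a, γ * ρ a = ρ a * γ

namespace GradedRep

open CyclicCohomology

variable {A H : Type*} [Ring A] [Algebra ℂ A]
  [NormedAddCommGroup H] [InnerProductSpace ℂ H] [CompleteSpace H]

/-- The commutator `[F, a]`. -/
def comm (M : GradedRep A H) (F : H →L[ℂ] H) (a : A) : H →L[ℂ] H := F * M.ρ a - M.ρ a * F

/-- `F` is odd, `[F, a] ∈ ℒ^p` for all `a ∈ A`, and `F² - 1 ∈ ℒ^(p/2)`. -/
structure IsSummable (M : GradedRep A H) (p : ℝ) (F : H →L[ℂ] H) : Prop where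
  odd : M.γ * F = -(F * M.γ)
  comm_mem : ∀ a, Schatten.Mem p (M.comm F a)
  curvature_mem : Schatten.Mem (p / 2) (F ^ 2 - 1)

/-- `(H, F, γ)` is an even finitely summable bounded Fredholm module over `A`, with summability
exponent `p`. -/
structure IsFredholmModule (M : GradedRep A H) (p : ℝ) (F : H →L[ℂ] H) : Prop
    extends M.IsSummable p F where
  selfAdjoint : IsSelfAdjoint F

/-- `F_t`, `0 ≤ t ≤ 1`, is a `C^1` operator homotopy from `F₀` to `F₁` with summability exponent
`p`: it is `C^1` in the operator norm, every `F_t` is odd, and `[F_t, a]` and `F_t² - 1` depend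
continuously on `t` as elements of `ℒ^p` and `ℒ^(p/2)`. -/
structure IsOperatorHomotopy (M : GradedRep A H) (p : ℝ) (F₀ F₁ : H →L[ℂ] H)
    (F : ℝ → H →L[ℂ] H) : Prop where
  at_zero : F 0 = F₀
  at_one : F 1 = F₁
  contDiffOn : ContDiffOn ℝ 1 F (Icc 0 1)
  odd : ∀ t ∈ Icc (0 : ℝ) 1, M.γ * F t = -(F t * M.γ)
  comm_continuous : ∀ a, Schatten.ContinuousOnUnit p (fun t => M.comm (F t) a)
  curvature_continuous : Schatten.ContinuousOnUnit (p / 2) (fun t => F t ^ 2 - 1)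

/-- The derivative `dF_t/dt` of a family on `[0,1]` (one-sided at the end points). -/
def velocity (F : ℝ → H →L[ℂ] H) (t : ℝ) : H →L[ℂ] H := derivWithin F (Icc 0 1) t

/-- The product `f₀ θ^(i₀) f₁ θ^(i₁) ⋯ f_{r-1} θ^(i_{r-1})`. -/
def word {r : ℕ} (θ : H →L[ℂ] H) (f : Fin r → H →L[ℂ] H) (i : Fin r → ℕ) : H →L[ℂ] H :=
  (List.ofFn fun j => f j * θ ^ i j).prod

/-- The tuple `(a₀, [F, a₁], …, [F, a_k])` of operators. -/
def factors (M : GradedRep A H) (F : H →L[ℂ] H) {k : ℕ} (a : Fin (k + 1) → A) :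
    Fin (k + 1) → H →L[ℂ] H :=
  Fin.cons (M.ρ (a 0)) (fun j : Fin k => M.comm F (a j.succ))

/-- `γ a₀ (1-F²)^(i₀) [F,a₁] (1-F²)^(i₁) ⋯ [F,a_k] (1-F²)^(i_k)`. -/
def chOp (M : GradedRep A H) (F : H →L[ℂ] H) {k : ℕ} (a : Fin (k + 1) → A)
    (i : Fin (k + 1) → ℕ) : H →L[ℂ] H :=
  M.γ * word (1 - F ^ 2) (M.factors F a) i

/-- The character `Ch_{2m}(F)`: for even `k ≤ 2m`, its `k`-th component at `(a₀,…,a_k)` is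
`m! / (m + k/2)! * ∑_{i₀+⋯+i_k = m - k/2}
  Tr γ a₀ (1-F²)^(i₀) [F,a₁] (1-F²)^(i₁) ⋯ [F,a_k] (1-F²)^(i_k)`;
the other components vanish. -/
def Ch (M : GradedRep A H) (m : ℕ) (F : H →L[ℂ] H) : Family A := fun k a =>
  if Even k ∧ k ≤ 2 * m then
    ((m.factorial : ℂ) / ((m + k / 2).factorial : ℂ)) *
      ∑ i ∈ Finset.Nat.antidiagonalTuple (k + 1) (m - k / 2), Schatten.trace (M.chOp F a i)
  else 0

/-- `γ a₀ (1-F²)^(i₀) [F,a₁] (1-F²)^(i₁) ⋯ [F,a_l] (1-F²)^(i_l) D (1-F²)^(i_{l+1}) ⋯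
[F,a_k] (1-F²)^(i_{k+1})`. -/
def tchOp (M : GradedRep A H) (F D : H →L[ℂ] H) {k : ℕ} (a : Fin (k + 1) → A)
    (i : Fin (k + 2) → ℕ) (l : Fin (k + 1)) : H →L[ℂ] H :=
  M.γ * word (1 - F ^ 2)
    (Fin.insertNth (α := fun _ => H →L[ℂ] H) l.succ D (M.factors F a)) i

/-- The transgression cochain `Tch_{2m}` of a homotopy `F_t`: for odd `k ≤ 2m - 1`, its `k`-th
component at `(a₀,…,a_k)` is
`- m! / (m + (k+1)/2)! * ∫₀¹ ∑_{i₀+⋯+i_{k+1} = m - (k+1)/2} ∑_{l=0}^k (-1)^l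
  Tr γ a₀ (1-F_t²)^(i₀) [F_t,a₁] (1-F_t²)^(i₁) ⋯ [F_t,a_l] (1-F_t²)^(i_l) dF_t/dt
  (1-F_t²)^(i_{l+1}) ⋯ [F_t,a_k] (1-F_t²)^(i_{k+1}) dt`;
the other components vanish. -/
def Tch (M : GradedRep A H) (m : ℕ) (F : ℝ → H →L[ℂ] H) : Family A := fun k a =>
  if Odd k ∧ k + 1 ≤ 2 * m then
    -((m.factorial : ℂ) / ((m + (k + 1) / 2).factorial : ℂ)) *
      ∫ t in (0 : ℝ)..1,
        ∑ i ∈ Finset.Nat.antidiagonalTuple (k + 2) (m - (k + 1) / 2), ∑ l : Fin (k + 1),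
          (-1 : ℂ) ^ (l : ℕ) * Schatten.trace (M.tchOp (F t) (velocity F t) a i l)
  else 0

/-- All operators under the traces in `Ch_{2m}(F)` are of trace class. -/
def ChDefined (M : GradedRep A H) (m : ℕ) (F : H →L[ℂ] H) : Prop :=
  ∀ k, Even k → k ≤ 2 * m → ∀ a : Fin (k + 1) → A,
    ∀ i ∈ Finset.Nat.antidiagonalTuple (k + 1) (m - k / 2), Schatten.Mem 1 (M.chOp F a i)

/-- All operators under the traces in `Tch_{2m}` are of trace class, and their traces depend
continuously on `t ∈ [0,1]`, so that the integrals converge. -/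
def TchDefined (M : GradedRep A H) (m : ℕ) (F : ℝ → H →L[ℂ] H) : Prop :=
  ∀ k, Odd k → k + 1 ≤ 2 * m → ∀ a : Fin (k + 1) → A,
    ∀ i ∈ Finset.Nat.antidiagonalTuple (k + 2) (m - (k + 1) / 2), ∀ l : Fin (k + 1),
      (∀ t ∈ Icc (0 : ℝ) 1, Schatten.Mem 1 (M.tchOp (F t) (velocity F t) a i l)) ∧
      ContinuousOn (fun t => Schatten.trace (M.tchOp (F t) (velocity F t) a i l)) (Icc 0 1)

end GradedRep

end

set_option linter.unusedSectionVars false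

noncomputable section

namespace Schatten

variable {H : Type*} [NormedAddCommGroup H] [InnerProductSpace ℂ H]

/-! ### Approximation numbers -/

/-! Put θ = 1 - F² and let R = (1 - Xθ)⁻¹ be its resolvent in formal power series over the bounded
operators. The sum over exponents in the k-th component of Ch is the coefficient of X^(m - k/2) in
a₀ R [F,a₁] R ⋯ [F,a_k] R (`PowerSeries.sum_prod_ofFn_eq_coeff`). Give [F,a] degree 1, θ degree 2
and X degree -2, where degree d means membership in ℒ^(p/d). Hölder's inequality makes degrees
additive, degree at least p means trace class, and the trace is cyclic on a product of total degree
at least p (`Schatten.trace_mul_comm`). Summability thus becomes a count of degrees.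

The cocycle identity is then algebra. Since [R,a] = X R [θ,a] R, the Leibniz rule collapses b of a
word to -Tr γ X a₀ R κ, where κ is the alternating sum of the words with one [F,a_j] replaced by
[θ,a_j] (`b_chWord`). B doubles one resolvent, and X dR/dX = R² - R counts the doublings
(`B_chWord`), with a factor that the factorials in Ch absorb. The two results agree because Tr γ(FW
+ WF) = 0 for W = a₀ R [F,a₁] R ⋯ R. This does not follow from cyclicity directly, because FW alone
may lack the degree of a trace class operator; `linTrace_anticommutator` gains the missing degree by
inserting 1 = θ + F².

For the transgression, replace θ by the upper triangular matrix with θ on the diagonal and D = dF/dt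
in the corner. The corners of the matrix words are the words with D inserted, so the same formulas
for b and B, applied to matrices, write (b + B) Tch as the integral of Tr γ of an explicit
expression. On the other side, the difference quotient of a word equals that expression up to an
anticommutator (`word_sub_word`), whose trace tends to 0, again by `linTrace_anticommutator`. The
fundamental theorem of calculus gives the transgression formula.

The velocity has degree ε = 0 in general, and ε = 1 if it is continuous in ℒ^p; what is needed is p
≤ 2m - 1 + ε. For ε = 1 the difference quotients must converge in ℒ^p, which rests on a bound for
the ℒ^p-norm of an integral, p > 1 (`exists_eNorm_integral_le`). For p ≤ 1 the second condition on m
implies the first.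

The analysis starts from approximation numbers: a dyadic decomposition bounds the trace by the trace
norm, and density of finite rank operators yields cyclicity. -/

lemma singularValue_nonneg (T : H →L[ℂ] H) (n : ℕ) : 0 ≤ singularValue T n :=
  Metric.infDist_nonneg

lemma singularValue_le_norm_sub {T R : H →L[ℂ] H} {n : ℕ}
    (hR : LinearMap.rank (R : H →ₗ[ℂ] H) ≤ (n : Cardinal)) : singularValue T n ≤ ‖T - R‖ := by
  rw [← dist_eq_norm]
  exact Metric.infDist_le_dist_of_mem hR

lemma exists_rank_le_norm_sub_lt (T : H →L[ℂ] H) (n : ℕ) {ε : ℝ} (hε : 0 < ε) :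
    ∃ R : H →L[ℂ] H, LinearMap.rank (R : H →ₗ[ℂ] H) ≤ (n : Cardinal) ∧
      ‖T - R‖ < singularValue T n + ε := by
  have hne : {R : H →L[ℂ] H | LinearMap.rank (R : H →ₗ[ℂ] H) ≤ (n : Cardinal)}.Nonempty :=
    ⟨0, by simp⟩
  obtain ⟨R, hR, h⟩ := (Metric.infDist_lt_iff (x := T) hne).1
    (show Metric.infDist T _ < singularValue T n + ε from lt_add_of_pos_right _ hε)
  exact ⟨R, hR, by rwa [dist_eq_norm] at h⟩

lemma singularValue_antitone (T : H →L[ℂ] H) : Antitone (singularValue T) := by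
  intro m n h
  refine le_of_forall_pos_le_add fun ε hε => ?_
  obtain ⟨R, hR, hT⟩ := exists_rank_le_norm_sub_lt T m hε
  exact (singularValue_le_norm_sub (hR.trans (by exact_mod_cast h))).trans hT.le

lemma singularValue_zero (T : H →L[ℂ] H) : singularValue T 0 = ‖T‖ := by
  refine le_antisymm ?_ ?_
  · simpa using singularValue_le_norm_sub (T := T) (R := 0) (n := 0) (by simp)
  · refine le_of_forall_pos_le_add fun ε hε => ?_
    obtain ⟨R, hR, hT⟩ := exists_rank_le_norm_sub_lt T 0 hε
    have : (R : H →ₗ[ℂ] H) = 0 := by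
      rw [← LinearMap.range_eq_bot, ← Submodule.rank_eq_zero (R := ℂ)]
      exact le_antisymm (by simpa [LinearMap.rank] using hR) zero_le
    have h0 : R = 0 := by
      ext x
      exact congrArg (fun f : H →ₗ[ℂ] H => f x) this
    subst h0
    simpa using hT.le

lemma singularValue_le_norm (T : H →L[ℂ] H) (n : ℕ) : singularValue T n ≤ ‖T‖ :=
  (singularValue_antitone T (Nat.zero_le n)).trans (singularValue_zero T).le

lemma singularValue_add_le (S T : H →L[ℂ] H) (m n : ℕ) :
    singularValue (S + T) (m + n) ≤ singularValue S m + singularValue T n := by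
  refine le_of_forall_pos_le_add fun ε hε => ?_
  obtain ⟨P, hP, hS⟩ := exists_rank_le_norm_sub_lt S m (half_pos hε)
  obtain ⟨Q, hQ, hT⟩ := exists_rank_le_norm_sub_lt T n (half_pos hε)
  have hr : LinearMap.rank ((P + Q : H →L[ℂ] H) : H →ₗ[ℂ] H) ≤ ((m + n : ℕ) : Cardinal) := by
    push_cast
    exact (LinearMap.rank_add_le _ _).trans (add_le_add hP hQ)
  have h1 := singularValue_le_norm_sub (T := S + T) hr
  have h2 : ‖S + T - (P + Q)‖ ≤ ‖S - P‖ + ‖T - Q‖ := by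
    rw [add_sub_add_comm]
    exact norm_add_le _ _
  linarith

lemma rank_mul_le_left (S T : H →L[ℂ] H) :
    LinearMap.rank ((S * T : H →L[ℂ] H) : H →ₗ[ℂ] H) ≤ LinearMap.rank (S : H →ₗ[ℂ] H) :=
  LinearMap.rank_comp_le_left (T : H →ₗ[ℂ] H) (S : H →ₗ[ℂ] H)

lemma rank_mul_le_right (S T : H →L[ℂ] H) :
    LinearMap.rank ((S * T : H →L[ℂ] H) : H →ₗ[ℂ] H) ≤ LinearMap.rank (T : H →ₗ[ℂ] H) :=
  LinearMap.rank_comp_le_right (T : H →ₗ[ℂ] H) (S : H →ₗ[ℂ] H)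

/-- If P and Q approximate S and T, then PT + (S - P)Q has rank at most m + n and misses ST by
exactly (S - P)(T - Q). -/
lemma singularValue_mul_le (S T : H →L[ℂ] H) (m n : ℕ) :
    singularValue (S * T) (m + n) ≤ singularValue S m * singularValue T n := by
  have key : ∀ ε > 0, singularValue (S * T) (m + n) ≤
      (singularValue S m + ε) * (singularValue T n + ε) := by
    intro ε hε
    obtain ⟨P, hP, hS⟩ := exists_rank_le_norm_sub_lt S m hε
    obtain ⟨Q, hQ, hT⟩ := exists_rank_le_norm_sub_lt T n hε
    have hr : LinearMap.rank ((P * T + (S - P) * Q : H →L[ℂ] H) : H →ₗ[ℂ] H) ≤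
        ((m + n : ℕ) : Cardinal) := by
      push_cast
      refine (LinearMap.rank_add_le _ _).trans (add_le_add ?_ ?_)
      · exact (rank_mul_le_left P T).trans hP
      · exact (rank_mul_le_right (S - P) Q).trans hQ
    have h1 := singularValue_le_norm_sub (T := S * T) hr
    have h2 : S * T - (P * T + (S - P) * Q) = (S - P) * (T - Q) := by noncomm_ring
    rw [h2] at h1
    refine h1.trans ((norm_mul_le _ _).trans ?_)
    exact mul_le_mul hS.le hT.le (norm_nonneg _)
      (add_nonneg (singularValue_nonneg _ _) hε.le)
  have hlim : Tendsto (fun ε : ℝ => (singularValue S m + ε) * (singularValue T n + ε))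
      (𝓝[>] 0) (𝓝 ((singularValue S m + 0) * (singularValue T n + 0))) := by
    refine Tendsto.mono_left (Continuous.tendsto (by fun_prop) 0) nhdsWithin_le_nhds
  rw [add_zero, add_zero] at hlim
  refine ge_of_tendsto hlim ?_
  filter_upwards [self_mem_nhdsWithin] with ε hε using key ε hε

lemma singularValue_mul_le_norm_mul (S T : H →L[ℂ] H) (n : ℕ) :
    singularValue (S * T) n ≤ ‖S‖ * singularValue T n := by
  simpa [singularValue_zero] using singularValue_mul_le S T 0 n

lemma singularValue_mul_le_mul_norm (S T : H →L[ℂ] H) (n : ℕ) :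
    singularValue (S * T) n ≤ singularValue S n * ‖T‖ := by
  simpa [singularValue_zero] using singularValue_mul_le S T n 0

/-! ### Schatten quasi-norms -/

/-- `∑ s_n(T)^p`. -/
def powSum (p : ℝ) (T : H →L[ℂ] H) : ℝ≥0∞ := ∑' n, ENNReal.ofReal (singularValue T n) ^ p

lemma eNorm_eq (p : ℝ) (T : H →L[ℂ] H) : eNorm p T = powSum p T ^ (1 / p) := rfl

lemma powSum_eq {p : ℝ} (hp : 0 < p) (T : H →L[ℂ] H) : powSum p T = eNorm p T ^ p := by
  rw [eNorm_eq, ← ENNReal.rpow_mul, one_div_mul_cancel hp.ne', ENNReal.rpow_one]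

/-- The inequalities for sums and products bound s_(n+n) by s_n of the two operators, so they see
only even indices; monotonicity recovers the odd ones at the cost of a factor 2. -/
lemma tsum_le_two_mul_tsum_even {f : ℕ → ℝ≥0∞} (hf : Antitone f) :
    ∑' n, f n ≤ 2 * ∑' n, f (n + n) := by
  have h : ∑' n, f (2 * n + 1) ≤ ∑' n, f (2 * n) := ENNReal.tsum_le_tsum fun n => hf (Nat.le_succ _)
  rw [← tsum_even_add_odd (f := f) ENNReal.summable ENNReal.summable]
  simp only [← two_mul]
  exact (add_le_add le_rfl h).trans (two_mul _).ge

lemma ofReal_singularValue_rpow_antitone {p : ℝ} (hp : 0 ≤ p) (T : H →L[ℂ] H) :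
    Antitone fun n => ENNReal.ofReal (singularValue T n) ^ p := fun _ _ h =>
  ENNReal.rpow_le_rpow (ENNReal.ofReal_le_ofReal (singularValue_antitone T h)) hp

lemma ENNReal_add_rpow_le {q : ℝ} (hq : 0 < q) (x y : ℝ≥0∞) :
    (x + y) ^ q ≤ 2 ^ q * (x ^ q + y ^ q) := by
  have h : x + y ≤ 2 * max x y := by
    rw [two_mul]
    exact add_le_add (le_max_left _ _) (le_max_right _ _)
  calc (x + y) ^ q ≤ (2 * max x y) ^ q := ENNReal.rpow_le_rpow h hq.le
    _ = 2 ^ q * max x y ^ q := ENNReal.mul_rpow_of_nonneg _ _ hq.le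
    _ ≤ 2 ^ q * (x ^ q + y ^ q) := by
      gcongr
      rcases le_total x y with h | h
      · rw [max_eq_right h]; exact le_add_self
      · rw [max_eq_left h]; exact le_self_add

lemma powSum_add_le {p : ℝ} (hp : 0 < p) (S T : H →L[ℂ] H) :
    powSum p (S + T) ≤ 2 * 2 ^ p * (powSum p S + powSum p T) := by
  refine (tsum_le_two_mul_tsum_even (ofReal_singularValue_rpow_antitone hp.le _)).trans ?_
  rw [mul_assoc]
  refine mul_le_mul' le_rfl ?_
  rw [powSum, powSum, ← ENNReal.tsum_add, ← ENNReal.tsum_mul_left]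
  refine ENNReal.tsum_le_tsum fun n => ?_
  refine le_trans ?_ (ENNReal_add_rpow_le hp _ _)
  refine ENNReal.rpow_le_rpow ?_ hp.le
  rw [← ENNReal.ofReal_add (singularValue_nonneg _ _) (singularValue_nonneg _ _)]
  exact ENNReal.ofReal_le_ofReal (singularValue_add_le S T n n)

lemma exists_eNorm_add_le {p : ℝ} (hp : 0 < p) :
    ∃ C : ℝ≥0∞, C ≠ ∞ ∧ ∀ S T : H →L[ℂ] H, eNorm p (S + T) ≤ C * (eNorm p S + eNorm p T) := by
  have hp' : 0 < 1 / p := one_div_pos.2 hp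
  refine ⟨(2 * 2 ^ p) ^ (1 / p) * 2 ^ (1 / p), ?_, fun S T => ?_⟩
  · refine ENNReal.mul_ne_top (ENNReal.rpow_ne_top_of_nonneg hp'.le ?_)
      (ENNReal.rpow_ne_top_of_nonneg hp'.le (by simp))
    exact ENNReal.mul_ne_top (by simp) (ENNReal.rpow_ne_top_of_nonneg hp.le (by simp))
  · rw [eNorm_eq, eNorm_eq, eNorm_eq]
    calc powSum p (S + T) ^ (1 / p)
        ≤ (2 * 2 ^ p * (powSum p S + powSum p T)) ^ (1 / p) :=
          ENNReal.rpow_le_rpow (powSum_add_le hp S T) hp'.le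
      _ = (2 * 2 ^ p) ^ (1 / p) * (powSum p S + powSum p T) ^ (1 / p) :=
          ENNReal.mul_rpow_of_nonneg _ _ hp'.le
      _ ≤ (2 * 2 ^ p) ^ (1 / p) * (2 ^ (1 / p) *
            (powSum p S ^ (1 / p) + powSum p T ^ (1 / p))) := by
          gcongr
          exact ENNReal_add_rpow_le hp' _ _
      _ = _ := by rw [mul_assoc]

/-- Hölder's inequality in the sequence spaces, applied to s_(n+n)(ST) ≤ s_n(S) s_n(T). -/
lemma exists_eNorm_mul_le {p q r : ℝ} (hr : 0 < r) (hrp : r < p) (h : 1 / r = 1 / p + 1 / q) :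
    ∃ C : ℝ≥0∞, C ≠ ∞ ∧ ∀ S T : H →L[ℂ] H, eNorm r (S * T) ≤ C * (eNorm p S * eNorm q T) := by
  have hr' : 0 < 1 / r := one_div_pos.2 hr
  refine ⟨2 ^ (1 / r), ENNReal.rpow_ne_top_of_nonneg hr'.le (by simp), fun S T => ?_⟩
  have h1 : powSum r (S * T) ≤ 2 * ∑' n, (ENNReal.ofReal (singularValue S n) *
      ENNReal.ofReal (singularValue T n)) ^ r := by
    refine (tsum_le_two_mul_tsum_even (ofReal_singularValue_rpow_antitone hr.le _)).trans ?_
    gcongr with n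
    rw [← ENNReal.ofReal_mul (singularValue_nonneg _ _)]
    exact ENNReal.ofReal_le_ofReal (singularValue_mul_le S T n n)
  have h2 := ENNReal.lintegral_Lp_mul_le_Lq_mul_Lr hr hrp h MeasureTheory.Measure.count
    (f := fun n => ENNReal.ofReal (singularValue S n))
    (g := fun n => ENNReal.ofReal (singularValue T n))
    (measurable_of_countable _).aemeasurable (measurable_of_countable _).aemeasurable
  simp only [MeasureTheory.lintegral_count, Pi.mul_apply] at h2
  rw [eNorm_eq]
  refine (ENNReal.rpow_le_rpow h1 hr'.le).trans ?_
  rw [ENNReal.mul_rpow_of_nonneg _ _ hr'.le]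
  gcongr
  exact h2

lemma ofReal_singularValue_le_eNorm {p : ℝ} (hp : 0 < p) (T : H →L[ℂ] H) (n : ℕ) :
    ENNReal.ofReal (singularValue T n) ≤ eNorm p T := by
  have h := ENNReal.rpow_le_rpow (ENNReal.le_tsum (f := fun n =>
    ENNReal.ofReal (singularValue T n) ^ p) n) (one_div_pos.2 hp).le
  rwa [← ENNReal.rpow_mul, mul_one_div_cancel hp.ne', ENNReal.rpow_one] at h

lemma enorm_le_eNorm {p : ℝ} (hp : 0 < p) (T : H →L[ℂ] H) : ‖T‖ₑ ≤ eNorm p T := by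
  rw [← ofReal_norm, ← singularValue_zero]
  exact ofReal_singularValue_le_eNorm hp T 0

/-- Every singular value is at most the p-norm, so s^q = s^(q-p) s^p can be summed. -/
lemma eNorm_anti {p q : ℝ} (hp : 0 < p) (hpq : p ≤ q) (T : H →L[ℂ] H) :
    eNorm q T ≤ eNorm p T := by
  have hq := hp.trans_le hpq
  have h : powSum q T ≤ eNorm p T ^ q := by
    calc powSum q T = ∑' n, ENNReal.ofReal (singularValue T n) ^ (q - p) *
          ENNReal.ofReal (singularValue T n) ^ p := by
          refine tsum_congr fun n => ?_
          rw [← ENNReal.rpow_add_of_nonneg _ _ (sub_nonneg.2 hpq) hp.le, sub_add_cancel]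
      _ ≤ ∑' n, eNorm p T ^ (q - p) * ENNReal.ofReal (singularValue T n) ^ p := by
          gcongr with n
          exact ofReal_singularValue_le_eNorm hp T n
      _ = eNorm p T ^ (q - p) * eNorm p T ^ p := by
          rw [ENNReal.tsum_mul_left, ← powSum_eq hp]; rfl
      _ = eNorm p T ^ q := by
          rw [← ENNReal.rpow_add_of_nonneg _ _ (sub_nonneg.2 hpq) hp.le, sub_add_cancel]
  rw [eNorm_eq]
  refine (ENNReal.rpow_le_rpow h (one_div_pos.2 hq).le).trans ?_
  rw [← ENNReal.rpow_mul, mul_one_div_cancel hq.ne', ENNReal.rpow_one]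

lemma eNorm_le_enorm_mul {p : ℝ} (hp : 0 < p) {S T : H →L[ℂ] H} {c : ℝ} (hc : 0 ≤ c)
    (h : ∀ n, singularValue S n ≤ c * singularValue T n) :
    eNorm p S ≤ ENNReal.ofReal c * eNorm p T := by
  have hp' : 0 < 1 / p := one_div_pos.2 hp
  have h1 : powSum p S ≤ ENNReal.ofReal c ^ p * powSum p T := by
    rw [powSum, powSum, ← ENNReal.tsum_mul_left]
    refine ENNReal.tsum_le_tsum fun n => ?_
    rw [← ENNReal.mul_rpow_of_nonneg _ _ hp.le, ← ENNReal.ofReal_mul hc]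
    exact ENNReal.rpow_le_rpow (ENNReal.ofReal_le_ofReal (h n)) hp.le
  rw [eNorm_eq, eNorm_eq]
  refine (ENNReal.rpow_le_rpow h1 hp'.le).trans ?_
  rw [ENNReal.mul_rpow_of_nonneg _ _ hp'.le, ← ENNReal.rpow_mul, mul_one_div_cancel hp.ne',
    ENNReal.rpow_one]

lemma eNorm_mul_le_enorm_mul {p : ℝ} (hp : 0 < p) (S T : H →L[ℂ] H) :
    eNorm p (S * T) ≤ ‖S‖ₑ * eNorm p T := by
  rw [← ofReal_norm]
  exact eNorm_le_enorm_mul hp (norm_nonneg _) (singularValue_mul_le_norm_mul S T)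

lemma eNorm_mul_le_mul_enorm {p : ℝ} (hp : 0 < p) (S T : H →L[ℂ] H) :
    eNorm p (S * T) ≤ eNorm p S * ‖T‖ₑ := by
  rw [← ofReal_norm, mul_comm]
  refine eNorm_le_enorm_mul hp (norm_nonneg _) fun n => ?_
  rw [mul_comm]
  exact singularValue_mul_le_mul_norm S T n

lemma eNorm_zero {p : ℝ} (hp : 0 < p) : eNorm p (0 : H →L[ℂ] H) = 0 := by
  have h := eNorm_mul_le_enorm_mul hp (0 : H →L[ℂ] H) 0
  rw [← ofReal_norm, norm_zero, ENNReal.ofReal_zero, zero_mul, zero_mul] at h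
  exact le_antisymm h zero_le

end Schatten

/-! ### Matrix coefficients and the trace norm -/

namespace Schatten

variable {H : Type*} [NormedAddCommGroup H] [InnerProductSpace ℂ H] [CompleteSpace H]

open InnerProductSpace in
-- Expand R v in an orthonormal basis f_j of the range; the coefficients are ⟪R* f_j, v⟫.
lemma exists_eq_sum_rankOne {R : H →L[ℂ] H} {r : ℕ}
    (hR : LinearMap.rank (R : H →ₗ[ℂ] H) ≤ (r : Cardinal)) :
    ∃ n ≤ r, ∃ f g : Fin n → H, (∀ j, ‖f j‖ ≤ 1) ∧ (∀ j, ‖g j‖ ≤ ‖R‖) ∧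
      R = ∑ j, rankOne ℂ (f j) (g j) := by
  have hfin : FiniteDimensional ℂ (LinearMap.range (R : H →ₗ[ℂ] H)) :=
    Module.rank_lt_aleph0_iff.1 (hR.trans_lt (Cardinal.natCast_lt_aleph0 (n := r)))
  let f := stdOrthonormalBasis ℂ (LinearMap.range (R : H →ₗ[ℂ] H))
  have hf : ∀ j, ‖(f j : H)‖ = 1 := fun j => f.orthonormal.1 j
  refine ⟨Module.finrank ℂ (LinearMap.range (R : H →ₗ[ℂ] H)), ?_, fun j => (f j : H),
    fun j => ContinuousLinearMap.adjoint R (f j : H), fun j => (hf j).le, fun j => ?_, ?_⟩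
  · have h := hR
    rw [LinearMap.rank, ← Module.finrank_eq_rank] at h
    exact_mod_cast h
  · refine (ContinuousLinearMap.le_opNorm _ _).trans ?_
    rw [hf j, mul_one, LinearIsometryEquiv.norm_map]
  · ext v
    have h := congrArg (Subtype.val) (f.sum_repr' ⟨R v, LinearMap.mem_range_self (R : H →ₗ[ℂ] H) v⟩)
    simp only [Submodule.coe_inner, AddSubmonoidClass.coe_finsetSum, Submodule.coe_smul] at h
    rw [sum_apply]
    simp only [rankOne_apply, ContinuousLinearMap.adjoint_inner_left]
    exact h.symm

lemma sum_norm_inner_mul_le {ι : Type*} {v w : ι → H} (hv : Orthonormal ℂ v)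
    (hw : Orthonormal ℂ w) (s : Finset ι) (x y : H) :
    ∑ i ∈ s, ‖inner ℂ (v i) x‖ * ‖inner ℂ (w i) y‖ ≤ ‖x‖ * ‖y‖ := by
  refine (Real.sum_mul_le_sqrt_mul_sqrt s _ _).trans ?_
  refine mul_le_mul ?_ ?_ (Real.sqrt_nonneg _) (norm_nonneg _)
  · exact Real.sqrt_le_iff.2 ⟨norm_nonneg _, hv.sum_inner_products_le x⟩
  · exact Real.sqrt_le_iff.2 ⟨norm_nonneg _, hw.sum_inner_products_le y⟩

open InnerProductSpace in
lemma sum_norm_inner_le_rank_mul_norm {ι : Type*} {v w : ι → H} (hv : Orthonormal ℂ v)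
    (hw : Orthonormal ℂ w) (s : Finset ι) {R : H →L[ℂ] H} {r : ℕ}
    (hR : LinearMap.rank (R : H →ₗ[ℂ] H) ≤ (r : Cardinal)) :
    ∑ i ∈ s, ‖inner ℂ (w i) (R (v i))‖ ≤ r * ‖R‖ := by
  obtain ⟨n, hn, f, g, hf, hg, h⟩ := exists_eq_sum_rankOne hR
  calc ∑ i ∈ s, ‖inner ℂ (w i) (R (v i))‖
      ≤ ∑ i ∈ s, ∑ j, ‖inner ℂ (v i) (g j)‖ * ‖inner ℂ (w i) (f j)‖ := by
        refine Finset.sum_le_sum fun i _ => ?_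
        conv_lhs => rw [h]
        rw [sum_apply, inner_sum]
        refine (norm_sum_le _ _).trans (Finset.sum_le_sum fun j _ => ?_)
        rw [rankOne_apply, inner_smul_right, norm_mul, norm_inner_symm]
    _ = ∑ j, ∑ i ∈ s, ‖inner ℂ (v i) (g j)‖ * ‖inner ℂ (w i) (f j)‖ := Finset.sum_comm
    _ ≤ ∑ j : Fin n, ‖R‖ := by
        refine Finset.sum_le_sum fun j _ => (sum_norm_inner_mul_le hv hw s _ _).trans ?_
        have := mul_le_mul (hg j) (hf j) (norm_nonneg _) (norm_nonneg _)
        rwa [mul_one] at this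
    _ ≤ r * ‖R‖ := by
        rw [Finset.sum_const, Finset.card_univ, Fintype.card_fin, nsmul_eq_mul]
        have : (n : ℝ) ≤ r := by exact_mod_cast hn
        gcongr

lemma sum_norm_inner_le_card_mul_norm {ι : Type*} {v w : ι → H} (hv : Orthonormal ℂ v)
    (hw : Orthonormal ℂ w) (s : Finset ι) (T : H →L[ℂ] H) :
    ∑ i ∈ s, ‖inner ℂ (w i) (T (v i))‖ ≤ s.card * ‖T‖ := by
  rw [← nsmul_eq_mul]
  refine Finset.sum_le_card_nsmul _ _ _ fun i _ => ?_
  refine (norm_inner_le_norm _ _).trans ?_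
  rw [hw.1 i, one_mul]
  exact (T.le_opNorm _).trans (by rw [hv.1 i, mul_one])

lemma eNorm_one (T : H →L[ℂ] H) : eNorm 1 T = ∑' n, ENNReal.ofReal (singularValue T n) := by
  simp [eNorm]

lemma summable_singularValue {T : H →L[ℂ] H} (hT : eNorm 1 T ≠ ∞) :
    Summable (singularValue T) := by
  rw [eNorm_one] at hT
  have h := ENNReal.summable_toReal hT
  simpa only [ENNReal.toReal_ofReal (singularValue_nonneg T _)] using h

lemma tsum_singularValue {T : H →L[ℂ] H} (hT : eNorm 1 T ≠ ∞) :
    ∑' n, singularValue T n = (eNorm 1 T).toReal := by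
  rw [eNorm_one, ← ENNReal.ofReal_tsum_of_nonneg (singularValue_nonneg T)
    (summable_singularValue hT), ENNReal.toReal_ofReal (tsum_nonneg (singularValue_nonneg T))]

/-- The sum of the moduli of matrix coefficients with respect to two orthonormal families is
controlled by the trace norm. -/
lemma sum_norm_inner_le_eNorm_one {ι : Type*} {v w : ι → H} (hv : Orthonormal ℂ v)
    (hw : Orthonormal ℂ w) (s : Finset ι) {T : H →L[ℂ] H} (hT : eNorm 1 T ≠ ∞) :
    ∑ i ∈ s, ‖inner ℂ (w i) (T (v i))‖ ≤ 14 * (eNorm 1 T).toReal := by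
  set Φ : (H →L[ℂ] H) → ℝ := fun A => ∑ i ∈ s, ‖inner ℂ (w i) (A (v i))‖ with hΦ
  have hadd : ∀ A B, Φ (A + B) ≤ Φ A + Φ B := fun A B => by
    simp only [hΦ]
    rw [← Finset.sum_add_distrib]
    refine Finset.sum_le_sum fun i _ => ?_
    rw [add_apply, inner_add_right]
    exact norm_add_le _ _
  set a := singularValue T with ha
  set S := ∑' n, a n with hS
  have hsum := summable_singularValue hT
  have ha0 : ∀ n, 0 ≤ a n := singularValue_nonneg T
  -- At the level 2^K, which exceeds the number of coefficients, the crude bound by cardinality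
  -- times norm suffices for the remainder.
  obtain ⟨K, hK⟩ : ∃ K, s.card ≤ 2 ^ K := ⟨s.card, Nat.lt_two_pow_self.le⟩
  -- Telescoping over dyadic approximants: near-best approximants of rank 2^n and 2^(n+1) differ by
  -- an operator of rank at most 3·2^n and norm at most 2 s_(2^n) + 2ε, to which the finite rank
  -- bound applies.
  have step : ∀ ε > 0, ∀ n, ∀ A : H →L[ℂ] H,
      LinearMap.rank (A : H →ₗ[ℂ] H) ≤ ((2 ^ n : ℕ) : Cardinal) → ‖T - A‖ < a (2 ^ n) + ε →
      Φ A ≤ 2 * a 0 + ε + ∑ k ∈ Finset.range n, (3 * 2 ^ k) * (2 * a (2 ^ k) + 2 * ε) := by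
    intro ε hε n
    induction n with
    | zero =>
      intro A hA hTA
      have h1 := sum_norm_inner_le_rank_mul_norm hv hw s hA
      have h2 : ‖A‖ ≤ ‖T‖ + ‖T - A‖ := by
        have := norm_sub_le T (T - A)
        rwa [sub_sub_cancel] at this
      have h3 : a (2 ^ 0) ≤ a 0 := singularValue_antitone T (Nat.zero_le _)
      have h4 : a 0 = ‖T‖ := singularValue_zero T
      simp only [pow_zero, Nat.cast_one, one_mul] at h1 h3 hTA
      simp only [Finset.range_zero, Finset.sum_empty, add_zero]
      exact h1.trans (by linarith)
    | succ n ih =>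
      intro A hA hTA
      obtain ⟨R, hR, hTR⟩ := exists_rank_le_norm_sub_lt T (2 ^ n) hε
      have h0 := ih R hR hTR
      have hr : LinearMap.rank ((A - R : H →L[ℂ] H) : H →ₗ[ℂ] H) ≤
          ((3 * 2 ^ n : ℕ) : Cardinal) := by
        have h5 : LinearMap.rank ((-R : H →L[ℂ] H) : H →ₗ[ℂ] H) ≤ ((2 ^ n : ℕ) : Cardinal) := by
          refine le_trans ?_ hR
          have := rank_mul_le_right (-1 : H →L[ℂ] H) R
          rwa [neg_one_mul] at this
        have h6 := (LinearMap.rank_add_le (A : H →ₗ[ℂ] H) ((-R : H →L[ℂ] H) : H →ₗ[ℂ] H)).trans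
          (add_le_add hA h5)
        rw [sub_eq_add_neg]
        refine h6.trans (le_of_eq ?_)
        rw [← Nat.cast_add]
        congr 1
        ring
      have h1 := sum_norm_inner_le_rank_mul_norm hv hw s hr
      have h2 : ‖A - R‖ ≤ 2 * a (2 ^ n) + 2 * ε := by
        have h7 : A - R = (T - R) - (T - A) := by abel
        have h8 := norm_sub_le (T - R) (T - A)
        have h9 : a (2 ^ (n + 1)) ≤ a (2 ^ n) :=
          singularValue_antitone T (Nat.pow_le_pow_right two_pos (Nat.le_succ n))
        rw [h7]
        linarith
      have h3 : Φ A ≤ Φ R + Φ (A - R) := by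
        have := hadd R (A - R)
        rwa [add_sub_cancel] at this
      rw [Finset.sum_range_succ]
      push_cast at h1
      have h10 := mul_le_mul_of_nonneg_left h2 (show (0 : ℝ) ≤ 3 * 2 ^ n by positivity)
      have h11 : Φ (A - R) ≤ 3 * 2 ^ n * ‖A - R‖ := h1
      linarith
  -- Cauchy condensation: the dyadic sum is comparable with the full sum of singular values.
  have hcond : ∑ k ∈ Finset.range (K + 1), 2 ^ k * a (2 ^ k) ≤ 2 * S := by
    have h := Finset.sum_condensed_le (f := a)
      (fun m n _ hmn => singularValue_antitone T hmn) K
    simp only [nsmul_eq_mul, Nat.cast_pow, Nat.cast_ofNat] at h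
    have h1 : a 1 + ∑ k ∈ Finset.Ico 2 (2 ^ K + 1), a k ≤ S := by
      have : a 1 + ∑ k ∈ Finset.Ico 2 (2 ^ K + 1), a k =
          ∑ k ∈ insert 1 (Finset.Ico 2 (2 ^ K + 1)), a k :=
        (Finset.sum_insert (by simp)).symm
      rw [this]
      exact hsum.sum_le_tsum _ fun i _ => ha0 i
    have h2 := ha0 1
    linarith
  -- The constant is 14 = 2 + 6·2: 2 s_0 from the first approximant, and 6 times the condensed sum,
  -- whose last term also pays for the remainder.
  have hfin : ∀ ε > 0, Φ T ≤ 14 * S + ε * (1 + 6 * (∑ k ∈ Finset.range K, 2 ^ k) + 2 ^ K) := by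
    intro ε hε
    obtain ⟨A, hA, hTA⟩ := exists_rank_le_norm_sub_lt T (2 ^ K) hε
    have h1 := step ε hε K A hA hTA
    have h2 := sum_norm_inner_le_card_mul_norm hv hw s (T - A)
    have h3 : (s.card : ℝ) * ‖T - A‖ ≤ 2 ^ K * (a (2 ^ K) + ε) := by
      have : (s.card : ℝ) ≤ 2 ^ K := by exact_mod_cast hK
      gcongr
    have h4 : Φ T ≤ Φ A + Φ (T - A) := by
      have := hadd A (T - A)
      rwa [add_sub_cancel] at this
    have h5 : ∑ k ∈ Finset.range K, (3 * 2 ^ k) * (2 * a (2 ^ k) + 2 * ε) =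
        6 * ∑ k ∈ Finset.range K, 2 ^ k * a (2 ^ k) + 6 * ε * ∑ k ∈ Finset.range K, 2 ^ k := by
      rw [Finset.mul_sum, Finset.mul_sum, ← Finset.sum_add_distrib]
      exact Finset.sum_congr rfl fun k _ => by ring
    have h6 : a 0 ≤ S := hsum.le_tsum 0 fun i _ => ha0 i
    rw [Finset.sum_range_succ] at hcond
    have h7 : 0 ≤ 2 ^ K * a (2 ^ K) := mul_nonneg (by positivity) (ha0 _)
    have h8 : Φ (T - A) ≤ s.card * ‖T - A‖ := h2
    rw [h5] at h1
    nlinarith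
  rw [← tsum_singularValue hT]
  refine le_of_forall_pos_le_add fun ε hε => ?_
  set c : ℝ := 1 + 6 * (∑ k ∈ Finset.range K, 2 ^ k) + 2 ^ K with hc
  have hc0 : 0 < c := by positivity
  have := hfin (ε / c) (div_pos hε hc0)
  rwa [div_mul_cancel₀ _ hc0.ne'] at this

end Schatten

namespace Schatten

variable {H : Type*} [NormedAddCommGroup H] [InnerProductSpace ℂ H] [CompleteSpace H]

/-! ### The trace -/

variable (H) in
/-- The index set of the orthonormal basis that defines the trace. -/
def traceIndex : Set H := (exists_hilbertBasis ℂ H).choose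

variable (H) in
/-- The orthonormal basis that defines the trace. -/
def traceBasis : HilbertBasis (traceIndex H) ℂ H :=
  (exists_hilbertBasis ℂ H).choose_spec.choose

lemma trace_eq (T : H →L[ℂ] H) :
    trace T = ∑' i, inner ℂ (traceBasis H i) (T (traceBasis H i)) := rfl

/-- The series that defines the trace of `T` converges. -/
def Traceable (T : H →L[ℂ] H) : Prop :=
  Summable fun i => inner ℂ (traceBasis H i) (T (traceBasis H i))

lemma traceable_of_eNorm_one {T : H →L[ℂ] H} (hT : eNorm 1 T ≠ ∞) : Traceable T := by
  refine Summable.of_norm (summable_of_sum_le (c := 14 * (eNorm 1 T).toReal)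
    (fun _ => norm_nonneg _) fun s => ?_)
  exact sum_norm_inner_le_eNorm_one (traceBasis H).orthonormal (traceBasis H).orthonormal s hT

lemma norm_trace_le {T : H →L[ℂ] H} (hT : eNorm 1 T ≠ ∞) :
    ‖trace T‖ ≤ 14 * (eNorm 1 T).toReal := by
  have h := fun s => sum_norm_inner_le_eNorm_one (traceBasis H).orthonormal
    (traceBasis H).orthonormal s hT
  refine (norm_tsum_le_tsum_norm (summable_of_sum_le (fun _ => norm_nonneg _) h)).trans ?_
  exact tsum_le_of_sum_le' (by positivity) h

lemma Traceable.add {S T : H →L[ℂ] H} (hS : Traceable S) (hT : Traceable T) :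
    Traceable (S + T) := by
  simpa only [Traceable, add_apply, inner_add_right] using Summable.add hS hT

lemma trace_add {S T : H →L[ℂ] H} (hS : Traceable S) (hT : Traceable T) :
    trace (S + T) = trace S + trace T := by
  simp only [trace_eq, add_apply, inner_add_right]
  exact Summable.tsum_add hS hT

lemma trace_smul (c : ℂ) (T : H →L[ℂ] H) : trace (c • T) = c * trace T := by
  simp only [trace_eq, smul_apply, inner_smul_right]
  exact tsum_mul_left

lemma trace_neg (T : H →L[ℂ] H) : trace (-T) = -trace T := by
  simpa using trace_smul (-1) T

lemma Traceable.neg {T : H →L[ℂ] H} (hT : Traceable T) : Traceable (-T) := by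
  have : Summable _ := Summable.neg hT
  simpa only [Traceable, neg_apply, inner_neg_right] using this

open InnerProductSpace in
lemma hasSum_inner_mul_rankOne (X : H →L[ℂ] H) (x y : H) :
    HasSum (fun i => inner ℂ (traceBasis H i) ((X * rankOne ℂ x y) (traceBasis H i)))
      (inner ℂ y (X x)) := by
  refine ((traceBasis H).hasSum_inner_mul_inner y (X x)).congr_fun fun i => ?_
  rw [mul_apply_eq_comp, rankOne_apply, map_smul, inner_smul_right]

open InnerProductSpace in
lemma hasSum_inner_rankOne_mul (X : H →L[ℂ] H) (x y : H) :
    HasSum (fun i => inner ℂ (traceBasis H i) ((rankOne ℂ x y * X) (traceBasis H i)))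
      (inner ℂ y (X x)) := by
  have h := (traceBasis H).hasSum_inner_mul_inner (ContinuousLinearMap.adjoint X y) x
  rw [ContinuousLinearMap.adjoint_inner_left] at h
  refine h.congr_fun fun i => ?_
  rw [mul_apply_eq_comp, rankOne_apply, inner_smul_right,
    ContinuousLinearMap.adjoint_inner_left, mul_comm]

/-- The trace of a product with an operator of finite rank is cyclic. -/
lemma trace_mul_comm_of_rank (X : H →L[ℂ] H) {R : H →L[ℂ] H} {r : ℕ}
    (hR : LinearMap.rank (R : H →ₗ[ℂ] H) ≤ (r : Cardinal)) :
    Traceable (X * R) ∧ Traceable (R * X) ∧ trace (X * R) = trace (R * X) := by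
  obtain ⟨n, -, f, g, -, -, rfl⟩ := exists_eq_sum_rankOne hR
  have h1 := hasSum_sum fun j (_ : j ∈ Finset.univ) => hasSum_inner_mul_rankOne X (f j) (g j)
  have h2 := hasSum_sum fun j (_ : j ∈ Finset.univ) => hasSum_inner_rankOne_mul X (f j) (g j)
  simp only [← inner_sum, ← sum_apply, ← Finset.mul_sum, ← Finset.sum_mul] at h1 h2
  exact ⟨h1.summable, h2.summable, h1.tsum_eq.trans h2.tsum_eq.symm⟩

/-! ### Density of the operators of finite rank -/

lemma singularValue_sub_rank_le {T R : H →L[ℂ] H} {r : ℕ}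
    (hR : LinearMap.rank (R : H →ₗ[ℂ] H) ≤ (r : Cardinal)) (n : ℕ) :
    singularValue (T - R) (n + r) ≤ singularValue T n := by
  have h := singularValue_add_le T (-R) n r
  have h1 : singularValue (-R) r ≤ 0 := by
    have h2 := singularValue_mul_le_norm_mul (-1) R r
    rw [neg_one_mul] at h2
    refine h2.trans (mul_nonpos_of_nonneg_of_nonpos (norm_nonneg _) ?_)
    simpa using singularValue_le_norm_sub (T := R) hR
  rw [sub_eq_add_neg]
  linarith

/-- Everything is estimated by the tail of the series beyond M. The first 3M singular values of T -
R are at most its norm, about s_(2M)(T), and M s_(2M)^q is bounded by the block of indices from M to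
2M - 1. The others satisfy s_(n+3M)(T - R) ≤ s_(n+M)(T), because R has rank at most 2M. -/
lemma powSum_sub_rank_le {q : ℝ} (hq : 0 < q) {T R : H →L[ℂ] H} {M : ℕ} {ε : ℝ} (hε : 0 ≤ ε)
    (hR : LinearMap.rank (R : H →ₗ[ℂ] H) ≤ ((M + M : ℕ) : Cardinal))
    (hTR : ‖T - R‖ ≤ singularValue T (M + M) + ε) :
    powSum q (T - R) ≤ 3 * M * (2 ^ q * ENNReal.ofReal ε ^ q) +
      (3 * 2 ^ q + 1) * ∑' k, ENNReal.ofReal (singularValue T (k + M)) ^ q := by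
  set a : ℕ → ℝ≥0∞ := fun n => ENNReal.ofReal (singularValue T n) ^ q with ha
  have hanti : Antitone a := ofReal_singularValue_rpow_antitone hq.le T
  have hblock : (M : ℝ≥0∞) * a (M + M) ≤ ∑' k, a (k + M) := by
    calc (M : ℝ≥0∞) * a (M + M) = ∑ k ∈ Finset.range M, a (M + M) := by simp
      _ ≤ ∑ k ∈ Finset.range M, a (k + M) := by
        refine Finset.sum_le_sum fun k hk => hanti ?_
        have := Finset.mem_range.1 hk
        omega
      _ ≤ ∑' k, a (k + M) := ENNReal.sum_le_tsum _
  set b : ℕ → ℝ≥0∞ := fun n => ENNReal.ofReal (singularValue (T - R) n) ^ q with hb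
  have hhead : ∀ n, b n ≤ 2 ^ q * (a (M + M) + ENNReal.ofReal ε ^ q) := fun n => by
    refine le_trans ?_ (ENNReal_add_rpow_le hq _ _)
    refine ENNReal.rpow_le_rpow ?_ hq.le
    rw [← ENNReal.ofReal_add (singularValue_nonneg _ _) hε]
    exact ENNReal.ofReal_le_ofReal ((singularValue_le_norm _ _).trans hTR)
  have hrest : ∀ n, b (n + (M + (M + M))) ≤ a (n + M) := fun n => by
    refine ENNReal.rpow_le_rpow (ENNReal.ofReal_le_ofReal ?_) hq.le
    rw [← add_assoc]
    exact singularValue_sub_rank_le hR (n + M)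
  have hsplit : powSum q (T - R) =
      ∑ n ∈ Finset.range (M + (M + M)), b n + ∑' n, b (n + (M + (M + M))) :=
    (Summable.sum_add_tsum_nat_add' (f := b) ENNReal.summable).symm
  have hfin : ∑ n ∈ Finset.range (M + (M + M)), b n ≤
      3 * M * (2 ^ q * (a (M + M) + ENNReal.ofReal ε ^ q)) := by
    refine (Finset.sum_le_card_nsmul _ _ _ fun n _ => hhead n).trans (le_of_eq ?_)
    rw [Finset.card_range, nsmul_eq_mul]
    push_cast
    ring
  rw [hsplit]
  refine (add_le_add hfin (ENNReal.tsum_le_tsum hrest)).trans ?_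
  have h3 : 3 * (M : ℝ≥0∞) * (2 ^ q * (a (M + M) + ENNReal.ofReal ε ^ q)) =
      3 * M * (2 ^ q * ENNReal.ofReal ε ^ q) + 3 * 2 ^ q * (M * a (M + M)) := by ring
  rw [h3, add_assoc, add_mul, one_mul]
  gcongr

lemma exists_rank_powSum_sub_le {q : ℝ} (hq : 0 < q) {T : H →L[ℂ] H} (hT : powSum q T ≠ ∞)
    {δ : ℝ≥0∞} (hδ : δ ≠ 0) :
    ∃ (r : ℕ) (R : H →L[ℂ] H), LinearMap.rank (R : H →ₗ[ℂ] H) ≤ (r : Cardinal) ∧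
      powSum q (T - R) ≤ δ := by
  have htop : (2 : ℝ≥0∞) ^ q ≠ ∞ := ENNReal.rpow_ne_top_of_nonneg hq.le ENNReal.ofNat_ne_top
  have hδ2 : δ / 2 ≠ 0 := (ENNReal.half_pos hδ).ne'
  have h1 : Tendsto (fun M : ℕ => (3 * 2 ^ q + 1) *
      ∑' k, ENNReal.ofReal (singularValue T (k + M)) ^ q) atTop (𝓝 ((3 * 2 ^ q + 1) * 0)) :=
    ENNReal.Tendsto.const_mul (ENNReal.tendsto_sum_nat_add _ hT) (Or.inr
      (ENNReal.add_ne_top.2 ⟨ENNReal.mul_ne_top ENNReal.ofNat_ne_top htop, ENNReal.one_ne_top⟩))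
  rw [mul_zero] at h1
  -- The order matters: M is fixed by the tail, and only then is ε chosen small against the factor
  -- 3M.
  obtain ⟨M, hM⟩ := (h1.eventually (gt_mem_nhds (pos_iff_ne_zero.2 hδ2))).exists
  have h2 : Tendsto (fun x : ℝ => 3 * (M : ℝ≥0∞) * (2 ^ q * ENNReal.ofReal x ^ q))
      (𝓝[>] 0) (𝓝 (3 * M * (2 ^ q * ENNReal.ofReal 0 ^ q))) := by
    refine ENNReal.Tendsto.const_mul (ENNReal.Tendsto.const_mul ?_ (Or.inr htop)) (Or.inr
      (ENNReal.mul_ne_top ENNReal.ofNat_ne_top (ENNReal.natCast_ne_top M)))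
    exact ((ENNReal.continuous_rpow_const.tendsto _).comp
      (ENNReal.continuous_ofReal.tendsto 0)).mono_left nhdsWithin_le_nhds
  rw [ENNReal.ofReal_zero, ENNReal.zero_rpow_of_pos hq, mul_zero, mul_zero] at h2
  obtain ⟨ε, hε, hε0⟩ := ((h2.eventually (gt_mem_nhds (pos_iff_ne_zero.2 hδ2))).and
    self_mem_nhdsWithin).exists
  obtain ⟨R, hR, hTR⟩ := exists_rank_le_norm_sub_lt T (M + M) hε0
  refine ⟨M + M, R, hR, (powSum_sub_rank_le hq (le_of_lt hε0) hR hTR.le).trans ?_⟩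
  exact (add_le_add hε.le hM.le).trans (ENNReal.add_halves δ).le

/-- Operators of finite rank are dense in the Schatten classes. -/
lemma exists_rank_eNorm_sub_le {q : ℝ} (hq : 0 < q) {T : H →L[ℂ] H} (hT : eNorm q T ≠ ∞)
    {ε : ℝ≥0∞} (hε : ε ≠ 0) :
    ∃ (r : ℕ) (R : H →L[ℂ] H), LinearMap.rank (R : H →ₗ[ℂ] H) ≤ (r : Cardinal) ∧
      eNorm q (T - R) ≤ ε := by
  have hT' : powSum q T ≠ ∞ := by
    rw [powSum_eq hq]
    exact ENNReal.rpow_ne_top_of_nonneg hq.le hT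
  have hεq : ε ^ q ≠ 0 := fun h => by
    rcases ENNReal.rpow_eq_zero_iff.1 h with h | h
    · exact hε h.1
    · exact absurd h.2 hq.not_gt
  obtain ⟨r, R, hR, h⟩ := exists_rank_powSum_sub_le hq hT' hεq
  refine ⟨r, R, hR, ?_⟩
  rw [eNorm_eq]
  refine (ENNReal.rpow_le_rpow h (one_div_pos.2 hq).le).trans ?_
  rw [← ENNReal.rpow_mul, mul_one_div_cancel hq.ne', ENNReal.rpow_one]

end Schatten

namespace Schatten

variable {H : Type*} [NormedAddCommGroup H] [InnerProductSpace ℂ H] [CompleteSpace H]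

/-! ### Integrals in the Schatten classes -/

lemma rank_starProjection_le (K : Submodule ℂ H) [K.HasOrthogonalProjection] :
    LinearMap.rank ((K.starProjection : H →L[ℂ] H) : H →ₗ[ℂ] H) ≤ Module.rank ℂ K := by
  refine Submodule.rank_mono ?_
  rintro _ ⟨x, rfl⟩
  exact Submodule.starProjection_apply_mem _ x

lemma rank_span_range_le {N : ℕ} (v : Fin N → H) :
    Module.rank ℂ (Submodule.span ℂ (Set.range v)) ≤ (N : Cardinal) := by
  refine (rank_span_le _).trans ?_
  have h := Cardinal.mk_range_le_lift (f := v)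
  simpa using h

lemma orthonormal_snoc {N : ℕ} {v : Fin N → H} (hv : Orthonormal ℂ v) {x : H} (hx : ‖x‖ = 1)
    (h : ∀ j, inner ℂ (v j) x = 0) : Orthonormal ℂ (Fin.snoc v x : Fin (N + 1) → H) := by
  refine ⟨fun i => ?_, fun i j hij => ?_⟩
  · refine Fin.lastCases ?_ (fun i => ?_) i
    · simpa using hx
    · simpa using hv.1 i
  · revert hij
    refine Fin.lastCases ?_ (fun i => ?_) i <;> refine Fin.lastCases ?_ (fun j => ?_) j
    · simp
    · intro _
      simpa [inner_eq_zero_symm] using h j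
    · intro _
      simpa using h i
    · intro hij
      simpa using hv.2 fun h => hij (by rw [h])

/-- A greedy choice. Once N vectors are found on either side, the compression of Y to the orthogonal
complements of both spans differs from Y by rank at most 2N, so its norm is at least s_(2N)(Y); a
vector on which at least half of it is attained gives the next pair. The rank lost on both sides
explains the index 2k, and the factor 1/2 replaces attainment of the norm. -/
lemma exists_orthonormal_singularValue_le (Y : H →L[ℂ] H) (N : ℕ)
    (hpos : ∀ k < N, 0 < singularValue Y (2 * k)) :
    ∃ v w : Fin N → H, Orthonormal ℂ v ∧ Orthonormal ℂ w ∧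
      ∀ k : Fin N, singularValue Y (2 * k) / 2 ≤ (inner ℂ (w k) (Y (v k))).re := by
  induction N with
  | zero => exact ⟨Fin.elim0, Fin.elim0, ⟨fun i => i.elim0, fun i => i.elim0⟩,
      ⟨fun i => i.elim0, fun i => i.elim0⟩, fun i => i.elim0⟩
  | succ N ih =>
    obtain ⟨v, w, hv, hw, h⟩ := ih fun k hk => hpos k (hk.trans N.lt_succ_self)
    set K := Submodule.span ℂ (Set.range v) with hK
    set L := Submodule.span ℂ (Set.range w) with hL
    have : FiniteDimensional ℂ K := FiniteDimensional.span_of_finite ℂ (Set.finite_range v)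
    have : FiniteDimensional ℂ L := FiniteDimensional.span_of_finite ℂ (Set.finite_range w)
    set A : H →L[ℂ] H := Lᗮ.starProjection * Y * Kᗮ.starProjection with hA
    have hrank : LinearMap.rank ((Y * K.starProjection + L.starProjection *
        (Y * Kᗮ.starProjection) : H →L[ℂ] H) : H →ₗ[ℂ] H) ≤ ((2 * N : ℕ) : Cardinal) := by
      rw [two_mul, Nat.cast_add]
      exact (LinearMap.rank_add_le _ _).trans (add_le_add
        ((rank_mul_le_right _ _).trans ((rank_starProjection_le K).trans (rank_span_range_le v)))
        ((rank_mul_le_left _ _).trans ((rank_starProjection_le L).trans (rank_span_range_le w))))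
    have hnorm := singularValue_le_norm_sub (T := Y) hrank
    have hYA : Y - (Y * K.starProjection + L.starProjection * (Y * Kᗮ.starProjection)) = A := by
      rw [hA, Submodule.starProjection_orthogonal', Submodule.starProjection_orthogonal']
      noncomm_ring
    rw [hYA] at hnorm
    have hs := hpos N N.lt_succ_self
    obtain ⟨x, hx⟩ : ∃ x, singularValue Y (2 * N) / 2 * ‖x‖ < ‖A x‖ := by
      by_contra! hcon
      have := A.opNorm_le_bound (by positivity) hcon
      linarith
    set x' := Kᗮ.starProjection x with hx'
    set y := Lᗮ.starProjection (Y x') with hy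
    have hAx : A x = y := rfl
    have hx'le : ‖x'‖ ≤ ‖x‖ := Submodule.norm_starProjection_apply_le _ x
    have hx'y : singularValue Y (2 * N) / 2 * ‖x'‖ < ‖y‖ := by
      rw [← hAx]
      exact (mul_le_mul_of_nonneg_left hx'le (by positivity)).trans_lt hx
    have hy0 : 0 < ‖y‖ := (by positivity : (0 : ℝ) ≤ _).trans_lt hx'y
    have hx0 : 0 < ‖x'‖ := by
      rw [norm_pos_iff]
      intro h0
      rw [hy, h0, map_zero, map_zero, norm_zero] at hy0
      exact hy0.false
    have hxK : ∀ j, inner ℂ (v j) x' = 0 := fun j =>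
      (Submodule.mem_orthogonal _ _).1 (Submodule.starProjection_apply_mem _ x) _
        (Submodule.subset_span ⟨j, rfl⟩)
    have hyL : ∀ j, inner ℂ (w j) y = 0 := fun j =>
      (Submodule.mem_orthogonal _ _).1 (Submodule.starProjection_apply_mem _ _) _
        (Submodule.subset_span ⟨j, rfl⟩)
    have hyY : inner ℂ y (Y x') = ((‖y‖ : ℂ)) ^ 2 := by
      have h1 : inner ℂ y (Y x') = inner ℂ y y := by
        have hyy : Lᗮ.starProjection y = y :=
          Submodule.starProjection_eq_self_iff.2 (Submodule.starProjection_apply_mem _ _)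
        conv_lhs => rw [← hyy]
        rw [Submodule.inner_starProjection_left_eq_right]
      rw [h1]
      exact inner_self_eq_norm_sq_to_K y
    refine ⟨Fin.snoc v (((‖x'‖⁻¹ : ℝ) : ℂ) • x'), Fin.snoc w (((‖y‖⁻¹ : ℝ) : ℂ) • y),
      orthonormal_snoc hv ?_ ?_, orthonormal_snoc hw ?_ ?_, fun k => ?_⟩
    · rw [norm_smul, Complex.norm_real, norm_inv, norm_norm, inv_mul_cancel₀ hx0.ne']
    · intro j
      rw [inner_smul_right, hxK, mul_zero]
    · rw [norm_smul, Complex.norm_real, norm_inv, norm_norm, inv_mul_cancel₀ hy0.ne']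
    · intro j
      rw [inner_smul_right, hyL, mul_zero]
    · refine Fin.lastCases ?_ (fun i => ?_) k
      · simp only [Fin.snoc_last, Fin.val_last, map_smul, inner_smul_left, inner_smul_right, hyY,
          Complex.conj_ofReal]
        rw [← Complex.ofReal_pow, ← Complex.ofReal_mul, ← Complex.ofReal_mul, Complex.ofReal_re]
        have h2 : ‖x'‖⁻¹ * (‖y‖⁻¹ * ‖y‖ ^ 2) = ‖y‖ / ‖x'‖ := by field_simp
        rw [h2, le_div_iff₀ hx0]
        exact hx'y.le
      · simpa using h i

/-- The operator `∑ λ_k ⟪w_k, ·⟫ v_k`. -/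
def diagonal {N : ℕ} (c : Fin N → ℝ) (v w : Fin N → H) : H →L[ℂ] H :=
  ∑ k, (c k : ℂ) • InnerProductSpace.rankOne ℂ (v k) (w k)

lemma norm_sum_smul_rankOne_le {N : ℕ} {c : Fin N → ℝ} (hc : ∀ k, 0 ≤ c k) {v w : Fin N → H}
    (hv : Orthonormal ℂ v) (hw : Orthonormal ℂ w) (s : Finset (Fin N)) {b : ℝ} (hb : 0 ≤ b)
    (h : ∀ k ∈ s, c k ≤ b) :
    ‖∑ k ∈ s, (c k : ℂ) • InnerProductSpace.rankOne ℂ (v k) (w k)‖ ≤ b := by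
  refine ContinuousLinearMap.opNorm_le_bound _ hb fun x => ?_
  set y := (∑ k ∈ s, (c k : ℂ) • InnerProductSpace.rankOne ℂ (v k) (w k)) x with hy
  have h1 : ‖inner ℂ y y‖ ≤ b * (‖y‖ * ‖x‖) := by
    have hyy : inner ℂ y y =
        inner ℂ y ((∑ k ∈ s, (c k : ℂ) • InnerProductSpace.rankOne ℂ (v k) (w k)) x) := rfl
    rw [hyy, sum_apply, inner_sum]
    refine (norm_sum_le _ _).trans ?_
    refine le_trans ?_ (mul_le_mul_of_nonneg_left (sum_norm_inner_mul_le hv hw s y x) hb)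
    rw [Finset.mul_sum]
    refine Finset.sum_le_sum fun k hk => ?_
    rw [smul_apply, InnerProductSpace.rankOne_apply, inner_smul_right, inner_smul_right,
      norm_mul, norm_mul, Complex.norm_real, Real.norm_of_nonneg (hc k),
      norm_inner_symm y (v k), mul_comm ‖inner ℂ (w k) x‖]
    exact mul_le_mul_of_nonneg_right (h k hk) (by positivity)
  rw [inner_self_eq_norm_sq_to_K, norm_pow] at h1
  simp only [Complex.coe_algebraMap, Complex.norm_real, norm_norm] at h1
  rcases (norm_nonneg y).eq_or_lt with h0 | h0
  · rw [← h0]; positivity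
  · have h2 : ‖y‖ * ‖y‖ ≤ ‖y‖ * (b * ‖x‖) := by nlinarith
    exact le_of_mul_le_mul_left h2 h0

lemma rank_sum_smul_rankOne_le {N : ℕ} (c : Fin N → ℝ) (v w : Fin N → H) (s : Finset (Fin N)) :
    LinearMap.rank ((∑ k ∈ s, (c k : ℂ) • InnerProductSpace.rankOne ℂ (v k) (w k) :
      H →L[ℂ] H) : H →ₗ[ℂ] H) ≤ (s.card : Cardinal) := by
  classical
  induction s using Finset.induction_on with
  | empty => simp
  | insert k s hk ih =>
    rw [Finset.sum_insert hk, Finset.card_insert_of_notMem hk, add_comm s.card, Nat.cast_add]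
    refine (LinearMap.rank_add_le _ _).trans (add_le_add ?_ ih)
    refine le_trans (Submodule.rank_mono (t := Submodule.span ℂ (Set.range fun _ : Fin 1 => v k)) ?_)
      (rank_span_range_le _)
    rintro _ ⟨x, rfl⟩
    refine Submodule.smul_mem _ _ (Submodule.smul_mem _ _ (Submodule.subset_span ⟨0, rfl⟩))

/-- The first k terms of the sum have rank at most k, and by orthonormality the remaining ones have
norm at most c_k, as c decreases. -/
lemma powSum_diagonal_le {q : ℝ} (hq : 0 < q) {N : ℕ} {c : Fin N → ℝ} (hc : ∀ k, 0 ≤ c k)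
    (hanti : Antitone c) {v w : Fin N → H} (hv : Orthonormal ℂ v) (hw : Orthonormal ℂ w) :
    powSum q (diagonal c v w) ≤ ∑ k, ENNReal.ofReal (c k) ^ q := by
  classical
  have hlt : ∀ k : Fin N, singularValue (diagonal c v w) k ≤ c k := fun k => by
    have h1 := rank_sum_smul_rankOne_le c v w (Finset.univ.filter fun j => j < k)
    have h2 : (Finset.univ.filter fun j => j < k).card = (k : ℕ) := by
      rw [← Fin.card_Iio k]
      congr 1
      ext
      simp
    rw [h2] at h1
    refine (singularValue_le_norm_sub (T := diagonal c v w) h1).trans ?_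
    rw [diagonal, ← Finset.sum_filter_add_sum_filter_not Finset.univ (fun j => j < k),
      add_sub_cancel_left]
    refine norm_sum_smul_rankOne_le hc hv hw _ (hc k) fun j hj => hanti ?_
    exact not_lt.1 (Finset.mem_filter.1 hj).2
  have hge : ∀ n, n ∉ Finset.range N →
      ENNReal.ofReal (singularValue (diagonal c v w) n) ^ q = 0 := fun n hn => by
    have h1 := rank_sum_smul_rankOne_le c v w Finset.univ
    have h2 : ((Finset.univ : Finset (Fin N)).card : Cardinal) ≤ (n : Cardinal) := by
      simpa using hn
    have h3 := singularValue_le_norm_sub (T := diagonal c v w) (h1.trans h2)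
    rw [diagonal, sub_self, norm_zero] at h3
    rw [diagonal, ENNReal.ofReal_of_nonpos h3, ENNReal.zero_rpow_of_pos hq]
  rw [powSum, tsum_eq_sum hge, Finset.sum_range]
  exact Finset.sum_le_sum fun k _ =>
    ENNReal.rpow_le_rpow (ENNReal.ofReal_le_ofReal (hlt k)) hq.le

lemma trace_mul_diagonal (X : H →L[ℂ] H) {N : ℕ} (c : Fin N → ℝ) (v w : Fin N → H) :
    trace (X * diagonal c v w) = ∑ k, (c k : ℂ) * inner ℂ (w k) (X (v k)) := by
  have h := hasSum_sum fun k (_ : k ∈ Finset.univ) =>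
    (hasSum_inner_mul_rankOne X (v k) (w k)).mul_left (c k : ℂ)
  rw [trace_eq, ← h.tsum_eq]
  refine tsum_congr fun i => ?_
  simp only [diagonal, Finset.mul_sum, mul_smul_comm, sum_apply, smul_apply, inner_sum,
    inner_smul_right]

/-- Matrix coefficients along orthonormal families, tested against a decreasing sequence. -/
lemma exists_norm_sum_mul_inner_le {p q : ℝ} (hp : 1 < p) (hpq : 1 = 1 / p + 1 / q) :
    ∃ C : ℝ, 0 ≤ C ∧ ∀ (X : H →L[ℂ] H), eNorm p X ≠ ∞ → ∀ (N : ℕ) (c : Fin N → ℝ),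
      (∀ k, 0 ≤ c k) → Antitone c → ∀ v w : Fin N → H, Orthonormal ℂ v → Orthonormal ℂ w →
      ‖∑ k, (c k : ℂ) * inner ℂ (w k) (X (v k))‖ ≤
        C * (eNorm p X).toReal * (∑ k, c k ^ q) ^ (1 / q) := by
  have hp0 : 0 < p := one_pos.trans hp
  have hq : 0 < q := by
    have h1 : 1 / p < 1 := (div_lt_one hp0).2 hp
    exact one_div_pos.1 (by linarith)
  obtain ⟨C, hC, h⟩ := exists_eNorm_mul_le (H := H) (q := q) one_pos hp
    (one_div_one.trans hpq)
  refine ⟨14 * C.toReal, by positivity, fun X hX N c hc hanti v w hv hw => ?_⟩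
  have h1 : eNorm q (diagonal c v w) ≤ ENNReal.ofReal ((∑ k, c k ^ q) ^ (1 / q)) := by
    rw [eNorm_eq, ← ENNReal.ofReal_rpow_of_nonneg
      (Finset.sum_nonneg fun k _ => Real.rpow_nonneg (hc k) q) (one_div_pos.2 hq).le,
      ENNReal.ofReal_sum_of_nonneg fun k _ => Real.rpow_nonneg (hc k) q]
    refine ENNReal.rpow_le_rpow ((powSum_diagonal_le hq hc hanti hv hw).trans (le_of_eq ?_))
      (one_div_pos.2 hq).le
    exact Finset.sum_congr rfl fun k _ => ENNReal.ofReal_rpow_of_nonneg (hc k) hq.le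
  have h2 : eNorm 1 (X * diagonal c v w) ≤
      C * (eNorm p X * ENNReal.ofReal ((∑ k, c k ^ q) ^ (1 / q))) :=
    (h X _).trans (by gcongr)
  have h3 : C * (eNorm p X * ENNReal.ofReal ((∑ k, c k ^ q) ^ (1 / q))) ≠ ∞ :=
    ENNReal.mul_ne_top hC (ENNReal.mul_ne_top hX ENNReal.ofReal_ne_top)
  have h4 := norm_trace_le (ne_top_of_le_ne_top h3 h2)
  rw [trace_mul_diagonal] at h4
  refine h4.trans ?_
  have h5 := ENNReal.toReal_mono h3 h2
  rw [ENNReal.toReal_mul, ENNReal.toReal_mul, ENNReal.toReal_ofReal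
    (Real.rpow_nonneg (Finset.sum_nonneg fun k _ => Real.rpow_nonneg (hc k) q) _)] at h5
  rw [mul_assoc, mul_assoc]
  exact mul_le_mul_of_nonneg_left h5 (by norm_num)

/-- The integral is taken in the operator norm only, but matrix coefficients are continuous for that
norm, so the test functional passes under it. -/
lemma norm_sum_mul_inner_integral_le {s t : ℝ} {X : ℝ → H →L[ℂ] H}
    (hX : IntervalIntegrable X MeasureTheory.volume s t) {N : ℕ} (c : Fin N → ℝ)
    (v w : Fin N → H) {b : ℝ}
    (hb : ∀ u ∈ Set.uIcc s t, ‖∑ k, (c k : ℂ) * inner ℂ (w k) (X u (v k))‖ ≤ b) :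
    ‖∑ k, (c k : ℂ) * inner ℂ (w k) ((∫ u in s..t, X u) (v k))‖ ≤ b * |t - s| := by
  let L : (H →L[ℂ] H) →L[ℂ] ℂ := ∑ k, (c k : ℂ) •
    ((innerSL ℂ (w k)).comp (ContinuousLinearMap.apply ℂ H (v k)))
  have hL : ∀ A, L A = ∑ k, (c k : ℂ) * inner ℂ (w k) (A (v k)) := fun A => by
    simp [L]
  rw [← hL, ← L.intervalIntegral_comp_comm hX]
  refine intervalIntegral.norm_integral_le_of_norm_le_const fun u hu => ?_
  rw [hL]
  exact hb u (Set.uIoc_subset_uIcc hu)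

/-- For `p > 1` the Schatten norm of an integral is controlled by the norms of the integrand. -/
lemma exists_eNorm_integral_le {p : ℝ} (hp : 1 < p) :
    ∃ C : ℝ≥0∞, C ≠ ∞ ∧ ∀ (s t : ℝ) (X : ℝ → H →L[ℂ] H) (b : ℝ≥0∞), b ≠ ∞ →
      IntervalIntegrable X MeasureTheory.volume s t →
      (∀ u ∈ Set.uIcc s t, eNorm p (X u) ≤ b) →
      eNorm p (∫ u in s..t, X u) ≤ C * b * ENNReal.ofReal |t - s| := by
  have hp0 : 0 < p := one_pos.trans hp
  set q := p / (p - 1) with hq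
  have hp1 : 0 < p - 1 := sub_pos.2 hp
  have hq0 : 0 < q := div_pos hp0 hp1
  have hpq : 1 = 1 / p + 1 / q := by rw [hq]; field_simp; ring
  obtain ⟨C, hC, h⟩ := exists_norm_sum_mul_inner_le (H := H) hp hpq
  refine ⟨2 ^ (1 / p) * ENNReal.ofReal (2 * C), ENNReal.mul_ne_top
    (ENNReal.rpow_ne_top_of_nonneg (one_div_pos.2 hp0).le ENNReal.ofNat_ne_top)
    ENNReal.ofReal_ne_top, fun s t X b hb hX hXb => ?_⟩
  set Y := ∫ u in s..t, X u with hY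
  set a : ℕ → ℝ := fun k => singularValue Y (2 * k) with ha
  have ha0 : ∀ k, 0 ≤ a k := fun k => singularValue_nonneg _ _
  have hanti : Antitone a := fun i j hij => singularValue_antitone Y (by omega)
  set M : ℝ := 2 * C * b.toReal * |t - s| with hM
  have hM0 : 0 ≤ M := by positivity
  have hpos : ∀ N, (∀ k < N, 0 < a k) → ∑ k ∈ Finset.range N, a k ^ p ≤ M ^ p := by
    intro N hN
    obtain ⟨v, w, hv, hw, hvw⟩ := exists_orthonormal_singularValue_le Y N hN
    -- The extremal sequence for duality: c_k^q = a_k^p and c_k a_k = a_k^p.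
    set c : Fin N → ℝ := fun k => a k ^ (p - 1) with hc
    have hc0 : ∀ k, 0 ≤ c k := fun k => Real.rpow_nonneg (ha0 _) _
    have hcanti : Antitone c := fun i j hij =>
      Real.rpow_le_rpow (ha0 _) (hanti (Fin.val_le_of_le hij)) hp1.le
    have hcq : ∀ k, c k ^ q = a k ^ p := fun k => by
      rw [hc, ← Real.rpow_mul (ha0 _), hq, mul_div_cancel₀ _ hp1.ne']
    set S := ∑ k ∈ Finset.range N, a k ^ p with hS
    have hS' : S = ∑ k : Fin N, c k ^ q := by
      rw [hS, Finset.sum_range]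
      exact Finset.sum_congr rfl fun k _ => (hcq k).symm
    have hS0 : 0 ≤ S := Finset.sum_nonneg fun k _ => Real.rpow_nonneg (ha0 k) p
    have h1 : ∀ u ∈ Set.uIcc s t, ‖∑ k, (c k : ℂ) * inner ℂ (w k) (X u (v k))‖ ≤
        C * b.toReal * S ^ (1 / q) := fun u hu => by
      refine (h (X u) (ne_top_of_le_ne_top hb (hXb u hu)) N c hc0 hcanti v w hv hw).trans ?_
      rw [← hS']
      have := ENNReal.toReal_mono hb (hXb u hu)
      gcongr
    have h2 := norm_sum_mul_inner_integral_le hX c v w h1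
    have h3 : S / 2 ≤ ‖∑ k, (c k : ℂ) * inner ℂ (w k) (Y (v k))‖ := by
      refine le_trans ?_ (Complex.re_le_norm _)
      rw [Complex.re_sum, hS, Finset.sum_range, Finset.sum_div]
      refine Finset.sum_le_sum fun k _ => ?_
      rw [Complex.re_ofReal_mul]
      have h4 : a k ^ p = c k * a k := by
        rw [hc, ← Real.rpow_add_one (hN k k.2).ne', sub_add_cancel]
      rw [h4, mul_div_assoc]
      exact mul_le_mul_of_nonneg_left (hvw k) (hc0 k)
    -- Testing against c reproduces S up to a factor 2; dividing by S^(1/q) leaves S^(1/p) ≤ M.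
    have h5 : S ≤ M * S ^ (1 / q) := by
      have := h3.trans h2
      rw [hM]
      nlinarith
    rcases hS0.eq_or_lt with h0 | h0
    · rw [← h0]; positivity
    · have h6 : S ^ (1 / p) ≤ M := by
        have h7 : S = S ^ (1 / p) * S ^ (1 / q) := by
          rw [← Real.rpow_add h0, ← hpq, Real.rpow_one]
        refine le_of_mul_le_mul_right (a := S ^ (1 / q)) ?_ (Real.rpow_pos_of_pos h0 _)
        rwa [← h7]
      calc S = (S ^ (1 / p)) ^ p := by
            rw [← Real.rpow_mul hS0, one_div_mul_cancel hp0.ne', Real.rpow_one]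
        _ ≤ M ^ p := Real.rpow_le_rpow (Real.rpow_nonneg hS0 _) h6 hp0.le
  -- Positivity was needed only to build the vectors. By monotonicity the terms vanish from the
  -- first zero on and add nothing.
  have hall : ∀ N, ∑ k ∈ Finset.range N, a k ^ p ≤ M ^ p := by
    intro N
    induction N with
    | zero => simpa using Real.rpow_nonneg hM0 p
    | succ N ih =>
      rcases (ha0 N).eq_or_lt with h0 | h0
      · rw [Finset.sum_range_succ, ← h0, Real.zero_rpow hp0.ne', add_zero]
        exact ih
      · exact hpos _ fun k hk => h0.trans_le (hanti (Nat.lt_succ_iff.1 hk))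
  have hpow : powSum p Y ≤ 2 * ENNReal.ofReal M ^ p := by
    refine (tsum_le_two_mul_tsum_even (ofReal_singularValue_rpow_antitone hp0.le _)).trans ?_
    refine mul_le_mul' le_rfl ?_
    refine ENNReal.tsum_le_of_sum_range_le fun N => ?_
    rw [ENNReal.ofReal_rpow_of_nonneg hM0 hp0.le]
    refine le_trans (le_of_eq ?_) (ENNReal.ofReal_le_ofReal (hall N))
    rw [ENNReal.ofReal_sum_of_nonneg fun k _ => Real.rpow_nonneg (ha0 k) p]
    refine Finset.sum_congr rfl fun k _ => ?_
    rw [← two_mul, ENNReal.ofReal_rpow_of_nonneg (ha0 k) hp0.le]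
  rw [eNorm_eq]
  refine (ENNReal.rpow_le_rpow hpow (one_div_pos.2 hp0).le).trans (le_of_eq ?_)
  rw [ENNReal.mul_rpow_of_nonneg _ _ (one_div_pos.2 hp0).le, ← ENNReal.rpow_mul,
    mul_one_div_cancel hp0.ne', ENNReal.rpow_one, hM, ENNReal.ofReal_mul (by positivity),
    ENNReal.ofReal_mul (by positivity), ENNReal.ofReal_toReal hb]
  ring

end Schatten

namespace Schatten

variable {H : Type*} [NormedAddCommGroup H] [InnerProductSpace ℂ H] [CompleteSpace H]

/-! ### The filtration of the bounded operators by the ideals `ℒ^(p/d)` -/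

/-- The quasi-norm of `ℒ^(p/d)`, which for `d = 0` is the operator norm. -/
def degNorm (p : ℝ) (d : ℕ) (T : H →L[ℂ] H) : ℝ≥0∞ := if d = 0 then ‖T‖ₑ else eNorm (p / d) T

lemma degNorm_zero_left (p : ℝ) (T : H →L[ℂ] H) : degNorm p 0 T = ‖T‖ₑ := if_pos rfl

lemma degNorm_of_ne_zero (p : ℝ) {d : ℕ} (hd : d ≠ 0) (T : H →L[ℂ] H) :
    degNorm p d T = eNorm (p / d) T := if_neg hd

lemma div_natCast_pos {p : ℝ} (hp : 0 < p) {d : ℕ} (hd : d ≠ 0) : 0 < p / d :=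
  div_pos hp (by exact_mod_cast Nat.pos_of_ne_zero hd)

lemma enorm_mul_le_mul (S T : H →L[ℂ] H) : ‖S * T‖ₑ ≤ ‖S‖ₑ * ‖T‖ₑ := by
  rw [← ofReal_norm, ← ofReal_norm, ← ofReal_norm, ← ENNReal.ofReal_mul (norm_nonneg _)]
  exact ENNReal.ofReal_le_ofReal (norm_mul_le S T)

lemma degNorm_mul_le_enorm_mul {p : ℝ} (hp : 0 < p) (d : ℕ) (S T : H →L[ℂ] H) :
    degNorm p d (S * T) ≤ ‖S‖ₑ * degNorm p d T := by
  rcases eq_or_ne d 0 with rfl | hd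
  · rw [degNorm_zero_left, degNorm_zero_left]
    exact enorm_mul_le_mul S T
  · rw [degNorm_of_ne_zero p hd, degNorm_of_ne_zero p hd]
    exact eNorm_mul_le_enorm_mul (div_natCast_pos hp hd) S T

lemma degNorm_mul_le_mul_enorm {p : ℝ} (hp : 0 < p) (d : ℕ) (S T : H →L[ℂ] H) :
    degNorm p d (S * T) ≤ degNorm p d S * ‖T‖ₑ := by
  rcases eq_or_ne d 0 with rfl | hd
  · rw [degNorm_zero_left, degNorm_zero_left]
    exact enorm_mul_le_mul S T
  · rw [degNorm_of_ne_zero p hd, degNorm_of_ne_zero p hd]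
    exact eNorm_mul_le_mul_enorm (div_natCast_pos hp hd) S T

lemma degNorm_smul_le {p : ℝ} (hp : 0 < p) (d : ℕ) (c : ℂ) (T : H →L[ℂ] H) :
    degNorm p d (c • T) ≤ ‖(c • 1 : H →L[ℂ] H)‖ₑ * degNorm p d T := by
  simpa using degNorm_mul_le_enorm_mul hp d (c • 1) T

lemma degNorm_zero {p : ℝ} (hp : 0 < p) (d : ℕ) : degNorm p d (0 : H →L[ℂ] H) = 0 := by
  rcases eq_or_ne d 0 with rfl | hd
  · rw [degNorm_zero_left, ← ofReal_norm, norm_zero, ENNReal.ofReal_zero]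
  · rw [degNorm_of_ne_zero p hd, eNorm_zero (div_natCast_pos hp hd)]

lemma exists_degNorm_add_le {p : ℝ} (hp : 0 < p) (d : ℕ) :
    ∃ C : ℝ≥0∞, C ≠ ∞ ∧
      ∀ S T : H →L[ℂ] H, degNorm p d (S + T) ≤ C * (degNorm p d S + degNorm p d T) := by
  rcases eq_or_ne d 0 with rfl | hd
  · refine ⟨1, ENNReal.one_ne_top, fun S T => ?_⟩
    simp only [degNorm_zero_left, one_mul]
    exact enorm_add_le S T
  · simp only [degNorm_of_ne_zero p hd]
    exact exists_eNorm_add_le (div_natCast_pos hp hd)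

/-- Degrees add because 1/(p/d) = d/p: Hölder's condition on the exponents reads (d + e)/p = d/p +
e/p. If one degree is 0, this is the ideal property. -/
lemma exists_degNorm_mul_le {p : ℝ} (hp : 0 < p) (d e : ℕ) :
    ∃ C : ℝ≥0∞, C ≠ ∞ ∧
      ∀ S T : H →L[ℂ] H, degNorm p (d + e) (S * T) ≤ C * (degNorm p d S * degNorm p e T) := by
  rcases eq_or_ne d 0 with rfl | hd
  · refine ⟨1, ENNReal.one_ne_top, fun S T => ?_⟩
    rw [zero_add, degNorm_zero_left, one_mul]
    exact degNorm_mul_le_enorm_mul hp e S T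
  rcases eq_or_ne e 0 with rfl | he
  · refine ⟨1, ENNReal.one_ne_top, fun S T => ?_⟩
    rw [add_zero, degNorm_zero_left, one_mul]
    exact degNorm_mul_le_mul_enorm hp d S T
  have hde : d + e ≠ 0 := by omega
  simp only [degNorm_of_ne_zero p hd, degNorm_of_ne_zero p he, degNorm_of_ne_zero p hde]
  have hd' : (0 : ℝ) < d := by exact_mod_cast Nat.pos_of_ne_zero hd
  have he' : (0 : ℝ) < e := by exact_mod_cast Nat.pos_of_ne_zero he
  refine exists_eNorm_mul_le (div_natCast_pos hp hde) ?_ ?_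
  · push_cast
    exact div_lt_div_of_pos_left hp hd' (by linarith)
  · push_cast
    field_simp

lemma degNorm_mono {p : ℝ} (hp : 0 < p) {d e : ℕ} (h : d ≤ e) (T : H →L[ℂ] H) :
    degNorm p d T ≤ degNorm p e T := by
  rcases eq_or_ne e 0 with rfl | he
  · rw [Nat.le_zero.1 h]
  rcases eq_or_ne d 0 with rfl | hd
  · rw [degNorm_zero_left, degNorm_of_ne_zero p he]
    exact enorm_le_eNorm (div_natCast_pos hp he) T
  · rw [degNorm_of_ne_zero p hd, degNorm_of_ne_zero p he]
    refine eNorm_anti (div_natCast_pos hp he) ?_ T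
    have hd' : (0 : ℝ) < d := by exact_mod_cast Nat.pos_of_ne_zero hd
    exact div_le_div_of_nonneg_left hp.le hd' (by exact_mod_cast h)

lemma eNorm_one_le_degNorm {p : ℝ} (hp : 0 < p) {d : ℕ} (h : p ≤ d) (T : H →L[ℂ] H) :
    eNorm 1 T ≤ degNorm p d T := by
  have hd' : (0 : ℝ) < d := hp.trans_le h
  have hd : d ≠ 0 := by rintro rfl; simp at hd'
  rw [degNorm_of_ne_zero p hd]
  exact eNorm_anti (div_natCast_pos hp hd) ((div_le_one hd').2 h) T

/-- `T` has degree `d`: it belongs to `ℒ^(p/d)`, and is arbitrary for `d ≤ 0`. -/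
def DegMem (p : ℝ) (d : ℤ) (T : H →L[ℂ] H) : Prop := degNorm p d.toNat T ≠ ∞

/-- `X t` converges to `x` in the quasi-norm of `ℒ^(p/d)`. -/
def DegTendsto {α : Type*} (p : ℝ) (d : ℤ) (l : Filter α) (X : α → H →L[ℂ] H) (x : H →L[ℂ] H) :
    Prop :=
  DegMem p d x ∧ Tendsto (fun t => degNorm p d.toNat (X t - x)) l (𝓝 0)

section

variable {p : ℝ} {d e : ℤ} {S T : H →L[ℂ] H}

lemma degMem_of_nonpos (hd : d ≤ 0) (T : H →L[ℂ] H) : DegMem p d T := by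
  rw [DegMem, Int.toNat_of_nonpos hd, degNorm_zero_left]
  exact enorm_ne_top

lemma DegMem.zero (hp : 0 < p) : DegMem p d (0 : H →L[ℂ] H) := by
  rw [DegMem, degNorm_zero hp]
  exact ENNReal.zero_ne_top

lemma DegMem.add (hp : 0 < p) (hS : DegMem p d S) (hT : DegMem p d T) : DegMem p d (S + T) := by
  obtain ⟨C, hC, h⟩ := exists_degNorm_add_le (H := H) hp d.toNat
  exact ne_top_of_le_ne_top (ENNReal.mul_ne_top hC (ENNReal.add_ne_top.2 ⟨hS, hT⟩)) (h S T)

lemma DegMem.smul (hp : 0 < p) (c : ℂ) (hT : DegMem p d T) : DegMem p d (c • T) :=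
  ne_top_of_le_ne_top (ENNReal.mul_ne_top enorm_ne_top hT) (degNorm_smul_le hp _ c T)

lemma DegMem.neg (hp : 0 < p) (hT : DegMem p d T) : DegMem p d (-T) := by
  simpa using hT.smul hp (-1)

lemma DegMem.mono (hp : 0 < p) (h : d ≤ e) (hT : DegMem p e T) : DegMem p d T :=
  ne_top_of_le_ne_top hT (degNorm_mono hp (Int.toNat_le_toNat h) T)

lemma DegMem.mul (hp : 0 < p) (hS : DegMem p d S) (hT : DegMem p e T) :
    DegMem p (d + e) (S * T) := by
  obtain ⟨C, hC, h⟩ := exists_degNorm_mul_le (H := H) hp d.toNat e.toNat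
  refine ne_top_of_le_ne_top (ENNReal.mul_ne_top hC (ENNReal.mul_ne_top hS hT))
    ((degNorm_mono hp ?_ _).trans (h S T))
  omega

lemma DegMem.eNorm_one (hp : 0 < p) (hd : p ≤ d) (hT : DegMem p d T) : eNorm 1 T ≠ ∞ := by
  refine ne_top_of_le_ne_top hT (eNorm_one_le_degNorm hp ?_ T)
  have h1 : d ≤ (d.toNat : ℤ) := Int.self_le_toNat d
  exact hd.trans (by exact_mod_cast h1)

lemma DegMem.traceable (hp : 0 < p) (hd : p ≤ d) (hT : DegMem p d T) : Traceable T :=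
  traceable_of_eNorm_one (hT.eNorm_one hp hd)

lemma enorm_trace_le (T : H →L[ℂ] H) : ‖trace T‖ₑ ≤ 14 * eNorm 1 T := by
  rcases eq_or_ne (eNorm 1 T) ∞ with h | h
  · rw [h, ENNReal.mul_top (by norm_num)]
    exact le_top
  · rw [← ofReal_norm]
    refine (ENNReal.ofReal_le_ofReal (norm_trace_le h)).trans ?_
    rw [ENNReal.ofReal_mul (by norm_num), ENNReal.ofReal_toReal h]
    simp

/-- X is approximated by R of finite rank in ℒ^(p/d), which is possible because d ≠ 0. The parts
with R commute under the trace, and the rest is at most K times the approximation error. -/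
lemma trace_mul_comm_aux (hp : 0 < p) {d e : ℕ} (hd : d ≠ 0) (hde : p ≤ (d + e : ℕ))
    {X Y : H →L[ℂ] H} (hX : degNorm p d X ≠ ∞) (hY : degNorm p e Y ≠ ∞) :
    trace (X * Y) = trace (Y * X) := by
  obtain ⟨C, hC, h1⟩ := exists_degNorm_mul_le (H := H) hp d e
  obtain ⟨C', hC', h2⟩ := exists_degNorm_mul_le (H := H) hp e d
  rw [add_comm e d] at h2
  have h1' := fun S T => (eNorm_one_le_degNorm hp hde (S * T)).trans (h1 S T)
  have h2' := fun S T => (eNorm_one_le_degNorm hp hde (S * T)).trans (h2 S T)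
  set K : ℝ≥0∞ := 14 * C * degNorm p e Y + 14 * C' * degNorm p e Y with hK
  have hKtop : K ≠ ∞ := ENNReal.add_ne_top.2
    ⟨ENNReal.mul_ne_top (ENNReal.mul_ne_top ENNReal.ofNat_ne_top hC) hY,
      ENNReal.mul_ne_top (ENNReal.mul_ne_top ENNReal.ofNat_ne_top hC') hY⟩
  have key : ∀ ε : ℝ≥0∞, 0 < ε → ε < ∞ → ‖trace (X * Y) - trace (Y * X)‖ₑ ≤ K * ε := by
    intro ε hε hε'
    rw [degNorm_of_ne_zero p hd] at hX
    obtain ⟨r, R, hR, hXR⟩ := exists_rank_eNorm_sub_le (div_natCast_pos hp hd) hX hε.ne'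
    rw [← degNorm_of_ne_zero p hd] at hXR
    obtain ⟨hr1, hr2, hr⟩ := trace_mul_comm_of_rank Y hR
    have hXR' := ne_top_of_le_ne_top hε'.ne hXR
    have t1 : eNorm 1 ((X - R) * Y) ≠ ∞ := ne_top_of_le_ne_top
      (ENNReal.mul_ne_top hC (ENNReal.mul_ne_top hXR' hY)) (h1' _ _)
    have t2 : eNorm 1 (Y * (X - R)) ≠ ∞ := ne_top_of_le_ne_top
      (ENNReal.mul_ne_top hC' (ENNReal.mul_ne_top hY hXR')) (h2' _ _)
    have e1 : trace (X * Y) = trace ((X - R) * Y) + trace (R * Y) := by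
      rw [← trace_add (traceable_of_eNorm_one t1) hr2, ← add_mul, sub_add_cancel]
    have e2 : trace (Y * X) = trace (Y * (X - R)) + trace (Y * R) := by
      rw [← trace_add (traceable_of_eNorm_one t2) hr1, ← mul_add, sub_add_cancel]
    rw [e1, e2, hr, add_sub_add_right_eq_sub]
    calc ‖trace ((X - R) * Y) - trace (Y * (X - R))‖ₑ
        ≤ ‖trace ((X - R) * Y)‖ₑ + ‖trace (Y * (X - R))‖ₑ := enorm_sub_le
      _ ≤ 14 * (C * (ε * degNorm p e Y)) + 14 * (C' * (degNorm p e Y * ε)) := by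
        refine add_le_add ((enorm_trace_le _).trans ?_) ((enorm_trace_le _).trans ?_)
        · exact mul_le_mul' le_rfl ((h1' _ _).trans (by gcongr))
        · exact mul_le_mul' le_rfl ((h2' _ _).trans (by gcongr))
      _ = K * ε := by rw [hK]; ring
  have hlim : Tendsto (fun ε : ℝ≥0∞ => K * ε) (𝓝[>] 0) (𝓝 (K * 0)) :=
    (ENNReal.Tendsto.const_mul tendsto_id (Or.inr hKtop)).mono_left nhdsWithin_le_nhds
  have h0 : ‖trace (X * Y) - trace (Y * X)‖ₑ ≤ K * 0 := by
    refine ge_of_tendsto hlim ?_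
    filter_upwards [self_mem_nhdsWithin,
      mem_nhdsWithin_of_mem_nhds (gt_mem_nhds ENNReal.zero_lt_top)] with ε h1 h2
    exact key ε h1 h2
  rw [mul_zero, nonpos_iff_eq_zero, enorm_eq_zero] at h0
  exact sub_eq_zero.1 h0

/-- The trace of a product is cyclic as soon as the degrees add up to `p`. -/
lemma trace_mul_comm (hp : 0 < p) (hde : p ≤ (d + e : ℤ)) (hS : DegMem p d S)
    (hT : DegMem p e T) : trace (S * T) = trace (T * S) := by
  have h1 : p ≤ ((d.toNat + e.toNat : ℕ) : ℝ) := by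
    have : d + e ≤ ((d.toNat + e.toNat : ℕ) : ℤ) := by omega
    exact hde.trans (by exact_mod_cast this)
  -- As p > 0, the two degrees are not both 0; the factor approximated by finite rank operators is
  -- one of positive degree.
  rcases eq_or_ne d.toNat 0 with h | h
  · have he : e.toNat ≠ 0 := by
      intro h'
      rw [h, h'] at h1
      simp at h1
      linarith
    rw [add_comm] at h1
    exact (trace_mul_comm_aux hp he h1 hT hS).symm
  · exact trace_mul_comm_aux hp h h1 hS hT

variable {α : Type*} {l : Filter α} {X Y : α → H →L[ℂ] H} {x y : H →L[ℂ] H}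

lemma DegTendsto.const (hp : 0 < p) (hT : DegMem p d T) : DegTendsto p d l (fun _ => T) T := by
  refine ⟨hT, ?_⟩
  simp only [sub_self, degNorm_zero hp]
  exact tendsto_const_nhds

lemma DegTendsto.mono (hp : 0 < p) (h : d ≤ e) (hX : DegTendsto p e l X x) :
    DegTendsto p d l X x :=
  ⟨hX.1.mono hp h, tendsto_of_tendsto_of_tendsto_of_le_of_le tendsto_const_nhds hX.2
    (fun _ => zero_le) fun _ => degNorm_mono hp (Int.toNat_le_toNat h) _⟩

lemma DegTendsto.add (hp : 0 < p) (hX : DegTendsto p d l X x) (hY : DegTendsto p d l Y y) :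
    DegTendsto p d l (fun t => X t + Y t) (x + y) := by
  refine ⟨hX.1.add hp hY.1, ?_⟩
  obtain ⟨C, hC, h⟩ := exists_degNorm_add_le (H := H) hp d.toNat
  have h1 := ENNReal.Tendsto.const_mul (hX.2.add hY.2) (Or.inr hC)
  rw [add_zero, mul_zero] at h1
  refine tendsto_of_tendsto_of_tendsto_of_le_of_le tendsto_const_nhds h1
    (fun _ => zero_le) fun t => ?_
  dsimp only
  rw [add_sub_add_comm]
  exact h _ _

lemma DegTendsto.smul (hp : 0 < p) (c : ℂ) (hX : DegTendsto p d l X x) :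
    DegTendsto p d l (fun t => c • X t) (c • x) := by
  refine ⟨hX.1.smul hp c, ?_⟩
  have h1 := ENNReal.Tendsto.const_mul hX.2
    (Or.inr (enorm_ne_top (x := (c • 1 : H →L[ℂ] H))))
  rw [mul_zero] at h1
  refine tendsto_of_tendsto_of_tendsto_of_le_of_le tendsto_const_nhds h1
    (fun _ => zero_le) fun t => ?_
  dsimp only
  rw [← smul_sub]
  exact degNorm_smul_le hp _ _ _

lemma DegTendsto.neg (hp : 0 < p) (hX : DegTendsto p d l X x) :
    DegTendsto p d l (fun t => -X t) (-x) := by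
  simpa using hX.smul hp (-1)

lemma DegTendsto.sub (hp : 0 < p) (hX : DegTendsto p d l X x) (hY : DegTendsto p d l Y y) :
    DegTendsto p d l (fun t => X t - Y t) (x - y) := by
  simp only [sub_eq_add_neg]
  exact hX.add hp (hY.neg hp)

lemma DegTendsto.mul (hp : 0 < p) (hX : DegTendsto p d l X x) (hY : DegTendsto p e l Y y) :
    DegTendsto p (d + e) l (fun t => X t * Y t) (x * y) := by
  refine ⟨hX.1.mul hp hY.1, ?_⟩
  obtain ⟨A, hA, ha⟩ := exists_degNorm_add_le (H := H) hp (d + e).toNat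
  obtain ⟨M, hM, hm⟩ := exists_degNorm_mul_le (H := H) hp d.toNat e.toNat
  have hm' : ∀ S T : H →L[ℂ] H, degNorm p (d + e).toNat (S * T) ≤
      M * (degNorm p d.toNat S * degNorm p e.toNat T) := fun S T =>
    (degNorm_mono hp (by omega) _).trans (hm S T)
  have hbound : ∀ t, degNorm p (d + e).toNat (X t * Y t - x * y) ≤
      A * (A * (M * (degNorm p d.toNat (X t - x) * degNorm p e.toNat (Y t - y)) +
        M * (degNorm p d.toNat (X t - x) * degNorm p e.toNat y)) +
        M * (degNorm p d.toNat x * degNorm p e.toNat (Y t - y))) := fun t => by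
    have h1 : X t * Y t - x * y =
        ((X t - x) * (Y t - y) + (X t - x) * y) + x * (Y t - y) := by noncomm_ring
    rw [h1]
    refine (ha _ _).trans (mul_le_mul' le_rfl (add_le_add ?_ (hm' _ _)))
    exact (ha _ _).trans (mul_le_mul' le_rfl (add_le_add (hm' _ _) (hm' _ _)))
  refine tendsto_of_tendsto_of_tendsto_of_le_of_le tendsto_const_nhds ?_
    (fun _ => zero_le) hbound
  have t1 : Tendsto (fun t => degNorm p d.toNat (X t - x) * degNorm p e.toNat (Y t - y)) l
      (𝓝 (0 * 0)) := ENNReal.Tendsto.mul hX.2 (Or.inr ENNReal.zero_ne_top) hY.2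
        (Or.inr ENNReal.zero_ne_top)
  have t2 : Tendsto (fun t => degNorm p d.toNat (X t - x) * degNorm p e.toNat y) l
      (𝓝 (0 * degNorm p e.toNat y)) := ENNReal.Tendsto.mul_const hX.2 (Or.inr hY.1)
  have t3 : Tendsto (fun t => degNorm p d.toNat x * degNorm p e.toNat (Y t - y)) l
      (𝓝 (degNorm p d.toNat x * 0)) := ENNReal.Tendsto.const_mul hY.2 (Or.inr hX.1)
  have t4 := ENNReal.Tendsto.const_mul (((ENNReal.Tendsto.const_mul
    ((ENNReal.Tendsto.const_mul t1 (Or.inr hM)).add (ENNReal.Tendsto.const_mul t2 (Or.inr hM)))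
    (Or.inr hA))).add (ENNReal.Tendsto.const_mul t3 (Or.inr hM))) (Or.inr hA)
  simpa using t4

lemma DegTendsto.sum (hp : 0 < p) {ι : Type*} (s : Finset ι) {f : ι → α → H →L[ℂ] H}
    {g : ι → H →L[ℂ] H} (h : ∀ i ∈ s, DegTendsto p d l (f i) (g i)) :
    DegTendsto p d l (fun t => ∑ i ∈ s, f i t) (∑ i ∈ s, g i) := by
  classical
  induction s using Finset.induction_on with
  | empty => simpa using DegTendsto.const hp (DegMem.zero hp)
  | insert i s hi ih =>
    simp only [Finset.sum_insert hi]
    exact (h i (Finset.mem_insert_self i s)).add hp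
      (ih fun j hj => h j (Finset.mem_insert_of_mem hj))

/-- Convergence requires membership only of the limit; for the family it follows once the distance
to the limit is finite. -/
lemma DegTendsto.eventually_mem (hp : 0 < p) (hX : DegTendsto p d l X x) :
    ∀ᶠ t in l, DegMem p d (X t) := by
  filter_upwards [hX.2.eventually (gt_mem_nhds ENNReal.zero_lt_top)] with t ht
  have h : DegMem p d (X t - x) := ht.ne
  simpa using h.add hp hX.1

lemma DegTendsto.congr' (hX : DegTendsto p d l X x) (h : X =ᶠ[l] Y) : DegTendsto p d l Y x :=
  ⟨hX.1, hX.2.congr' (by filter_upwards [h] with t ht; rw [ht])⟩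

lemma DegTendsto.trace (hp : 0 < p) (hd : p ≤ d) (hX : DegTendsto p d l X x) :
    Tendsto (fun t => trace (X t)) l (𝓝 (trace x)) := by
  rw [tendsto_iff_edist_tendsto_0]
  have hd' : p ≤ (d.toNat : ℝ) := hd.trans (by exact_mod_cast Int.self_le_toNat d)
  have h1 := ENNReal.Tendsto.const_mul hX.2 (Or.inr (ENNReal.ofNat_ne_top (n := 14)))
  rw [mul_zero] at h1
  refine tendsto_of_tendsto_of_tendsto_of_le_of_le' tendsto_const_nhds h1
    (Eventually.of_forall fun _ => zero_le) ?_
  filter_upwards [hX.eventually_mem hp] with t ht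
  have h2 : Schatten.trace (X t) - Schatten.trace x = Schatten.trace (X t - x) := by
    rw [sub_eq_add_neg (X t), trace_add (ht.traceable hp hd) (hX.1.traceable hp hd).neg,
      trace_neg, sub_eq_add_neg]
  rw [edist_eq_enorm_sub, h2]
  exact (enorm_trace_le _).trans (mul_le_mul' le_rfl (eNorm_one_le_degNorm hp hd' _))

lemma degTendsto_of_nonpos (hd : d ≤ 0) (hX : Tendsto X l (𝓝 x)) : DegTendsto p d l X x := by
  refine ⟨degMem_of_nonpos hd x, ?_⟩
  simp only [Int.toNat_of_nonpos hd, degNorm_zero_left, ← edist_eq_enorm_sub]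
  exact tendsto_iff_edist_tendsto_0.1 hX

end

end Schatten

/-! ### Recursion for the product of neighbouring entries -/

namespace CyclicCohomology

lemma contractNth_zero {α : Type*} {n : ℕ} (op : α → α → α) (g : Fin (n + 2) → α) :
    Fin.contractNth (0 : Fin (n + 2)) op g = Fin.cons (op (g 0) (g 1)) fun i => g i.succ.succ := by
  funext i
  refine Fin.cases ?_ (fun i => ?_) i
  · simp [Fin.contractNth]
  · simp [Fin.contractNth]

lemma contractNth_succ {α : Type*} {n : ℕ} (j : Fin (n + 1)) (op : α → α → α)
    (g : Fin (n + 2) → α) :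
    Fin.contractNth j.succ op g = Fin.cons (g 0) (Fin.contractNth j op fun i => g i.succ) := by
  funext i
  refine Fin.cases ?_ (fun i => ?_) i
  · simp [Fin.contractNth]
  · simp [Fin.contractNth]

/-! ### Words in a ring, and the operators `b` and `B` on traces of words -/

section Words

variable {A E : Type*} [Ring A] [Ring E] [Algebra ℂ E]

/-- The product `δ(x₁) R δ(x₂) R ⋯ δ(x_n) R`. -/
def piWord (δ : A → E) (R : E) : List A → E
  | [] => 1
  | x :: L => δ x * R * piWord δ R L

/-- The alternating sum of the words obtained from `piWord` by replacing one `δ(x_j)` with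
the commutator `[θ, x_j]`. -/
def kapWord (r δ : A → E) (R θ : E) : List A → E
  | [] => 0
  | x :: L => (θ * r x - r x * θ) * R * piWord δ R L - δ x * R * kapWord r δ R θ L

lemma piWord_append (δ : A → E) (R : E) (L L' : List A) :
    piWord δ R (L ++ L') = piWord δ R L * piWord δ R L' := by
  induction L with
  | nil => simp [piWord]
  | cons x L ih => simp only [List.cons_append, piWord, ih, mul_assoc]

/-- The word `a₀ R δ(a₁) R ⋯ δ(a_k) R`. -/
def chWord (r δ : A → E) (R : E) {k : ℕ} (a : Fin (k + 1) → A) : E :=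
  r (a 0) * R * piWord δ R (List.ofFn fun j : Fin k => a j.succ)

variable {r δ : A → E} {R θ z : E}

/-- The alternating sum of the words with one product of neighbouring letters. -/
def contractSum (δ : A → E) (R : E) {k : ℕ} (a : Fin (k + 1) → A) : E :=
  ∑ j : Fin k, (-1 : ℂ) ^ (j : ℕ) •
    piWord δ R (List.ofFn (Fin.contractNth j.castSucc (· * ·) a))

lemma contractSum_succ {k : ℕ} (a : Fin (k + 2) → A) :
    contractSum δ R a =
      δ (a 0 * a 1) * R * piWord δ R (List.ofFn fun j : Fin k => a j.succ.succ) -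
        δ (a 0) * R * contractSum δ R fun j : Fin (k + 1) => a j.succ := by
  rw [contractSum, Fin.sum_univ_succ, contractSum, Finset.mul_sum, sub_eq_add_neg,
    ← Finset.sum_neg_distrib]
  congr 1
  · rw [Fin.castSucc_zero, contractNth_zero, List.ofFn_cons]
    simp [piWord]
  · refine Finset.sum_congr rfl fun j _ => ?_
    rw [← Fin.succ_castSucc, contractNth_succ, List.ofFn_cons]
    simp [piWord, pow_succ]

/-- By the Leibniz rule, consecutive terms of the alternating sum contain the same letter r(a_j) on
either side of one resolvent. What survives is the commutator [R, r(a_j)] = z R [θ, r(a_j)] R, that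
is `kapWord`, together with the two ends of the chain. The central element z stands for the formal
variable. -/
lemma mul_contractSum
    (hδ : ∀ x y, δ (x * y) = δ x * r y + r x * δ y)
    (hR : ∀ x, R * r x - r x * R = z * (R * (θ * r x - r x * θ) * R))
    (hz : ∀ x, z * x = x * z) {k : ℕ} (a : Fin (k + 1) → A) :
    R * contractSum δ R a =
      r (a 0) * R * piWord δ R (List.ofFn fun j : Fin k => a j.succ) +
        z * (R * kapWord r δ R θ (List.ofFn a)) -
        (-1 : ℂ) ^ k • (R * piWord δ R (List.ofFn fun j : Fin k => a j.castSucc) *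
          r (a (Fin.last k))) := by
  induction k with
  | zero =>
    have h := hR (a 0)
    simp only [contractSum, Finset.univ_eq_empty, Finset.sum_empty, mul_zero, List.ofFn_zero,
      piWord, mul_one, List.ofFn_succ, kapWord, sub_zero, pow_zero, one_smul, Fin.last_zero]
    rw [← mul_assoc R (_ - _) R, ← h]
    abel
  | succ k ih =>
    have h := ih fun j => a j.succ
    rw [contractSum_succ, mul_sub, ← mul_assoc R (δ (a 0) * R), ← mul_assoc R (δ (a 0)) R,
      mul_assoc (R * δ (a 0)) R, h, hδ, List.ofFn_succ (f := a), kapWord]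
    have e3 : (List.ofFn fun i : Fin (k + 1) => a i.succ) =
        a 1 :: List.ofFn fun i : Fin k => a i.succ.succ := List.ofFn_succ ..
    have e4 : (List.ofFn fun i : Fin (k + 1) => a i.castSucc) =
        a 0 :: List.ofFn fun i : Fin k => a i.succ.castSucc := List.ofFn_succ ..
    have e5 : piWord δ R (List.ofFn fun i : Fin (k + 1) => a i.succ) =
        δ (a 1) * R * piWord δ R (List.ofFn fun i : Fin k => a i.succ.succ) := by
      rw [e3, piWord]
    have e6 : piWord δ R (List.ofFn fun i : Fin (k + 1) => a i.castSucc) =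
        δ (a 0) * R * piWord δ R (List.ofFn fun i : Fin k => a i.succ.castSucc) := by
      rw [e4, piWord]
    rw [e5, e6]
    simp only [Fin.succ_zero_eq_one, Fin.succ_castSucc, Fin.succ_last]
    set P := piWord δ R (List.ofFn fun i : Fin k => a i.succ.succ)
    set K := kapWord r δ R θ (List.ofFn fun i : Fin (k + 1) => a i.succ)
    set Q := piWord δ R (List.ofFn fun i : Fin k => a i.succ.castSucc)
    have hz1 : R * δ (a 0) * (z * (R * K)) = z * (R * (δ (a 0) * R * K)) := by
      rw [← mul_assoc, ← hz]
      simp only [mul_assoc]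
    have hz2 : z * (R * ((θ * r (a 0) - r (a 0) * θ) * R * (δ (a 1) * R * P))) =
        (R * r (a 0) - r (a 0) * R) * (δ (a 1) * R * P) := by
      rw [hR]
      simp only [mul_assoc]
    have hs : (-1 : ℂ) ^ (k + 1) • (R * (δ (a 0) * R * Q) * r (a (Fin.last (k + 1)))) =
        -(R * δ (a 0) * ((-1 : ℂ) ^ k • (R * Q * r (a (Fin.last (k + 1)))))) := by
      rw [pow_succ, mul_neg_one, neg_smul, mul_smul_comm]
      simp only [mul_assoc]
    rw [mul_sub, mul_add, hz1, mul_sub R, mul_sub z, hz2, hs]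
    noncomm_ring

/-- The two ends left over by `mul_contractSum` cancel the first and the last term of b, the latter
by one use of cyclicity. E and T are kept abstract, since the lemma serves both power series and
matrices of power series. -/
lemma b_chWord (hr : ∀ x y, r (x * y) = r x * r y)
    (hδ : ∀ x y, δ (x * y) = δ x * r y + r x * δ y)
    (hR : ∀ x, R * r x - r x * R = z * (R * (θ * r x - r x * θ) * R))
    (hz : ∀ x, z * x = x * z) (T : E →ₗ[ℂ] ℂ) {k : ℕ} (a : Fin (k + 2) → A)
    (hcyc : T (r (a (Fin.last (k + 1))) * chWord r δ R fun j : Fin (k + 1) => a j.castSucc) =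
      T ((chWord r δ R fun j : Fin (k + 1) => a j.castSucc) * r (a (Fin.last (k + 1))))) :
    b (fun x : Fin (k + 1) → A => T (chWord r δ R x)) a =
      -T (z * (r (a 0) * R * kapWord r δ R θ (List.ofFn fun j : Fin (k + 1) => a j.succ))) := by
  have h := mul_contractSum (r := r) hδ hR hz fun j => a j.succ
  have hsum : ∑ j : Fin (k + 1), (-1 : ℂ) ^ (j : ℕ) •
      chWord r δ R (Fin.contractNth j.castSucc (· * ·) a) =
      r (a 0) * r (a 1) * R * piWord δ R (List.ofFn fun j : Fin k => a j.succ.succ) -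
        r (a 0) * (R * contractSum δ R fun j : Fin (k + 1) => a j.succ) := by
    rw [Fin.sum_univ_succ, contractSum, Finset.mul_sum, Finset.mul_sum, sub_eq_add_neg,
      ← Finset.sum_neg_distrib]
    congr 1
    · rw [Fin.castSucc_zero, contractNth_zero]
      simp [chWord, hr]
    · refine Finset.sum_congr rfl fun j _ => ?_
      rw [← Fin.succ_castSucc, contractNth_succ]
      simp [chWord, pow_succ, mul_assoc]
  have hT := congrArg T hsum
  simp only [map_sum, map_smul, smul_eq_mul] at hT
  rw [b, hT, h]
  have hlast : T (chWord r δ R (Fin.cons (a (Fin.last (k + 1)) * a 0)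
      fun j : Fin k => a j.succ.castSucc)) =
      T ((chWord r δ R fun j : Fin (k + 1) => a j.castSucc) * r (a (Fin.last (k + 1)))) := by
    rw [← hcyc]
    congr 1
    simp [chWord, hr, mul_assoc]
  rw [hlast, ← smul_eq_mul (a := (-1 : ℂ) ^ (k + 1)), ← map_smul, ← map_add, ← map_neg]
  congr 1
  have hz' : z * (r (a 0) * R * kapWord r δ R θ (List.ofFn fun j : Fin (k + 1) => a j.succ)) =
      r (a 0) * (z * (R * kapWord r δ R θ (List.ofFn fun j : Fin (k + 1) => a j.succ))) := by
    rw [← mul_assoc (r (a 0)) z, ← hz (r (a 0))]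
    simp only [mul_assoc]
  rw [hz', chWord, pow_succ, mul_neg_one, neg_smul]
  simp only [Fin.succ_zero_eq_one, Fin.castSucc_zero, Fin.succ_castSucc, Fin.succ_last, mul_sub,
    mul_add, mul_smul_comm, mul_assoc]
  abel

/-- Doubling the j-th resolvent is R² = D R + R. As D kills the letters, summing over j gives the
derivation of the word plus its length times the word. -/
lemma euler_piWord {D : E → E} (hD : ∀ x y, D (x * y) = D x * y + x * D y)
    (hDδ : ∀ x, D (δ x) = 0) (hDR : D R = R * R - R) (L : List A) :
    ∑ j ∈ Finset.range L.length,
        piWord δ R (L.take (j + 1)) * R * piWord δ R (L.drop (j + 1)) =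
      D (piWord δ R L) + (L.length : ℂ) • piWord δ R L := by
  have hD1 : D 1 = 0 := by simpa using hD 1 1
  induction L with
  | nil => simp [piWord, hD1]
  | cons x L ih =>
    have e1 : ∑ j ∈ Finset.range L.length, piWord δ R ((x :: L).take (j + 1 + 1)) * R *
        piWord δ R ((x :: L).drop (j + 1 + 1)) =
        δ x * R * (D (piWord δ R L) + (L.length : ℂ) • piWord δ R L) := by
      rw [← ih, Finset.mul_sum]
      refine Finset.sum_congr rfl fun j _ => ?_
      simp only [List.take_succ_cons, List.drop_succ_cons, piWord, mul_assoc]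
    rw [List.length_cons, Finset.sum_range_succ', e1]
    simp only [zero_add, List.take_succ_cons, List.drop_succ_cons, List.take_zero, List.drop_zero,
      piWord, mul_one, hD, hDδ, hDR, zero_mul]
    push_cast
    rw [add_smul, one_smul]
    simp only [mul_add, mul_smul_comm]
    noncomm_ring

lemma ofFn_add {k : ℕ} (a : Fin (k + 1) → A) (j : Fin (k + 1)) :
    (List.ofFn fun i => a (i + j)) =
      (List.ofFn a).drop (j : ℕ) ++ (List.ofFn a).take (j : ℕ) := by
  rw [← List.rotate_eq_drop_append_take (by simp)]
  refine List.ext_getElem (by simp) fun i h1 h2 => ?_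
  simp only [List.getElem_ofFn, List.getElem_rotate, List.length_ofFn]
  congr 1

/-- As δ(1) = 0, only the first half of B₀ survives, and it puts an R in front. Undoing the cyclic
rotations with graded cyclicity turns the sum over rotations into the sum over the positions of the
doubled resolvent, which `euler_piWord` evaluates. -/
lemma B_chWord (hr1 : r 1 = 1) (hδ1 : δ 1 = 0) {D : E → E}
    (hD : ∀ x y, D (x * y) = D x * y + x * D y)
    (hDδ : ∀ x, D (δ x) = 0) (hDR : D R = R * R - R) (T : E →ₗ[ℂ] ℂ) {k : ℕ}
    (a : Fin (k + 1) → A)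
    (hcyc : ∀ L L' : List A, L.length + L'.length = k + 1 →
      T (R * piWord δ R L * piWord δ R L') =
        (-1 : ℂ) ^ (L.length * L'.length) * T (piWord δ R L' * (R * piWord δ R L))) :
    B (fun x : Fin (k + 2) → A => T (chWord r δ R x)) a =
      T (D (piWord δ R (List.ofFn a))) + (k + 1) * T (piWord δ R (List.ofFn a)) := by
  set L := List.ofFn a with hL
  have hlen : L.length = k + 1 := by simp [hL]
  set f : ℕ → ℂ := fun j => T (piWord δ R (L.take j) * R * piWord δ R (L.drop j)) with hf
  have hB₀ : ∀ x : Fin (k + 1) → A, B₀ (fun x : Fin (k + 2) → A => T (chWord r δ R x)) x =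
      T (R * piWord δ R (List.ofFn x)) := fun x => by
    have h0 : chWord r δ R (Fin.snoc x 1 : Fin (k + 2) → A) = 0 := by
      have h1 : (List.ofFn fun j : Fin (k + 1) => (Fin.snoc x 1 : Fin (k + 2) → A) j.succ) =
          (List.ofFn fun j : Fin k => x j.succ) ++ [1] := by
        rw [List.ofFn_succ']
        simp only [Fin.succ_castSucc, Fin.snoc_castSucc, Fin.succ_last, Fin.snoc_last,
          List.concat_eq_append]
      rw [chWord, h1, piWord_append]
      simp [piWord, hδ1]
    rw [B₀, h0, map_zero, mul_zero, sub_zero]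
    simp [chWord, hr1]
  -- B sums the positions 0, …, k and `euler_piWord` the positions 1, …, k + 1; the extreme ones
  -- agree by cyclicity.
  have hf0 : f 0 = f (k + 1) := by
    have h2 := hcyc [] L (by simpa using hlen)
    simp only [piWord, mul_one, List.length_nil, zero_mul, pow_zero, one_mul] at h2
    simp only [hf, List.take_zero, List.drop_zero, ← hlen, List.take_length, List.drop_length,
      piWord, mul_one, one_mul]
    exact h2
  have hterm : ∀ j : Fin (k + 1), (-1 : ℂ) ^ (k * (j : ℕ)) *
      B₀ (fun x : Fin (k + 2) → A => T (chWord r δ R x)) (fun i => a (i + j)) = f j := fun j => by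
    have hj := j.2
    rw [hB₀, ofFn_add, ← hL, piWord_append, ← mul_assoc R, hcyc _ _ (by simp [hlen]),
      ← mul_assoc, ← pow_add, ← mul_assoc (piWord δ R _) R]
    -- The sign in the definition of B cancels the sign of the rotation.
    have hev : Even (k * (j : ℕ) + (L.drop j).length * (L.take j).length) := by
      have h1 : (L.take j).length = j := by simp [hlen]
      have h2 : (L.drop j).length = k + 1 - j := by simp [hlen]
      obtain ⟨i, hi⟩ : ∃ i, k = i + (j : ℕ) := ⟨k - j, by omega⟩
      rw [h1, h2]
      have h3 : k + 1 - (j : ℕ) = i + 1 := by omega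
      rw [h3, show k * (j : ℕ) = (i + j) * j by rw [← hi]]
      have h4 : (i + (j : ℕ)) * j + (i + 1) * j = 2 * (i * j) + j * (j + 1) := by ring
      rw [h4]
      exact (even_two_mul _).add (Nat.even_mul_succ_self _)
    rw [hev.neg_one_pow, one_mul]
  have heuler := euler_piWord hD hDδ hDR L
  rw [hlen] at heuler
  have hT := congrArg T heuler
  rw [map_sum, map_add, map_smul, smul_eq_mul] at hT
  rw [B, Finset.sum_congr rfl fun j _ => hterm j, ← Finset.sum_range (n := k + 1) (f := f)]
  push_cast at hT
  rw [← hT]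
  have h1 := Finset.sum_range_succ f (k + 1)
  rw [Finset.sum_range_succ' f (k + 1), hf0] at h1
  exact (add_right_cancel h1).symm

end Words

end CyclicCohomology

namespace PowerSeries

/-! ### Resolvents and the Euler derivation of formal power series -/

section

variable {S : Type*} [Ring S] [Algebra ℂ S]

/-- The formal resolvent `(1 - θ X)⁻¹ = ∑ θ^n X^n`. -/
def resolvent (θ : S) : PowerSeries S := mk fun n => θ ^ n

lemma coeff_resolvent (θ : S) (n : ℕ) : coeff n (resolvent θ) = θ ^ n := coeff_mk _ _

lemma resolvent_eq (θ : S) : resolvent θ = 1 + X * (C θ * resolvent θ) := by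
  ext n
  rcases n with _ | n
  · simp [coeff_resolvent]
  · rw [map_add, coeff_succ_X_mul, coeff_C_mul, coeff_resolvent, coeff_resolvent, coeff_one,
      if_neg n.succ_ne_zero, zero_add, pow_succ']

lemma resolvent_eq' (θ : S) : resolvent θ = 1 + X * (resolvent θ * C θ) := by
  ext n
  rcases n with _ | n
  · simp [coeff_resolvent]
  · rw [map_add, coeff_succ_X_mul, coeff_mul_C, coeff_resolvent, coeff_resolvent, coeff_one,
      if_neg n.succ_ne_zero, zero_add, pow_succ]

lemma X_mul_eq (f : PowerSeries S) : X * f = f * X := (commute_X f).symm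

lemma mul_X_mul (f g : PowerSeries S) : f * (X * g) = X * (f * g) := by
  rw [← mul_assoc, ← X_mul_eq, mul_assoc]

/-- The difference of two resolvents. -/
lemma resolvent_sub (θ η : S) :
    resolvent θ - resolvent η = X * (resolvent θ * C (θ - η) * resolvent η) := by
  have h1 := resolvent_eq' θ
  have h2 := resolvent_eq η
  have e1 : resolvent θ * (resolvent η - X * (C η * resolvent η)) = resolvent θ := by
    rw [sub_eq_of_eq_add h2, mul_one]
  have e2 : (resolvent θ - X * (resolvent θ * C θ)) * resolvent η = resolvent η := by
    rw [sub_eq_of_eq_add h1, one_mul]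
  rw [show resolvent θ - resolvent η =
      resolvent θ * (resolvent η - X * (C η * resolvent η)) -
        (resolvent θ - X * (resolvent θ * C θ)) * resolvent η by rw [e1, e2],
    mul_sub, sub_mul, mul_X_mul, map_sub]
  simp only [mul_sub, sub_mul, mul_assoc]
  abel

/-- With R the resolvent, R f - f R = R (f (1 - θX) - (1 - θX) f) R, and X is central. -/
lemma resolvent_commutator (θ : S) (f : PowerSeries S) :
    resolvent θ * f - f * resolvent θ =
      X * (resolvent θ * (C θ * f - f * C θ) * resolvent θ) := by
  have h1 := resolvent_eq' θ
  have h2 := resolvent_eq θ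
  have e1 : resolvent θ * f * (resolvent θ - X * (C θ * resolvent θ)) = resolvent θ * f := by
    rw [sub_eq_of_eq_add h2, mul_one]
  have e2 : (resolvent θ - X * (resolvent θ * C θ)) * (f * resolvent θ) = f * resolvent θ := by
    rw [sub_eq_of_eq_add h1, one_mul]
  rw [show resolvent θ * f - f * resolvent θ =
      resolvent θ * f * (resolvent θ - X * (C θ * resolvent θ)) -
        (resolvent θ - X * (resolvent θ * C θ)) * (f * resolvent θ) by rw [e1, e2],
    mul_sub, sub_mul, mul_X_mul]
  simp only [mul_sub, sub_mul, mul_assoc]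
  abel

/-- The derivation `X d/dX`. -/
def euler : PowerSeries S →ₗ[ℂ] PowerSeries S where
  toFun f := mk fun n => (n : ℂ) • coeff n f
  map_add' f g := by ext n; simp
  map_smul' c f := by
    ext n
    simp [smul_comm (n : ℂ) c]

lemma coeff_euler (f : PowerSeries S) (n : ℕ) : coeff n (euler f) = (n : ℂ) • coeff n f := by
  change coeff n (mk fun n => (n : ℂ) • coeff n f) = _
  exact coeff_mk _ _

lemma euler_mul (f g : PowerSeries S) : euler (f * g) = euler f * g + f * euler g := by
  ext n
  rw [map_add, coeff_euler, coeff_mul, coeff_mul, coeff_mul, Finset.smul_sum,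
    ← Finset.sum_add_distrib]
  refine Finset.sum_congr rfl fun ij hij => ?_
  rw [coeff_euler, coeff_euler, smul_mul_assoc, mul_smul_comm, ← add_smul, ← Nat.cast_add,
    Finset.HasAntidiagonal.mem_antidiagonal.1 hij]

lemma euler_C (x : S) : euler (C x) = 0 := by
  ext n
  rcases n with _ | n
  · simp [coeff_euler]
  · rw [coeff_euler, coeff_C, if_neg n.succ_ne_zero, smul_zero, map_zero]

lemma euler_X : euler (X : PowerSeries S) = X := by
  ext n
  rw [coeff_euler, coeff_X]
  split_ifs with h
  · simp [h]
  · simp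

/-- The n-th coefficient of R² is θ^n taken n + 1 times. -/
lemma euler_resolvent (θ : S) :
    euler (resolvent θ) = resolvent θ * resolvent θ - resolvent θ := by
  ext n
  rw [map_sub, coeff_euler, coeff_mul]
  simp only [coeff_resolvent]
  rw [Finset.sum_congr rfl fun ij hij => by
    rw [← pow_add, Finset.HasAntidiagonal.mem_antidiagonal.1 hij], Finset.sum_const,
    Finset.Nat.card_antidiagonal, ← Nat.cast_smul_eq_nsmul ℂ]
  push_cast
  rw [add_smul, one_smul, add_sub_cancel_right]

lemma sum_antidiagonalTuple_succ {M : Type*} [AddCommMonoid M] (r n : ℕ)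
    (g : (Fin (r + 1) → ℕ) → M) :
    ∑ i ∈ Finset.Nat.antidiagonalTuple (r + 1) n, g i =
      ∑ ij ∈ Finset.HasAntidiagonal.antidiagonal n, ∑ i ∈ Finset.Nat.antidiagonalTuple r ij.2,
        g (Fin.cons ij.1 i) := by
  rw [Finset.sum_sigma']
  refine (Finset.sum_bij (fun x _ => Fin.cons x.1.1 x.2) ?_ ?_ ?_ ?_).symm
  · rintro ⟨⟨u, v⟩, i⟩ h
    simp only [Finset.mem_sigma, Finset.HasAntidiagonal.mem_antidiagonal, Finset.Nat.mem_antidiagonalTuple] at h ⊢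
    rw [Fin.sum_univ_succ]
    simp [h.1, h.2]
  · rintro ⟨⟨u, v⟩, i⟩ h ⟨⟨u', v'⟩, i'⟩ h' heq
    simp only [Finset.mem_sigma, Finset.HasAntidiagonal.mem_antidiagonal, Finset.Nat.mem_antidiagonalTuple] at h h'
    obtain ⟨h1, h2⟩ := Fin.cons_injective2 heq
    dsimp only at h1 h2 h h'
    subst h1 h2
    have : v = v' := h.2.symm.trans h'.2
    subst this
    rfl
  · intro i hi
    rw [Finset.Nat.mem_antidiagonalTuple, Fin.sum_univ_succ] at hi
    refine ⟨⟨(i 0, ∑ j, i (Fin.succ j)), Fin.tail i⟩, ?_, Fin.cons_self_tail i⟩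
    simp only [Finset.mem_sigma, Finset.HasAntidiagonal.mem_antidiagonal, Finset.Nat.mem_antidiagonalTuple]
    exact ⟨hi, rfl⟩
  · intro _ _
    rfl

/-- The passage to generating functions: sums over exponents of fixed total become one coefficient
of a product of resolvents. -/
lemma sum_prod_ofFn_eq_coeff (θ : S) {r : ℕ} (f : Fin r → S) (n : ℕ) :
    ∑ i ∈ Finset.Nat.antidiagonalTuple r n, (List.ofFn fun j => f j * θ ^ i j).prod =
      coeff n (List.ofFn fun j => C (f j) * resolvent θ).prod := by
  induction r generalizing n with
  | zero =>
    rcases n with _ | n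
    · simp
    · simp [coeff_one]
  | succ r ih =>
    rw [sum_antidiagonalTuple_succ, List.ofFn_succ, List.prod_cons, coeff_mul]
    refine Finset.sum_congr rfl fun ij _ => ?_
    rw [← ih, coeff_C_mul, coeff_resolvent, Finset.mul_sum]
    refine Finset.sum_congr rfl fun i _ => ?_
    rw [List.ofFn_succ, List.prod_cons]
    simp

end

end PowerSeries

/-! ### Parity -/

/-- `x` has parity `i` with respect to the grading operator `g`. -/
def HasParity {S : Type*} [Ring S] [Algebra ℂ S] (g : S) (i : ℕ) (x : S) : Prop :=
  g * x = (-1 : ℂ) ^ i • (x * g)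

namespace HasParity

variable {S : Type*} [Ring S] [Algebra ℂ S] {g x y : S} {i j : ℕ}

lemma one : HasParity g 0 1 := by simp [HasParity]

lemma add (hx : HasParity g i x) (hy : HasParity g i y) : HasParity g i (x + y) := by
  rw [HasParity, mul_add, hx, hy, ← smul_add, add_mul]

lemma smul (c : ℂ) (hx : HasParity g i x) : HasParity g i (c • x) := by
  rw [HasParity, mul_smul_comm, hx, smul_mul_assoc, smul_comm]

lemma neg (hx : HasParity g i x) : HasParity g i (-x) := by
  simpa using hx.smul (-1)

lemma sub (hx : HasParity g i x) (hy : HasParity g i y) : HasParity g i (x - y) := by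
  rw [sub_eq_add_neg]
  exact hx.add hy.neg

lemma mul (hx : HasParity g i x) (hy : HasParity g j y) : HasParity g (i + j) (x * y) := by
  rw [HasParity, ← mul_assoc, hx, smul_mul_assoc, mul_assoc, hy, mul_smul_comm, smul_smul,
    ← pow_add, mul_assoc]

lemma pow (hx : HasParity g 0 x) (n : ℕ) : HasParity g 0 (x ^ n) := by
  induction n with
  | zero => simpa using one
  | succ n ih => simpa [pow_succ] using ih.mul hx

lemma congr (hx : HasParity g i x) (h : (-1 : ℂ) ^ i = (-1) ^ j) : HasParity g j x := by
  rw [HasParity, ← h]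
  exact hx

end HasParity

namespace Schatten

variable {H : Type*} [NormedAddCommGroup H] [InnerProductSpace ℂ H] [CompleteSpace H]

/-! ### A linear extension of the trace -/

variable (H) in
/-- The operators whose trace series converges. -/
def traceableSubmodule : Submodule ℂ (H →L[ℂ] H) where
  carrier := {T | Traceable T}
  add_mem' := Traceable.add
  zero_mem' := by
    change Summable _
    simp
  smul_mem' c T hT := by
    have : Summable _ := Summable.mul_left c hT
    change Summable _
    simpa only [smul_apply, inner_smul_right] using this

/-- With a functional defined on all bounded operators, operator identities may be split into
summands that are not of trace class; degrees have to be checked only where cyclicity, continuity or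
agreement with the trace is used. -/
lemma exists_linear_trace : ∃ f : (H →L[ℂ] H) →ₗ[ℂ] ℂ, ∀ T, Traceable T → f T = trace T := by
  let g : traceableSubmodule H →ₗ[ℂ] ℂ :=
    { toFun := fun T => trace (T : H →L[ℂ] H)
      map_add' := fun S T => trace_add S.2 T.2
      map_smul' := fun c T => trace_smul c _ }
  obtain ⟨f, hf⟩ := g.exists_extend
  exact ⟨f, fun T hT => congrArg (fun h => h ⟨T, hT⟩) hf⟩

variable (H) in
/-- A linear functional on all bounded operators that extends the trace. -/
def linTrace : (H →L[ℂ] H) →ₗ[ℂ] ℂ := exists_linear_trace.choose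

lemma linTrace_eq {T : H →L[ℂ] H} (hT : Traceable T) : linTrace H T = trace T :=
  exists_linear_trace.choose_spec T hT

lemma linTrace_mul_comm {p : ℝ} (hp : 0 < p) {d e : ℤ} {S T : H →L[ℂ] H}
    (hde : p ≤ (d + e : ℤ)) (hS : DegMem p d S) (hT : DegMem p e T) :
    linTrace H (S * T) = linTrace H (T * S) := by
  rw [linTrace_eq ((hS.mul hp hT).traceable hp hde),
    linTrace_eq ((hT.mul hp hS).traceable hp (by rwa [add_comm])), trace_mul_comm hp hde hS hT]

lemma tendsto_linTrace {α : Type*} {l : Filter α} {p : ℝ} (hp : 0 < p) {d : ℤ} (hd : p ≤ d)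
    {X : α → H →L[ℂ] H} {x : H →L[ℂ] H} (hX : DegTendsto p d l X x) :
    Tendsto (fun t => linTrace H (X t)) l (𝓝 (linTrace H x)) := by
  rw [linTrace_eq (hX.1.traceable hp hd)]
  refine (hX.trace hp hd).congr' ?_
  filter_upwards [hX.eventually_mem hp] with t ht
  exact (linTrace_eq (ht.traceable hp hd)).symm

/-! ### Power series of operators -/

open PowerSeries

/-- Convergence of formal power series of operators, where the formal variable has
degree `-2`. -/
def SerTendsto {α : Type*} (p : ℝ) (d : ℤ) (l : Filter α) (f : α → PowerSeries (H →L[ℂ] H))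
    (g : PowerSeries (H →L[ℂ] H)) : Prop :=
  ∀ n : ℕ, DegTendsto p (d + 2 * n) l (fun t => coeff n (f t)) (coeff n g)

/-- Formal power series of operators of degree `d`, where the formal variable has
degree `-2`. -/
def SerMem (p : ℝ) (d : ℤ) (f : PowerSeries (H →L[ℂ] H)) : Prop :=
  ∀ n : ℕ, DegMem p (d + 2 * n) (coeff n f)

section

variable {p : ℝ} {d e : ℤ} {α : Type*} {l : Filter α} {f f' : α → PowerSeries (H →L[ℂ] H)}
  {g g' : PowerSeries (H →L[ℂ] H)}

lemma SerTendsto.mem (h : SerTendsto p d l f g) : SerMem p d g := fun n => (h n).1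

lemma SerTendsto.const (hp : 0 < p) (h : SerMem p d g) : SerTendsto p d l (fun _ => g) g :=
  fun n => DegTendsto.const hp (h n)

/-- Membership is convergence of a constant family, here along the trivial filter, so every closure
property needs a proof only for convergence. -/
lemma SerMem.tendsto (hp : 0 < p) (h : SerMem p d g) :
    SerTendsto p d (⊥ : Filter Unit) (fun _ => g) g := SerTendsto.const hp h

lemma SerTendsto.mono (hp : 0 < p) (hde : d ≤ e) (h : SerTendsto p e l f g) :
    SerTendsto p d l f g := fun n => (h n).mono hp (by omega)

lemma SerTendsto.add (hp : 0 < p) (h : SerTendsto p d l f g) (h' : SerTendsto p d l f' g') :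
    SerTendsto p d l (fun t => f t + f' t) (g + g') := fun n => by
  simp only [map_add]
  exact (h n).add hp (h' n)

lemma SerTendsto.smul (hp : 0 < p) (c : ℂ) (h : SerTendsto p d l f g) :
    SerTendsto p d l (fun t => c • f t) (c • g) := fun n => by
  simp only [coeff_smul]
  exact (h n).smul hp c

lemma SerTendsto.neg (hp : 0 < p) (h : SerTendsto p d l f g) :
    SerTendsto p d l (fun t => -f t) (-g) := by
  simpa using h.smul hp (-1)

lemma SerTendsto.sub (hp : 0 < p) (h : SerTendsto p d l f g) (h' : SerTendsto p d l f' g') :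
    SerTendsto p d l (fun t => f t - f' t) (g - g') := by
  simp only [sub_eq_add_neg]
  exact h.add hp (h'.neg hp)

lemma SerTendsto.mul (hp : 0 < p) (h : SerTendsto p d l f g) (h' : SerTendsto p e l f' g') :
    SerTendsto p (d + e) l (fun t => f t * f' t) (g * g') := fun n => by
  simp only [coeff_mul]
  refine DegTendsto.sum hp _ fun ij hij => ?_
  have hn := Finset.HasAntidiagonal.mem_antidiagonal.1 hij
  refine ((h ij.1).mul hp (h' ij.2)).mono hp ?_
  omega

lemma SerTendsto.X_mul (hp : 0 < p) (h : SerTendsto p d l f g) :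
    SerTendsto p (d - 2) l (fun t => X * f t) (X * g) := fun n => by
  rcases n with _ | n
  · simpa using DegTendsto.const hp (DegMem.zero hp)
  · simp only [coeff_succ_X_mul]
    refine (h n).mono hp ?_
    push_cast
    omega

lemma SerTendsto.C (hp : 0 < p) {Y : α → H →L[ℂ] H} {y : H →L[ℂ] H} (h : DegTendsto p d l Y y) :
    SerTendsto p d l (fun t => C (Y t)) (C y) := fun n => by
  rcases n with _ | n
  · simpa using h
  · simpa [coeff_C] using DegTendsto.const hp (DegMem.zero hp)

lemma DegTendsto.pow (hp : 0 < p) {Y : α → H →L[ℂ] H} {y : H →L[ℂ] H}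
    (h : DegTendsto p 2 l Y y) (n : ℕ) :
    DegTendsto p (2 * n) l (fun t => Y t ^ n) (y ^ n) := by
  induction n with
  | zero => simpa using DegTendsto.const hp (degMem_of_nonpos le_rfl _)
  | succ n ih =>
    simp only [pow_succ]
    refine (ih.mul hp h).mono hp ?_
    push_cast
    omega

lemma SerTendsto.resolvent (hp : 0 < p) {Y : α → H →L[ℂ] H} {y : H →L[ℂ] H}
    (h : DegTendsto p 2 l Y y) :
    SerTendsto p 0 l (fun t => resolvent (Y t)) (resolvent y) := fun n => by
  simp only [coeff_resolvent, zero_add]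
  exact h.pow hp n

lemma SerMem.mono (hp : 0 < p) (hde : d ≤ e) (h : SerMem p e g) : SerMem p d g :=
  ((h.tendsto hp).mono hp hde).mem

lemma SerMem.smul (hp : 0 < p) (c : ℂ) (h : SerMem p d g) : SerMem p d (c • g) :=
  ((h.tendsto hp).smul hp c).mem

lemma SerMem.sub (hp : 0 < p) (h : SerMem p d g) (h' : SerMem p d g') : SerMem p d (g - g') :=
  ((h.tendsto hp).sub hp (h'.tendsto hp)).mem

lemma SerMem.mul (hp : 0 < p) (h : SerMem p d g) (h' : SerMem p e g') :
    SerMem p (d + e) (g * g') :=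
  ((h.tendsto hp).mul hp (h'.tendsto hp)).mem

lemma SerMem.X_mul (hp : 0 < p) (h : SerMem p d g) : SerMem p (d - 2) (X * g) :=
  ((h.tendsto hp).X_mul hp).mem

lemma SerMem.C (hp : 0 < p) {y : H →L[ℂ] H} (h : DegMem p d y) : SerMem p d (C y) :=
  (SerTendsto.C (l := (⊥ : Filter Unit)) hp (DegTendsto.const hp h)).mem

lemma SerMem.resolvent (hp : 0 < p) {y : H →L[ℂ] H} (h : DegMem p 2 y) :
    SerMem p 0 (resolvent y) :=
  (SerTendsto.resolvent (l := (⊥ : Filter Unit)) hp (DegTendsto.const hp h)).mem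

lemma SerMem.zero (hp : 0 < p) : SerMem p d (0 : PowerSeries (H →L[ℂ] H)) := fun n => by
  simpa using DegMem.zero hp

lemma SerMem.one (hp : 0 < p) : SerMem p 0 (1 : PowerSeries (H →L[ℂ] H)) := fun n => by
  rcases n with _ | n
  · exact degMem_of_nonpos (by simp) _
  · rw [coeff_one, if_neg n.succ_ne_zero]
    exact DegMem.zero hp

end

/-- The functional `f ↦ Tr γ f_n`, where `f_n` is the `n`-th coefficient of `f`. -/
def serTrace (γ : H →L[ℂ] H) (n : ℕ) : PowerSeries (H →L[ℂ] H) →ₗ[ℂ] ℂ where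
  toFun f := linTrace H (γ * coeff n f)
  map_add' f g := by rw [map_add, mul_add, map_add]
  map_smul' c f := by rw [coeff_smul, mul_smul_comm, map_smul, RingHom.id_apply]

lemma serTrace_apply (γ : H →L[ℂ] H) (n : ℕ) (f : PowerSeries (H →L[ℂ] H)) :
    serTrace γ n f = linTrace H (γ * coeff n f) := rfl

lemma tendsto_serTrace {p : ℝ} (hp : 0 < p) (γ : H →L[ℂ] H) {d : ℤ} {n : ℕ}
    (hd : p ≤ (d + 2 * n : ℤ)) {α : Type*} {l : Filter α} {f : α → PowerSeries (H →L[ℂ] H)}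
    {g : PowerSeries (H →L[ℂ] H)} (h : SerTendsto p d l f g) :
    Tendsto (fun t => serTrace γ n (f t)) l (𝓝 (serTrace γ n g)) := by
  simp only [serTrace_apply]
  refine tendsto_linTrace hp (d := 0 + (d + 2 * n)) (by rwa [zero_add]) ?_
  exact (DegTendsto.const hp (degMem_of_nonpos le_rfl γ)).mul hp (h n)

lemma hasParity_iff_coeff {γ : H →L[ℂ] H} {i : ℕ} {f : PowerSeries (H →L[ℂ] H)} :
    HasParity (C γ) i f ↔ ∀ n, HasParity γ i (coeff n f) := by
  simp only [HasParity, PowerSeries.ext_iff, coeff_C_mul, coeff_smul, coeff_mul_C]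

lemma _root_.HasParity.C {γ y : H →L[ℂ] H} {i : ℕ} (h : HasParity γ i y) :
    HasParity (PowerSeries.C γ) i (PowerSeries.C y) := by
  rw [HasParity, ← map_mul, h, ← map_mul]
  ext n
  simp [coeff_C]

lemma _root_.HasParity.X_mul {γ : H →L[ℂ] H} {i : ℕ} {f : PowerSeries (H →L[ℂ] H)}
    (h : HasParity (PowerSeries.C γ) i f) : HasParity (PowerSeries.C γ) i (X * f) := by
  rw [HasParity, mul_X_mul, h, mul_smul_comm, mul_assoc]

lemma _root_.HasParity.resolvent {γ y : H →L[ℂ] H} (h : HasParity γ 0 y) :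
    HasParity (PowerSeries.C γ) 0 (resolvent y) :=
  hasParity_iff_coeff.2 fun n => by
    rw [coeff_resolvent]
    exact h.pow n

/-- The graded trace is graded cyclic. -/
lemma serTrace_mul_comm {p : ℝ} (hp : 0 < p) {γ : H →L[ℂ] H} {d e : ℤ} {n j : ℕ}
    (hde : p ≤ (d + e + 2 * n : ℤ)) {f g : PowerSeries (H →L[ℂ] H)} (hf : SerMem p d f)
    (hg : SerMem p e g) (hj : HasParity (C γ) j g) :
    serTrace γ n (f * g) = (-1 : ℂ) ^ j * serTrace γ n (g * f) := by
  rw [serTrace_apply, serTrace_apply, coeff_mul, coeff_mul,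
    ← Finset.Nat.sum_antidiagonal_swap (f := fun ij => coeff ij.1 g * coeff ij.2 f), Finset.mul_sum,
    Finset.mul_sum, map_sum, map_sum, Finset.mul_sum]
  refine Finset.sum_congr rfl fun ij hij => ?_
  have hn := Finset.HasAntidiagonal.mem_antidiagonal.1 hij
  have hγ : DegMem p (0 + (d + 2 * ij.1)) (γ * coeff ij.1 f) :=
    (degMem_of_nonpos le_rfl γ).mul hp (hf _)
  -- The indices add up to n, so each product of coefficients has total degree d + e + 2n and may be
  -- rotated separately.
  rw [← mul_assoc, linTrace_mul_comm hp ?_ hγ (hg _)]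
  · have h1 := hasParity_iff_coeff.1 hj ij.2
    have h2 : coeff ij.2 g * (γ * coeff ij.1 f) =
        (-1 : ℂ) ^ j • (γ * (coeff ij.2 g * coeff ij.1 f)) := by
      rw [← mul_assoc γ, h1, smul_mul_assoc, smul_smul, ← mul_pow, neg_one_mul, neg_neg, one_pow,
        one_smul, mul_assoc]
    rw [h2, map_smul, smul_eq_mul]
    rfl
  · refine hde.trans ?_
    have : d + e + 2 * n ≤ 0 + (d + 2 * ij.1) + (e + 2 * ij.2) := by omega
    exact_mod_cast this

end Schatten

namespace GradedRep

open CyclicCohomology Schatten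

variable {A H : Type*} [Ring A] [Algebra ℂ A]
  [NormedAddCommGroup H] [InnerProductSpace ℂ H] [CompleteSpace H]

/-! ### Vanishing of traces of graded commutators with `F` -/

/-- FY and YG need not be of trace class; only their sum Z is assumed to have degree at least p.
Insert 1 = θ + F² in front of Z. In the θ-part the two extra degrees allow each summand to be
rotated; in F(FZ) one rotates the factor G of FZG, which is legitimate because Z is of trace class,
and G changes sign on passing γ. For F = G the right hand side is 0; for F close to G it consists of
error terms. -/
lemma linTrace_anticommutator {p : ℝ} (hp : 0 < p) {γ F G Y : H →L[ℂ] H} {e N : ℤ}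
    (hF : HasParity γ 1 F) (hG : HasParity γ 1 G)
    (hθ : DegMem p 2 (1 - F ^ 2)) (hY : DegMem p e Y) (he : p ≤ (e + 2 : ℤ))
    (hZ : DegMem p N (F * Y + Y * G)) (hN : p ≤ N) :
    2 * linTrace H (γ * (F * Y + Y * G)) =
      2 * linTrace H (γ * ((F - G) * ((1 - F ^ 2) * Y))) +
        linTrace H (γ * ((F - G) * (F * (F * Y + Y * G)))) +
        linTrace H (γ * (F * (Y * ((1 - G ^ 2) - (1 - F ^ 2))))) := by
  have hF' : F * γ = -(γ * F) := by
    have h : γ * F = -(F * γ) := by simpa [HasParity] using hF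
    rw [h, neg_neg]
  have hG' : G * γ = -(γ * G) := by
    have h : γ * G = -(G * γ) := by simpa [HasParity] using hG
    rw [h, neg_neg]
  set θ := 1 - F ^ 2 with hθdef
  set η := 1 - G ^ 2 with hηdef
  set Z := F * Y + Y * G with hZdef
  have hθF : θ * F = F * θ := by rw [hθdef]; noncomm_ring
  have hθγ : θ * γ = γ * θ := by
    have : F ^ 2 * γ = γ * F ^ 2 := by
      rw [pow_two, mul_assoc, hF', mul_neg, ← mul_assoc, hF', neg_mul, neg_neg, mul_assoc]
    rw [hθdef, sub_mul, mul_sub, this, one_mul, mul_one]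
  have h0 : ∀ X : H →L[ℂ] H, DegMem p 0 X := degMem_of_nonpos le_rfl
  have c1 : linTrace H (γ * F * Z * G) = linTrace H (G * (γ * F * Z)) :=
    linTrace_mul_comm hp (d := 0 + N) (e := 0) (by simpa using hN) ((h0 _).mul hp hZ) (h0 _)
  have c2 : linTrace H (γ * F * Y * θ) = linTrace H (θ * (γ * F * Y)) :=
    linTrace_mul_comm hp (d := 0 + e) (e := 2) (by simpa using he) ((h0 _).mul hp hY) hθ
  have c3 : linTrace H (γ * (θ * Y) * G) = linTrace H (G * (γ * (θ * Y))) :=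
    linTrace_mul_comm hp (d := 0 + (2 + e)) (e := 0) (by simpa [add_comm] using he)
      ((h0 _).mul hp (hθ.mul hp hY)) (h0 _)
  have e1 : γ * Z = (γ * (θ * (F * Y)) + γ * (θ * Y) * G) + γ * (F * (F * Z)) := by
    rw [hθdef, hZdef]; noncomm_ring
  have e2 : γ * (F * (F * Z)) = γ * F * Z * G - γ * (F * (θ * Y)) + γ * F * Y * η := by
    rw [hθdef, hηdef, hZdef]; noncomm_ring
  have e3 : G * (γ * F * Z) = -(γ * (F * (F * Z)) - γ * ((F - G) * (F * Z))) := by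
    rw [show G * (γ * F * Z) = (G * γ) * (F * Z) by noncomm_ring, hG']
    noncomm_ring
  have e4 : γ * F * Y * η = γ * (F * (Y * (η - θ))) + γ * F * Y * θ := by noncomm_ring
  have e5 : θ * (γ * F * Y) = γ * (F * (θ * Y)) := by
    rw [show θ * (γ * F * Y) = θ * γ * (F * Y) by noncomm_ring, hθγ,
      show γ * θ * (F * Y) = γ * (θ * F * Y) by noncomm_ring, hθF, mul_assoc F]
  have e6 : G * (γ * (θ * Y)) = -(γ * (θ * (F * Y))) + γ * ((F - G) * (θ * Y)) := by
    rw [show G * (γ * (θ * Y)) = G * γ * (θ * Y) by noncomm_ring, hG',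
      show γ * (θ * (F * Y)) = γ * (θ * F * Y) by noncomm_ring, hθF]
    noncomm_ring
  have f1 := congrArg (linTrace H) e1
  have f2 := congrArg (linTrace H) e2
  have f3 := congrArg (linTrace H) e3
  have f4 := congrArg (linTrace H) e4
  have f5 := congrArg (linTrace H) e5
  have f6 := congrArg (linTrace H) e6
  simp only [map_add, map_sub, map_neg] at f1 f2 f3 f4 f5 f6
  linear_combination 2 * f1 + f2 + c1 + f3 + f4 + c2 + f5 + 2 * c3 + 2 * f6

/-! ### Words in operators -/

/-- The constant power series `a`. -/
def rc (M : GradedRep A H) (a : A) : PowerSeries (H →L[ℂ] H) := PowerSeries.C (M.ρ a)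

/-- The constant power series `[F, a]`. -/
def dc (M : GradedRep A H) (F : H →L[ℂ] H) (a : A) : PowerSeries (H →L[ℂ] H) :=
  PowerSeries.C (M.comm F a)

/-- The constant power series `1 - F²`. -/
def tc (F : H →L[ℂ] H) : PowerSeries (H →L[ℂ] H) := PowerSeries.C (1 - F ^ 2)

/-- The formal resolvent of `1 - F²`. -/
def Rc (F : H →L[ℂ] H) : PowerSeries (H →L[ℂ] H) := PowerSeries.resolvent (1 - F ^ 2)

section algebra

variable (M : GradedRep A H) (F : H →L[ℂ] H)

lemma rc_mul (x y : A) : M.rc (x * y) = M.rc x * M.rc y := by simp [rc]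

lemma rc_one : M.rc 1 = 1 := by simp [rc]

lemma comm_mul (x y : A) :
    M.comm F (x * y) = M.comm F x * M.ρ y + M.ρ x * M.comm F y := by
  simp only [comm, map_mul]
  noncomm_ring

lemma dc_mul (x y : A) : M.dc F (x * y) = M.dc F x * M.rc y + M.rc x * M.dc F y := by
  simp only [dc, rc, comm_mul, map_add, map_mul]

lemma dc_one : M.dc F 1 = 0 := by simp [dc, comm]

lemma Rc_commutator (x : A) : Rc F * M.rc x - M.rc x * Rc F =
    PowerSeries.X * (Rc F * (tc F * M.rc x - M.rc x * tc F) * Rc F) :=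
  PowerSeries.resolvent_commutator _ _

lemma anticomm_dc (x : A) : PowerSeries.C F * M.dc F x + M.dc F x * PowerSeries.C F =
    -(tc F * M.rc x - M.rc x * tc F) := by
  simp only [dc, rc, tc, ← map_mul, ← map_add, ← map_sub, ← map_neg]
  congr 1
  simp only [comm]
  noncomm_ring

lemma C_mul_Rc : PowerSeries.C F * Rc F = Rc F * PowerSeries.C F := by
  refine PowerSeries.ext fun n => ?_
  rw [Rc, PowerSeries.coeff_C_mul, PowerSeries.coeff_mul_C, PowerSeries.coeff_resolvent]
  have h : Commute F (1 - F ^ 2) :=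
    (Commute.one_right F).sub_right ((Commute.refl F).pow_right 2)
  exact (h.pow_right n).eq

/-- F commutes with the resolvent, and F[F,x] + [F,x]F = [F²,x] = -[θ,x]. Moving F through the word
therefore changes the sign once for every letter and leaves `kapWord` behind. -/
lemma C_mul_piWord (L : List A) : PowerSeries.C F * piWord (M.dc F) (Rc F) L =
    (-1 : ℂ) ^ L.length • (piWord (M.dc F) (Rc F) L * PowerSeries.C F) -
      kapWord M.rc (M.dc F) (Rc F) (tc F) L := by
  induction L with
  | nil => simp [piWord, kapWord]
  | cons x L ih =>
    have h1 : PowerSeries.C F * M.dc F x = -(M.dc F x * PowerSeries.C F) -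
        (tc F * M.rc x - M.rc x * tc F) := by
      rw [eq_sub_iff_add_eq, ← neg_eq_iff_eq_neg.2 (anticomm_dc M F x).symm.symm]
      abel
    rw [piWord, kapWord, List.length_cons, ← mul_assoc, ← mul_assoc, h1, sub_mul, neg_mul, sub_mul,
      neg_mul, mul_assoc (M.dc F x) (PowerSeries.C F), C_mul_Rc, ← mul_assoc (M.dc F x), mul_assoc _
      (PowerSeries.C F), ih, pow_succ, mul_neg_one, neg_smul]
    simp only [mul_sub, sub_mul, mul_smul_comm, mul_assoc]
    abel

lemma piWord_eq_prod (δ : A → PowerSeries (H →L[ℂ] H)) (R : PowerSeries (H →L[ℂ] H)) {k : ℕ}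
    (a : Fin k → A) : piWord δ R (List.ofFn a) = (List.ofFn fun j => δ (a j) * R).prod := by
  induction k with
  | zero => simp [piWord]
  | succ k ih => rw [List.ofFn_succ, List.ofFn_succ, piWord, List.prod_cons, ih]

lemma sum_word_eq_coeff {r : ℕ} (f : Fin r → H →L[ℂ] H) (n : ℕ) :
    ∑ i ∈ Finset.Nat.antidiagonalTuple r n, word (1 - F ^ 2) f i =
      PowerSeries.coeff n (List.ofFn fun j => PowerSeries.C (f j) * Rc F).prod :=
  PowerSeries.sum_prod_ofFn_eq_coeff _ _ _

lemma sum_chOp {k : ℕ} (a : Fin (k + 1) → A) (n : ℕ) :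
    ∑ i ∈ Finset.Nat.antidiagonalTuple (k + 1) n, M.chOp F a i =
      M.γ * PowerSeries.coeff n (chWord M.rc (M.dc F) (Rc F) a) := by
  simp only [chOp]
  rw [← Finset.mul_sum, sum_word_eq_coeff, List.ofFn_succ, List.prod_cons, chWord, piWord_eq_prod]
  rfl

end algebra

/-! ### Degrees and parities of words -/

section degrees

variable {M : GradedRep A H} {p : ℝ} {F : H →L[ℂ] H}

lemma degMem_of_mem {d : ℕ} (hd : d ≠ 0) {T : H →L[ℂ] H} (h : Mem (p / d) T) :
    DegMem p d T := by
  rw [DegMem, Int.toNat_natCast, degNorm_of_ne_zero p hd]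
  exact h.ne

lemma IsSummable.degMem_comm (hF : M.IsSummable p F) (a : A) : DegMem p 1 (M.comm F a) :=
  degMem_of_mem (d := 1) one_ne_zero (by simpa using hF.comm_mem a)

lemma IsSummable.degMem_curvature (hp : 0 < p) (hF : M.IsSummable p F) :
    DegMem p 2 (1 - F ^ 2) := by
  have h : DegMem p 2 (F ^ 2 - 1) :=
    degMem_of_mem (d := 2) two_ne_zero (by simpa using hF.curvature_mem)
  simpa using h.neg hp

lemma hasParity_of_odd (h : M.γ * F = -(F * M.γ)) : HasParity M.γ 1 F := by
  simpa [HasParity] using h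

lemma hasParity_ρ (M : GradedRep A H) (a : A) : HasParity M.γ 0 (M.ρ a) := by
  simpa [HasParity] using M.even a

lemma hasParity_comm (h : HasParity M.γ 1 F) (a : A) : HasParity M.γ 1 (M.comm F a) :=
  ((h.mul (hasParity_ρ M a)).congr (by norm_num)).sub
    (((hasParity_ρ M a).mul h).congr (by norm_num))

lemma hasParity_curvature (h : HasParity M.γ 1 F) : HasParity M.γ 0 (1 - F ^ 2) := by
  rw [pow_two]
  exact HasParity.one.sub ((h.mul h).congr (by norm_num))

variable {α : Type*} {l : Filter α} {Fs : α → H →L[ℂ] H}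

lemma tendsto_piWord (hp : 0 < p)
    (hd : ∀ a, DegTendsto p 1 l (fun t => M.comm (Fs t) a) (M.comm F a))
    (hθ : DegTendsto p 2 l (fun t => 1 - Fs t ^ 2) (1 - F ^ 2)) (L : List A) :
    SerTendsto p L.length l (fun t => piWord (M.dc (Fs t)) (Rc (Fs t)) L)
      (piWord (M.dc F) (Rc F) L) := by
  induction L with
  | nil => exact SerTendsto.const hp (SerMem.one hp)
  | cons x L ih =>
    refine (((SerTendsto.C hp (hd x)).mul hp (SerTendsto.resolvent hp hθ)).mul hp ih).mono hp ?_
    simp [add_comm]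

lemma tendsto_commutator (hp : 0 < p)
    (hθ : DegTendsto p 2 l (fun t => 1 - Fs t ^ 2) (1 - F ^ 2)) (x : A) :
    SerTendsto p 2 l (fun t => tc (Fs t) * M.rc x - M.rc x * tc (Fs t))
      (tc F * M.rc x - M.rc x * tc F) := by
  have h1 : SerTendsto p 0 l (fun _ => M.rc x) (M.rc x) :=
    SerTendsto.const hp (SerMem.C hp (degMem_of_nonpos le_rfl _))
  have h2 : SerTendsto p 2 l (fun t => tc (Fs t)) (tc F) := SerTendsto.C hp hθ
  exact ((h2.mul hp h1).mono hp (by simp)).sub hp ((h1.mul hp h2).mono hp (by simp))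

lemma tendsto_kapWord (hp : 0 < p)
    (hd : ∀ a, DegTendsto p 1 l (fun t => M.comm (Fs t) a) (M.comm F a))
    (hθ : DegTendsto p 2 l (fun t => 1 - Fs t ^ 2) (1 - F ^ 2)) (L : List A) :
    SerTendsto p (L.length + 1) l
      (fun t => kapWord M.rc (M.dc (Fs t)) (Rc (Fs t)) (tc (Fs t)) L)
      (kapWord M.rc (M.dc F) (Rc F) (tc F) L) := by
  induction L with
  | nil => exact SerTendsto.const hp (SerMem.zero hp)
  | cons x L ih =>
    have hR := SerTendsto.resolvent hp hθ
    refine SerTendsto.sub hp ?_ ?_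
    · refine (((tendsto_commutator hp hθ x).mul hp hR).mul hp
        (tendsto_piWord hp hd hθ L)).mono hp ?_
      simp only [List.length_cons]; push_cast; omega
    · refine (((SerTendsto.C hp (hd x)).mul hp hR).mul hp ih).mono hp ?_
      simp only [List.length_cons]; push_cast; omega

lemma parity_piWord (h : HasParity M.γ 1 F) (L : List A) :
    HasParity (PowerSeries.C M.γ) L.length (piWord (M.dc F) (Rc F) L) := by
  induction L with
  | nil => exact HasParity.one
  | cons x L ih =>
    refine (((hasParity_comm h x).C.mul (hasParity_curvature h).resolvent).mul ih).congr ?_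
    simp [add_comm]

lemma serMem_rc (hp : 0 < p) (M : GradedRep A H) (x : A) : SerMem p 0 (M.rc x) :=
  SerMem.C hp (degMem_of_nonpos le_rfl _)

lemma IsSummable.serMem_piWord (hp : 0 < p) (hF : M.IsSummable p F) (L : List A) :
    SerMem p L.length (piWord (M.dc F) (Rc F) L) :=
  (tendsto_piWord (l := (⊥ : Filter Unit)) hp (fun a => DegTendsto.const hp (hF.degMem_comm a))
    (DegTendsto.const hp (hF.degMem_curvature hp)) L).mem

lemma IsSummable.serMem_kapWord (hp : 0 < p) (hF : M.IsSummable p F) (L : List A) :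
    SerMem p (L.length + 1) (kapWord M.rc (M.dc F) (Rc F) (tc F) L) :=
  (tendsto_kapWord (l := (⊥ : Filter Unit)) hp (fun a => DegTendsto.const hp (hF.degMem_comm a))
    (DegTendsto.const hp (hF.degMem_curvature hp)) L).mem

lemma IsSummable.serMem_Rc (hp : 0 < p) (hF : M.IsSummable p F) : SerMem p 0 (Rc F) :=
  SerMem.resolvent hp (hF.degMem_curvature hp)

lemma IsSummable.serMem_chWord (hp : 0 < p) (hF : M.IsSummable p F) {k : ℕ}
    (a : Fin (k + 1) → A) : SerMem p k (chWord M.rc (M.dc F) (Rc F) a) := by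
  refine (((serMem_rc hp M (a 0)).mul hp (hF.serMem_Rc hp)).mul hp
    (hF.serMem_piWord hp _)).mono hp ?_
  simp

end degrees

end GradedRep

/-! ### Homogeneity of b and B -/

namespace CyclicCohomology

variable {A : Type*} [Ring A]

lemma b_const_mul {k : ℕ} (c : ℂ) (φ : (Fin (k + 1) → A) → ℂ) (a : Fin (k + 2) → A) :
    b (fun x => c * φ x) a = c * b φ a := by
  simp only [b, mul_add, Finset.mul_sum]
  congr 1
  · exact Finset.sum_congr rfl fun j _ => by ring
  · ring

lemma B_const_mul {k : ℕ} (c : ℂ) (φ : (Fin (k + 2) → A) → ℂ) (a : Fin (k + 1) → A) :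
    B (fun x => c * φ x) a = c * B φ a := by
  simp only [B, B₀, Finset.mul_sum]
  exact Finset.sum_congr rfl fun j _ => by ring

lemma b_zero {k : ℕ} : b (0 : (Fin (k + 1) → A) → ℂ) = 0 := by
  funext a
  simp [b]

lemma B_zero {k : ℕ} : B (0 : (Fin (k + 2) → A) → ℂ) = 0 := by
  funext a
  simp [B, B₀]

end CyclicCohomology

namespace GradedRep

open CyclicCohomology Schatten

variable {A H : Type*} [Ring A] [Algebra ℂ A]
  [NormedAddCommGroup H] [InnerProductSpace ℂ H] [CompleteSpace H]

/-! ### Degrees and multilinearity of the operators under the traces -/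

lemma tendsto_word {p : ℝ} (hp : 0 < p) {α : Type*} {l : Filter α} {θs : α → H →L[ℂ] H}
    {θ : H →L[ℂ] H} (hθ : DegTendsto p 2 l θs θ) {r : ℕ} {fs : α → Fin r → H →L[ℂ] H}
    {f : Fin r → H →L[ℂ] H} (d : Fin r → ℤ)
    (hf : ∀ j, DegTendsto p (d j) l (fun t => fs t j) (f j)) (i : Fin r → ℕ) :
    DegTendsto p (∑ j, d j + 2 * ((∑ j, i j : ℕ) : ℤ)) l (fun t => word (θs t) (fs t) i)
      (word θ f i) := by
  induction r with
  | zero => simpa [word] using DegTendsto.const hp (degMem_of_nonpos le_rfl _)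
  | succ r ih =>
    have h := ((hf 0).mul hp (hθ.pow hp (i 0))).mul hp
      (ih (fun j => d j.succ) (fun j => hf j.succ) fun j => i j.succ)
    simp only [word, List.ofFn_succ, List.prod_cons] at h ⊢
    refine h.mono hp (le_of_eq ?_)
    rw [Fin.sum_univ_succ d, Fin.sum_univ_succ i]
    push_cast
    ring

/-- The map `f ↦ f₀ θ^(i₀) ⋯ f_{r-1} θ^(i_{r-1})` as a multilinear map. -/
def wordMultilinear (θ : H →L[ℂ] H) {r : ℕ} (i : Fin r → ℕ) :
    MultilinearMap ℂ (fun _ : Fin r => H →L[ℂ] H) (H →L[ℂ] H) :=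
  (MultilinearMap.mkPiAlgebraFin ℂ r (H →L[ℂ] H)).compLinearMap
    fun j => LinearMap.mulRight ℂ (θ ^ i j)

lemma wordMultilinear_apply (θ : H →L[ℂ] H) {r : ℕ} (i : Fin r → ℕ) (f : Fin r → H →L[ℂ] H) :
    wordMultilinear θ i f = word θ f i := by
  simp [wordMultilinear, word]

/-- The maps `a₀ ↦ a₀` and `a_j ↦ [F, a_j]`, `j > 0`. -/
def factorsLinear (M : GradedRep A H) (F : H →L[ℂ] H) {k : ℕ} :
    Fin (k + 1) → A →ₗ[ℂ] (H →L[ℂ] H) :=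
  Fin.cons M.ρ.toLinearMap fun _ : Fin k =>
    (LinearMap.mulLeft ℂ F - LinearMap.mulRight ℂ F) ∘ₗ M.ρ.toLinearMap

lemma factors_eq (M : GradedRep A H) (F : H →L[ℂ] H) {k : ℕ} (a : Fin (k + 1) → A) :
    M.factors F a = fun j => M.factorsLinear F j (a j) := by
  funext j
  refine Fin.cases ?_ (fun j => ?_) j
  · simp [factors, factorsLinear]
  · simp [factors, factorsLinear, comm]

/-- The map `a ↦ γ a₀ (1-F²)^(i₀) [F,a₁] ⋯` as a multilinear map. -/
def chMultilinear (M : GradedRep A H) (F : H →L[ℂ] H) {k : ℕ} (i : Fin (k + 1) → ℕ) :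
    MultilinearMap ℂ (fun _ : Fin (k + 1) => A) (H →L[ℂ] H) :=
  (LinearMap.mulLeft ℂ M.γ).compMultilinearMap
    ((wordMultilinear (1 - F ^ 2) i).compLinearMap (M.factorsLinear F))

lemma chMultilinear_apply (M : GradedRep A H) (F : H →L[ℂ] H) {k : ℕ} (i : Fin (k + 1) → ℕ)
    (a : Fin (k + 1) → A) : M.chMultilinear F i a = M.chOp F a i := by
  rw [chOp, factors_eq, ← wordMultilinear_apply]
  rfl

section

variable {M : GradedRep A H} {p : ℝ} {F : H →L[ℂ] H} {m : ℕ}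

lemma tendsto_factors (hp : 0 < p) {α : Type*} {l : Filter α} {Fs : α → H →L[ℂ] H}
    (hd : ∀ a, DegTendsto p 1 l (fun t => M.comm (Fs t) a) (M.comm F a)) {k : ℕ}
    (a : Fin (k + 1) → A) (j : Fin (k + 1)) :
    DegTendsto p ((Fin.cons 0 fun _ => 1 : Fin (k + 1) → ℤ) j) l
      (fun t => M.factors (Fs t) a j) (M.factors F a j) := by
  refine Fin.cases ?_ (fun j => ?_) j
  · exact DegTendsto.const hp (degMem_of_nonpos le_rfl _)
  · exact hd _

lemma IsSummable.degMem_chOp (hp : 0 < p) (hF : M.IsSummable p F) {k : ℕ} (hk : Even k)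
    (hkm : k ≤ 2 * m) (a : Fin (k + 1) → A) {i : Fin (k + 1) → ℕ}
    (hi : i ∈ Finset.Nat.antidiagonalTuple (k + 1) (m - k / 2)) :
    DegMem p (2 * m) (M.chOp F a i) := by
  have h := (tendsto_word (l := (⊥ : Filter Unit)) hp
    (DegTendsto.const hp (hF.degMem_curvature hp)) _
    (tendsto_factors hp (fun a => DegTendsto.const hp (hF.degMem_comm a)) a) i).1
  rw [Finset.Nat.mem_antidiagonalTuple.1 hi] at h
  refine ((degMem_of_nonpos le_rfl M.γ).mul hp h).mono hp ?_
  rw [Fin.sum_univ_succ]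
  simp only [Fin.cons_zero, Fin.cons_succ, Finset.sum_const, Finset.card_univ, Fintype.card_fin,
    nsmul_eq_mul, mul_one, zero_add]
  obtain ⟨j, rfl⟩ := hk
  omega

lemma IsSummable.chDefined (hp : 0 < p) (hF : M.IsSummable p F) (hm : p ≤ 2 * m) :
    M.ChDefined m F := fun _ hk hkm a _ hi =>
  ((hF.degMem_chOp hp hk hkm a hi).eNorm_one hp (by exact_mod_cast hm)).lt_top

/-- The normalization constant of the components of the character. -/
def chConst (m j : ℕ) : ℂ := (m.factorial : ℂ) / ((m + j).factorial : ℂ)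

/-- The ratio of consecutive constants is the factor that the Euler derivation produces in B. -/
lemma chConst_succ (m j : ℕ) : chConst m (j + 1) * (m + j + 1) = chConst m j := by
  have h1 : ((m + j).factorial : ℂ) ≠ 0 := by exact_mod_cast Nat.factorial_ne_zero _
  have h2 : (m + j + 1 : ℂ) ≠ 0 := by exact_mod_cast Nat.succ_ne_zero (m + j)
  rw [chConst, chConst, ← add_assoc, Nat.factorial_succ]
  push_cast
  field_simp

lemma IsSummable.sum_trace_chOp (hp : 0 < p) (hF : M.IsSummable p F) (hm : p ≤ 2 * m) {k : ℕ}
    (hk : Even k) (hkm : k ≤ 2 * m) (a : Fin (k + 1) → A) :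
    ∑ i ∈ Finset.Nat.antidiagonalTuple (k + 1) (m - k / 2), trace (M.chOp F a i) =
      ∑ i ∈ Finset.Nat.antidiagonalTuple (k + 1) (m - k / 2), linTrace H (M.chOp F a i) :=
  Finset.sum_congr rfl fun _ hi =>
    (linTrace_eq ((hF.degMem_chOp hp hk hkm a hi).traceable hp (by exact_mod_cast hm))).symm

lemma IsSummable.ch_eq (hp : 0 < p) (hF : M.IsSummable p F) (hm : p ≤ 2 * m) {j : ℕ}
    (hj : j ≤ m) : M.Ch m F (2 * j) = fun a => chConst m j *
      serTrace M.γ (m - j) (chWord M.rc (M.dc F) (Rc F) a) := by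
  funext a
  have hk : Even (2 * j) := even_two_mul j
  have hkm : 2 * j ≤ 2 * m := by omega
  have h2 : 2 * j / 2 = j := by omega
  rw [Ch, if_pos ⟨hk, hkm⟩, hF.sum_trace_chOp hp hm hk hkm, ← map_sum, sum_chOp, serTrace_apply,
    h2, chConst]

lemma ch_eq_zero {k : ℕ} (h : ¬ (Even k ∧ k ≤ 2 * m)) : M.Ch m F k = 0 := by
  funext a
  exact if_neg h

lemma IsSummable.ch_mem_totCochains (hp : 0 < p) (hF : M.IsSummable p F) (hm : p ≤ 2 * m) :
    M.Ch m F ∈ totCochains A (2 * m) := by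
  intro k
  refine ⟨?_, fun h => ch_eq_zero fun h' => h ⟨h'.2, ?_⟩⟩
  · by_cases h : Even k ∧ k ≤ 2 * m
    · refine ⟨((m.factorial : ℂ) / ((m + k / 2).factorial : ℂ)) •
        ∑ i ∈ Finset.Nat.antidiagonalTuple (k + 1) (m - k / 2),
          (linTrace H).compMultilinearMap (M.chMultilinear F i), ?_⟩
      funext a
      rw [Ch, if_pos h, hF.sum_trace_chOp hp hm h.1 h.2]
      simp [chMultilinear_apply]
    · rw [ch_eq_zero h]
      exact (cochains A k).zero_mem
  · rw [Nat.modEq_iff_dvd' h'.2]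
    exact (Nat.dvd_sub (dvd_mul_right 2 m) h'.1.two_dvd)

/-! ### The cocycle identity for the character -/

lemma serTrace_X_mul_succ (γ : H →L[ℂ] H) (n : ℕ) (f : PowerSeries (H →L[ℂ] H)) :
    serTrace γ (n + 1) (PowerSeries.X * f) = serTrace γ n f := by
  rw [serTrace_apply, PowerSeries.coeff_succ_X_mul, serTrace_apply]

lemma serTrace_X_mul_zero (γ : H →L[ℂ] H) (f : PowerSeries (H →L[ℂ] H)) :
    serTrace γ 0 (PowerSeries.X * f) = 0 := by
  rw [serTrace_apply, PowerSeries.coeff_zero_X_mul, mul_zero, map_zero]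

lemma serTrace_euler (γ : H →L[ℂ] H) (n : ℕ) (f : PowerSeries (H →L[ℂ] H)) :
    serTrace γ n (PowerSeries.euler f) = n * serTrace γ n f := by
  rw [serTrace_apply, PowerSeries.coeff_euler, mul_smul_comm, map_smul, smul_eq_mul,
    serTrace_apply]

lemma IsSummable.b_serTrace (hp : 0 < p) (hF : M.IsSummable p F) {k n : ℕ}
    (hn : p ≤ (k + 2 * n : ℤ)) (a : Fin (k + 2) → A) :
    b (fun x : Fin (k + 1) → A => serTrace M.γ n (chWord M.rc (M.dc F) (Rc F) x)) a =
      -serTrace M.γ n (PowerSeries.X * (M.rc (a 0) * Rc F *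
        kapWord M.rc (M.dc F) (Rc F) (tc F) (List.ofFn fun j : Fin (k + 1) => a j.succ))) := by
  refine b_chWord (M.rc_mul) (M.dc_mul F) (M.Rc_commutator F) PowerSeries.X_mul_eq _ a ?_
  have h := serTrace_mul_comm hp (γ := M.γ) (n := n) (j := 0) (by simpa using hn)
    (hF.serMem_chWord hp fun j : Fin (k + 1) => a j.castSucc)
    (serMem_rc hp M (a (Fin.last (k + 1)))) (hasParity_ρ M _).C
  rw [h, pow_zero, one_mul]

lemma neg_one_pow_mul_of_even_add {u v : ℕ} (h : Even (u + v)) :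
    (-1 : ℂ) ^ (u * v) = (-1) ^ v := by
  rcases Nat.even_or_odd v with hv | hv
  · rw [(hv.mul_left u).neg_one_pow, hv.neg_one_pow]
  · have hu : Odd u := by
      by_contra hu
      rw [Nat.not_odd_iff_even] at hu
      exact Nat.not_even_iff_odd.2 (hu.add_odd hv) h
    rw [(hu.mul hv).neg_one_pow, hv.neg_one_pow]

lemma IsSummable.B_serTrace (hp : 0 < p) (hF : M.IsSummable p F) {k n : ℕ} (hk : Odd k)
    (hn : p ≤ (k + 1 + 2 * n : ℤ)) (a : Fin (k + 1) → A) :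
    B (fun x : Fin (k + 2) → A => serTrace M.γ n (chWord M.rc (M.dc F) (Rc F) x)) a =
      (n + k + 1) * serTrace M.γ n (piWord (M.dc F) (Rc F) (List.ofFn a)) := by
  rw [B_chWord (D := PowerSeries.euler) (R := Rc F) M.rc_one (M.dc_one F) PowerSeries.euler_mul
    (fun x => PowerSeries.euler_C _) (PowerSeries.euler_resolvent _), serTrace_euler]
  · ring
  · intro L L' hL
    have h1 : Even (L.length + L'.length) := by rw [hL]; exact hk.add_one
    rw [neg_one_pow_mul_of_even_add h1]
    refine serTrace_mul_comm hp ?_ ((hF.serMem_Rc hp).mul hp (hF.serMem_piWord hp L))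
      (hF.serMem_piWord hp L') (parity_piWord (hasParity_of_odd hF.odd) L')
    refine hn.trans ?_
    have : (k + 1 + 2 * n : ℤ) ≤ 0 + L.length + L'.length + 2 * n := by omega
    exact_mod_cast this

/-- The difference of the two words is the anticommutator FW + WF with W = a₀ R [F,a₁] R ⋯ [F,a_k]
R. The relevant coefficient of W has degree k + 2n, possibly one short of p, which is exactly the
situation of `linTrace_anticommutator` with F = G. -/
lemma IsSummable.serTrace_piWord (hp : 0 < p) (hF : M.IsSummable p F) {k n : ℕ} (hk : Odd k)
    (hn : p ≤ (k + 1 + 2 * n : ℤ)) (a : Fin (k + 1) → A) :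
    serTrace M.γ n (piWord (M.dc F) (Rc F) (List.ofFn a)) =
      serTrace M.γ n (M.rc (a 0) * Rc F *
        kapWord M.rc (M.dc F) (Rc F) (tc F) (List.ofFn fun j : Fin k => a j.succ)) := by
  set L := List.ofFn fun j : Fin k => a j.succ with hL
  have hlen : L.length = k := by simp [hL]
  have hpar : HasParity M.γ 1 F := hasParity_of_odd hF.odd
  set W := chWord M.rc (M.dc F) (Rc F) a with hW
  have hcomm : PowerSeries.C F * M.rc (a 0) = M.dc F (a 0) + M.rc (a 0) * PowerSeries.C F := by
    simp [rc, dc, comm]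
  have key : PowerSeries.C F * W + W * PowerSeries.C F =
      piWord (M.dc F) (Rc F) (List.ofFn a) -
        M.rc (a 0) * Rc F * kapWord M.rc (M.dc F) (Rc F) (tc F) L := by
    have h1 := C_mul_piWord M F L
    rw [hlen, hk.neg_one_pow, neg_one_smul] at h1
    have h2 : PowerSeries.C F * W = M.dc F (a 0) * Rc F * piWord (M.dc F) (Rc F) L +
        M.rc (a 0) * Rc F * (PowerSeries.C F * piWord (M.dc F) (Rc F) L) := by
      rw [hW, chWord, ← mul_assoc, ← mul_assoc, hcomm, add_mul, add_mul,
        mul_assoc (M.rc (a 0)) (PowerSeries.C F), C_mul_Rc]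
      simp only [mul_assoc]
      rfl
    rw [h2, h1, List.ofFn_succ, piWord, hW, chWord]
    simp only [mul_sub, mul_neg, mul_assoc, ← hL]
    abel
  have hcoeff : F * PowerSeries.coeff n W + PowerSeries.coeff n W * F =
      PowerSeries.coeff n (piWord (M.dc F) (Rc F) (List.ofFn a) -
        M.rc (a 0) * Rc F * kapWord M.rc (M.dc F) (Rc F) (tc F) L) := by
    rw [← key, map_add, PowerSeries.coeff_C_mul, PowerSeries.coeff_mul_C]
  have hdeg : SerMem p (k + 1) (piWord (M.dc F) (Rc F) (List.ofFn a) -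
      M.rc (a 0) * Rc F * kapWord M.rc (M.dc F) (Rc F) (tc F) L) := by
    refine ((hF.serMem_piWord hp _).mono hp (by simp)).sub hp
      ((((serMem_rc hp M (a 0)).mul hp (hF.serMem_Rc hp)).mul hp
        (hF.serMem_kapWord hp L)).mono hp ?_)
    rw [hlen]
    omega
  have hZ := linTrace_anticommutator hp hpar hpar (hF.degMem_curvature hp)
    (hF.serMem_chWord hp a n) (N := k + 1 + 2 * n)
    (by
      refine hn.trans ?_
      have : (k + 1 + 2 * n : ℤ) ≤ k + 2 * n + 2 := by omega
      exact_mod_cast this)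
    (by rw [← hW, hcoeff]; exact hdeg n) (by exact_mod_cast hn)
  simp only [sub_self, zero_mul, mul_zero, map_zero] at hZ
  rw [← hW, hcoeff] at hZ
  have h3 : serTrace M.γ n (piWord (M.dc F) (Rc F) (List.ofFn a) -
      M.rc (a 0) * Rc F * kapWord M.rc (M.dc F) (Rc F) (tc F) L) = 0 := by
    rw [serTrace_apply]
    linear_combination hZ / 2
  rw [map_sub] at h3
  exact sub_eq_zero.1 h3

/-- The character of a summable Fredholm module is a cyclic cocycle. -/
lemma IsSummable.d_ch (hp : 0 < p) (hF : M.IsSummable p F) (hm : p ≤ 2 * m) :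
    d A (M.Ch m F) = 0 := by
  funext k
  rcases k with _ | k
  · change B (M.Ch m F 1) = 0
    rw [ch_eq_zero (by simp), B_zero]
  change b (M.Ch m F k) + B (M.Ch m F (k + 2)) = 0
  rcases Nat.even_or_odd k with hk | hk
  swap
  · rw [ch_eq_zero fun h => Nat.not_even_iff_odd.2 hk h.1,
      ch_eq_zero fun h => Nat.not_even_iff_odd.2 (hk.add_even even_two) h.1, b_zero, B_zero,
      add_zero]
  obtain ⟨j, rfl⟩ := hk.two_dvd
  rcases lt_trichotomy m j with hj | rfl | hj
  · rw [ch_eq_zero fun h => by omega, ch_eq_zero fun h => by omega, b_zero, B_zero, add_zero]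
  -- In top degree b alone must vanish: it is the coefficient 0 of a multiple of X.
  · rw [ch_eq_zero (k := 2 * m + 2) fun h => by omega, B_zero, add_zero, hF.ch_eq hp hm le_rfl]
    funext a
    rw [b_const_mul, hF.b_serTrace hp (by push_cast; simpa using hm), Nat.sub_self,
      serTrace_X_mul_zero]
    simp
  · obtain ⟨n, hn⟩ : ∃ n, m = j + 1 + n := ⟨m - (j + 1), by omega⟩
    have h1 : m - j = n + 1 := by omega
    have h2 : m - (j + 1) = n := by omega
    have h3 : M.Ch m F (2 * j + 2) = fun a : Fin (2 * j + 2 + 1) → A => chConst m (j + 1) *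
        serTrace M.γ (m - (j + 1)) (chWord M.rc (M.dc F) (Rc F) a) :=
      hF.ch_eq hp hm (show j + 1 ≤ m by omega)
    have hdeg : p ≤ ((2 * j + 1 : ℕ) + 1 + 2 * n : ℤ) := by
      refine hm.trans (le_of_eq ?_)
      rw [hn]
      push_cast
      ring
    rw [h3, hF.ch_eq hp hm hj.le, h1, h2]
    funext a
    have hb := hF.b_serTrace hp (k := 2 * j) (n := n + 1)
      (by refine hdeg.trans (le_of_eq ?_); push_cast; ring) a
    have hB := hF.B_serTrace hp (k := 2 * j + 1) (n := n) (odd_two_mul_add_one j) hdeg a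
    have hc := chConst_succ m j
    have hπ := hF.serTrace_piWord hp (odd_two_mul_add_one j) hdeg a
    rw [serTrace_X_mul_succ] at hb
    have e1 := b_const_mul (chConst m j)
      (fun x : Fin (2 * j + 1) → A => serTrace M.γ (n + 1) (chWord M.rc (M.dc F) (Rc F) x)) a
    have e2 := B_const_mul (chConst m (j + 1))
      (fun x : Fin (2 * j + 1 + 2) → A => serTrace M.γ n (chWord M.rc (M.dc F) (Rc F) x)) a
    -- For k = 2j + 1 and n = m - (j + 1) the Euler factor n + k + 1 is m + j + 1.
    have hmn : (m : ℂ) = j + 1 + n := by rw [hn]; push_cast; ring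
    refine (congrArg₂ (· + ·) e1 e2).trans ?_
    rw [hb, hB, hπ, ← hc, hmn]
    simp only [Pi.zero_apply]
    push_cast
    ring

end

end GradedRep

namespace UpperTriangular

/-! ### Upper triangular two by two matrices -/

variable {S : Type*} [Ring S]

/-- The matrix with rows `(x, y)` and `(0, w)`. -/
def ut (x y w : S) : Matrix (Fin 2) (Fin 2) S := !![x, y; 0, w]

lemma ut_apply (x y w : S) : ut x y w 0 1 = y := rfl

lemma ut_mul (x y w x' y' w' : S) :
    ut x y w * ut x' y' w' = ut (x * x') (x * y' + y * w') (w * w') := by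
  simp [ut]

lemma ut_add (x y w x' y' w' : S) : ut x y w + ut x' y' w' = ut (x + x') (y + y') (w + w') := by
  simp [ut]

lemma ut_sub (x y w x' y' w' : S) : ut x y w - ut x' y' w' = ut (x - x') (y - y') (w - w') := by
  simp [ut]

lemma ut_zero : ut (0 : S) 0 0 = 0 := by
  ext i j
  fin_cases i <;> fin_cases j <;> rfl

lemma ut_one : ut (1 : S) 0 1 = 1 := by
  simp [ut, Matrix.one_fin_two]

lemma ut_map (f : S → S) (hf : f 0 = 0) (x y w : S) :
    (ut x y w).map f = ut (f x) (f y) (f w) := by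
  ext i j
  fin_cases i <;> fin_cases j <;> simp [ut, hf]

lemma map_mul_of_derivation {f : S → S} (hadd : ∀ x y, f (x + y) = f x + f y)
    (hmul : ∀ x y, f (x * y) = f x * y + x * f y) (M N : Matrix (Fin 2) (Fin 2) S) :
    (M * N).map f = M.map f * N + M * N.map f := by
  ext i j
  simp only [Matrix.map_apply, Matrix.mul_apply, Matrix.add_apply, Fin.sum_univ_two, hadd, hmul]
  abel

end UpperTriangular

namespace GradedRep

open CyclicCohomology Schatten UpperTriangular

variable {A H : Type*} [Ring A] [Algebra ℂ A]
  [NormedAddCommGroup H] [InnerProductSpace ℂ H] [CompleteSpace H]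

/-! ### Words with an additional letter -/

/-- The alternating sum of the words obtained from `R δ(x₁) R ⋯ δ(x_k) R` by the insertion of the
letter `D`; letters on the left of `D` belong to `F`, letters on the right of `D` to `G`. -/
def insWord (M : GradedRep A H) (F G D : H →L[ℂ] H) : List A → PowerSeries (H →L[ℂ] H)
  | [] => Rc F * PowerSeries.C D * Rc G
  | x :: L => Rc F * PowerSeries.C D * (Rc G * piWord (M.dc G) (Rc G) (x :: L)) -
      Rc F * M.dc F x * insWord M F G D L

/-- The first variation of `R δ(x₁) R ⋯ δ(x_k) R` in the direction `D`, up to an anticommutator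
with the operator. -/
def varWord (M : GradedRep A H) (F G D : H →L[ℂ] H) : List A → PowerSeries (H →L[ℂ] H)
  | [] => 0
  | x :: L => Rc F * (PowerSeries.C D * M.rc x - M.rc x * PowerSeries.C D) *
        (Rc G * piWord (M.dc G) (Rc G) L) +
      Rc F * M.dc F x * varWord M F G D L +
      PowerSeries.X * (Rc F * (tc F * M.rc x - M.rc x * tc F) * insWord M F G D L) +
      PowerSeries.X * (Rc F * PowerSeries.C D *
        (Rc G * kapWord M.rc (M.dc G) (Rc G) (tc G) (x :: L)))

section algebra

variable (M : GradedRep A H) (F G D : H →L[ℂ] H)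

/-- The resolvent identity, with F² - G² = F(F - G) + (F - G)G. In applications c = t - s and D is
the difference quotient. -/
lemma Rc_sub_Rc {c : ℂ} (hD : c • D = F - G) : Rc F - Rc G = -(c • (PowerSeries.X *
    (Rc F * (PowerSeries.C F * PowerSeries.C D + PowerSeries.C D * PowerSeries.C G) * Rc G))) := by
  have h : (1 - F ^ 2) - (1 - G ^ 2) = -(c • (F * D + D * G)) := by
    rw [smul_add, ← mul_smul_comm, ← smul_mul_assoc, hD]
    noncomm_ring
  have hC : ∀ T : H →L[ℂ] H, PowerSeries.C (c • T) = c • PowerSeries.C T := fun T =>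
    PowerSeries.ext fun n => by
      rcases n with _ | n <;> simp [PowerSeries.coeff_C]
  rw [Rc, Rc, PowerSeries.resolvent_sub, h, map_neg, hC, map_add, map_mul, map_mul, mul_neg,
    neg_mul, mul_neg, mul_smul_comm, smul_mul_assoc, mul_smul_comm]

/-- The difference of the words of two operators. -/
lemma word_sub_word {c : ℂ} (hD : c • D = F - G) (L : List A) :
    Rc F * piWord (M.dc F) (Rc F) L - Rc G * piWord (M.dc G) (Rc G) L =
      c • (M.varWord F G D L - PowerSeries.X * (PowerSeries.C F * M.insWord F G D L +
        (-1 : ℂ) ^ L.length • (M.insWord F G D L * PowerSeries.C G))) := by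
  have hR := Rc_sub_Rc F G D hD
  induction L with
  | nil =>
    simp only [piWord, mul_one, varWord, insWord, List.length_nil, pow_zero, one_smul, zero_sub]
    rw [hR, ← smul_neg]
    congr 3
    rw [mul_assoc (Rc F * _) (Rc G) (PowerSeries.C G), ← C_mul_Rc, mul_assoc (Rc F) _ (Rc G),
      ← mul_assoc (PowerSeries.C F), ← mul_assoc (PowerSeries.C F), C_mul_Rc]
    noncomm_ring
  | cons x L ih =>
    set s : ℂ := (-1) ^ L.length with hs
    set wF := Rc F * piWord (M.dc F) (Rc F) L with hwF
    set wG := Rc G * piWord (M.dc G) (Rc G) L with hwG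
    set w' := Rc G * piWord (M.dc G) (Rc G) (x :: L) with hw'
    set κ := Rc G * kapWord M.rc (M.dc G) (Rc G) (tc G) (x :: L) with hκ
    set y := M.insWord F G D L with hy
    set q := M.varWord F G D L with hq
    set z := (PowerSeries.X : PowerSeries (H →L[ℂ] H)) with hz
    have hzc : ∀ f : PowerSeries (H →L[ℂ] H), f * z = z * f := fun f =>
      (PowerSeries.X_mul_eq f).symm
    set f := PowerSeries.C F
    set g := PowerSeries.C G
    set δ := PowerSeries.C D
    set R := Rc F
    set a := M.rc x
    set dF := M.dc F x
    set dG := M.dc G x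
    set T := tc F * a - a * tc F with hT
    have h1 : R * piWord (M.dc F) R (x :: L) = R * dF * wF := by
      rw [piWord, hwF]; simp only [mul_assoc]; rfl
    have h2 : w' = Rc G * dG * wG := by
      rw [hw', piWord, hwG]; simp only [mul_assoc, dG]
    -- The variation of the first letter and its resolvent: [F,x] changes by c[D,x], and the
    -- resolvent by `Rc_sub_Rc`.
    have h3 : R * dF - Rc G * dG = c • (R * (δ * a - a * δ)) - c • (z * (R * (f * δ + δ * g) *
        (Rc G * dG))) := by
      have e1 : dF - dG = c • (δ * a - a * δ) := by
        have e2 : c • δ = f - g := by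
          refine PowerSeries.ext fun n => ?_
          rcases n with _ | n
          · simpa [δ, f, g] using hD
          · simp [δ, f, g]
        rw [smul_sub, ← smul_mul_assoc, ← mul_smul_comm, e2]
        simp only [dF, dG, f, g, a, dc, rc, comm, map_sub, map_mul]
        noncomm_ring
      have e3 : R * dF - Rc G * dG = R * (dF - dG) + (R - Rc G) * dG := by noncomm_ring
      rw [e3, e1, hR, mul_smul_comm, neg_mul, smul_mul_assoc, ← sub_eq_add_neg]
      simp only [mul_assoc]
    have h4 : g * w' = -(s • (w' * g)) - κ := by
      have e1 := C_mul_piWord M G (x :: L)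
      rw [List.length_cons, pow_succ, mul_neg_one, neg_smul, ← hs] at e1
      rw [hw', ← mul_assoc, C_mul_Rc, mul_assoc, e1, hκ, mul_sub, mul_neg, mul_smul_comm]
      simp only [mul_assoc]; rfl
    have h5 : dF * f = -(f * dF) - T := by
      have := anticomm_dc M F x
      rw [hT, sub_eq_add_neg (-(f * dF)), ← this]
      simp only [f, dF]
      abel
    have h6 : f * R = R * f := C_mul_Rc F
    have hq' : M.varWord F G D (x :: L) = R * (δ * a - a * δ) * wG + R * dF * q +
        z * (R * T * y) + z * (R * δ * κ) := rfl
    have hy' : M.insWord F G D (x :: L) = R * δ * w' - R * dF * y := rfl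
    rw [hq', hy', h1, List.length_cons, pow_succ, mul_neg_one, ← hs, h2]
    -- Telescoping at the first letter; the induction hypothesis treats the rest. Collecting F on
    -- the far left and G on the far right costs T = [θ,x] from passing [F,x] and κ from passing the
    -- word of G: these are the two X-terms of `varWord`.
    have h7 : R * dF * wF - Rc G * dG * wG = R * dF * (wF - wG) + (R * dF - Rc G * dG) * wG := by
      noncomm_ring
    rw [h7, ih, h3]
    have h8 : R * dF * (c • (q - z * (f * y + s • (y * g)))) =
        c • (R * dF * q - z * (R * (dF * f) * y + s • (R * dF * y * g))) := by
      rw [mul_smul_comm, mul_sub, ← mul_assoc (R * dF) z, hzc, mul_add]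
      simp only [mul_add, mul_smul_comm, mul_assoc]
    have h9 : (c • (R * (δ * a - a * δ)) - c • (z * (R * (f * δ + δ * g) * (Rc G * dG)))) * wG =
        c • (R * (δ * a - a * δ) * wG - z * (R * f * δ * w' + R * δ * (g * w'))) := by
      rw [← smul_sub, smul_mul_assoc, sub_mul, h2]
      noncomm_ring
    rw [h8, h9, ← smul_add, h4, h5, ← h2]
    congr 1
    have h10 : f * (R * δ * w' - R * dF * y) = R * f * δ * w' - R * f * dF * y := by
      have e : ∀ u v : PowerSeries (H →L[ℂ] H), f * (R * u * v) = R * f * u * v := fun u v => by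
        rw [← h6]
        simp only [mul_assoc]
      rw [mul_sub, e, e]
    rw [h10]
    simp only [neg_smul, smul_sub, sub_mul, mul_sub, mul_add, mul_neg, neg_mul, mul_smul_comm,
      ← mul_assoc]
    abel

end algebra

end GradedRep

namespace GradedRep

open CyclicCohomology Schatten UpperTriangular

variable {A H : Type*} [Ring A] [Algebra ℂ A]
  [NormedAddCommGroup H] [InnerProductSpace ℂ H] [CompleteSpace H]

/-! ### Words with coefficients in upper triangular matrices -/

section hat

variable (M : GradedRep A H) (F D : H →L[ℂ] H)

/-- The constant matrix `diag(a, a)`. -/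
def rcHat (a : A) : Matrix (Fin 2) (Fin 2) (PowerSeries (H →L[ℂ] H)) := ut (M.rc a) 0 (M.rc a)

/-- The constant matrix `diag([F, a], -[F, a])`. -/
def dcHat (a : A) : Matrix (Fin 2) (Fin 2) (PowerSeries (H →L[ℂ] H)) :=
  ut (M.dc F a) 0 (-M.dc F a)

/-- The curvature `1 - F²` with the variation `D` above the diagonal. -/
def tcHat : Matrix (Fin 2) (Fin 2) (PowerSeries (H →L[ℂ] H)) :=
  ut (tc F) (PowerSeries.C D) (tc F)

/-- The formal resolvent of `tcHat`. -/
def RcHat : Matrix (Fin 2) (Fin 2) (PowerSeries (H →L[ℂ] H)) :=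
  ut (Rc F) (PowerSeries.X * (Rc F * PowerSeries.C D * Rc F)) (Rc F)

/-- The formal variable as a scalar matrix. -/
def XHat : Matrix (Fin 2) (Fin 2) (PowerSeries (H →L[ℂ] H)) := ut PowerSeries.X 0 PowerSeries.X

lemma rcHat_mul (x y : A) : M.rcHat (x * y) = M.rcHat x * M.rcHat y := by
  simp [rcHat, ut_mul, rc_mul]

lemma rcHat_one : M.rcHat 1 = 1 := by rw [rcHat, rc_one, ut_one]

lemma dcHat_mul (x y : A) :
    M.dcHat F (x * y) = M.dcHat F x * M.rcHat y + M.rcHat x * M.dcHat F y := by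
  simp only [rcHat, dcHat, ut_mul, ut_add, dc_mul]
  congr 1 <;> noncomm_ring

lemma dcHat_one : M.dcHat F 1 = 0 := by rw [dcHat, dc_one, neg_zero, ut_zero]

lemma XHat_mul (N : Matrix (Fin 2) (Fin 2) (PowerSeries (H →L[ℂ] H))) : XHat * N = N * XHat := by
  ext i j : 2
  fin_cases i <;> fin_cases j <;>
    simp [XHat, ut, Matrix.mul_apply, Fin.sum_univ_two, PowerSeries.X_mul_eq]

lemma RcHat_commutator (x : A) : RcHat F D * M.rcHat x - M.rcHat x * RcHat F D =
    XHat * (RcHat F D * (tcHat F D * M.rcHat x - M.rcHat x * tcHat F D) * RcHat F D) := by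
  have h := M.Rc_commutator F x
  simp only [RcHat, rcHat, tcHat, XHat, ut_mul, ut_sub, mul_zero, zero_mul, zero_add, add_zero]
  set R := Rc F
  set a := M.rc x
  set δ := PowerSeries.C D
  set T := tc F * a - a * tc F with hT
  set z := (PowerSeries.X : PowerSeries (H →L[ℂ] H)) with hz
  have hzc : ∀ f g : PowerSeries (H →L[ℂ] H), f * (z * g) = z * (f * g) :=
    PowerSeries.mul_X_mul
  congr 1
  have e1 : z * (R * δ * R) * a - a * (z * (R * δ * R)) =
      z * (R * δ * (R * a - a * R)) + z * (R * (δ * a - a * δ) * R) +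
        z * ((R * a - a * R) * δ * R) := by
    rw [hzc]
    noncomm_ring
  rw [e1, h]
  simp only [hzc, mul_assoc, add_mul, mul_add]
  abel

lemma map_euler_dcHat (x : A) : (M.dcHat F x).map PowerSeries.euler = 0 := by
  rw [dcHat, ut_map _ (map_zero _), map_neg, map_zero, dc, PowerSeries.euler_C, neg_zero, ut_zero]

lemma map_euler_RcHat :
    (RcHat F D).map PowerSeries.euler = RcHat F D * RcHat F D - RcHat F D := by
  have hR : PowerSeries.euler (Rc F) = Rc F * Rc F - Rc F := PowerSeries.euler_resolvent _
  rw [RcHat, ut_map _ (map_zero _), ut_mul, ut_sub, PowerSeries.euler_mul, PowerSeries.euler_mul,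
    PowerSeries.euler_mul, PowerSeries.euler_X, PowerSeries.euler_C, hR, PowerSeries.mul_X_mul]
  congr 1
  noncomm_ring

/-- The corner of a product of triangular matrices is the sum over the places where one passes from
the first diagonal entry to the second, that is, where D is inserted. Each letter after that place
contributes -1 by the definition of `dcHat`; relative to the total sign this is the sign (-1)^l of
the letters before it. -/
lemma RcHat_mul_piWord (L : List A) : RcHat F D * piWord (M.dcHat F) (RcHat F D) L =
    ut (Rc F * piWord (M.dc F) (Rc F) L)
      ((-1 : ℂ) ^ L.length • (PowerSeries.X * M.insWord F F D L))
      ((-1 : ℂ) ^ L.length • (Rc F * piWord (M.dc F) (Rc F) L)) := by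
  induction L with
  | nil => simp [piWord, RcHat, insWord]
  | cons x L ih =>
    rw [piWord, mul_assoc (M.dcHat F x), ih, RcHat, dcHat, ut_mul, ut_mul, piWord, insWord, piWord,
      List.length_cons]
    simp only [pow_succ, mul_one, neg_smul, smul_neg, smul_zero, zero_mul, add_zero, mul_sub,
      smul_sub, neg_mul, mul_neg, mul_smul_comm, PowerSeries.mul_X_mul, mul_assoc]
    congr 1
    abel

lemma piWord_hat_cons (x : A) (L : List A) : piWord (M.dcHat F) (RcHat F D) (x :: L) =
    ut (piWord (M.dc F) (Rc F) (x :: L))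
      ((-1 : ℂ) ^ L.length • (PowerSeries.X * (M.dc F x * M.insWord F F D L)))
      ((-1 : ℂ) ^ (L.length + 1) • piWord (M.dc F) (Rc F) (x :: L)) := by
  rw [piWord, mul_assoc, RcHat_mul_piWord, dcHat, ut_mul, piWord, pow_succ, mul_neg_one, neg_smul,
    mul_smul_comm, neg_mul, zero_mul, add_zero, mul_smul_comm, PowerSeries.mul_X_mul,
    mul_assoc]

/-- This is the point of the matrices: what b makes of the inserted words, the corner on the left,
is the first variation of the original words, with F = G. -/
lemma RcHat_mul_kapWord (L : List A) :
    RcHat F D * kapWord M.rcHat (M.dcHat F) (RcHat F D) (tcHat F D) L =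
      ut (Rc F * kapWord M.rc (M.dc F) (Rc F) (tc F) L)
        (-((-1 : ℂ) ^ L.length • M.varWord F F D L))
        (-((-1 : ℂ) ^ L.length • (Rc F * kapWord M.rc (M.dc F) (Rc F) (tc F) L))) := by
  induction L with
  | nil => simp [kapWord, varWord, ut_zero]
  | cons x L ih =>
    have h1 : tcHat F D * M.rcHat x - M.rcHat x * tcHat F D =
        ut (tc F * M.rc x - M.rc x * tc F)
          (PowerSeries.C D * M.rc x - M.rc x * PowerSeries.C D)
          (tc F * M.rc x - M.rc x * tc F) := by
      simp only [tcHat, rcHat, ut_mul, ut_sub, mul_zero, zero_mul, zero_add, add_zero]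
    have h2 : kapWord M.rc (M.dc F) (Rc F) (tc F) (x :: L) =
        (tc F * M.rc x - M.rc x * tc F) * (Rc F * piWord (M.dc F) (Rc F) L) -
          M.dc F x * (Rc F * kapWord M.rc (M.dc F) (Rc F) (tc F) L) := by
      rw [kapWord, mul_assoc, mul_assoc]
    rw [varWord, h2, kapWord, mul_assoc (_ - _) (RcHat F D), mul_assoc (M.dcHat F x) (RcHat F D),
      RcHat_mul_piWord, ih, h1, dcHat, RcHat, ut_mul, ut_mul, ut_sub, ut_mul, List.length_cons]
    set w := Rc F * piWord (M.dc F) (Rc F) L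
    set κ := Rc F * kapWord M.rc (M.dc F) (Rc F) (tc F) L
    set T := tc F * M.rc x - M.rc x * tc F
    simp only [pow_succ, mul_one, neg_smul, smul_neg, smul_zero, zero_mul, mul_zero,
      mul_sub, mul_add, smul_add, smul_sub, neg_mul, mul_neg, mul_smul_comm,
      PowerSeries.mul_X_mul, mul_assoc, sub_neg_eq_add, sub_mul]
    congr 1 <;> abel

lemma chWord_hat {k : ℕ} (a : Fin (k + 1) → A) :
    chWord M.rcHat (M.dcHat F) (RcHat F D) a 0 1 = (-1 : ℂ) ^ k • (PowerSeries.X *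
      (M.rc (a 0) * M.insWord F F D (List.ofFn fun j : Fin k => a j.succ))) := by
  rw [chWord, mul_assoc, RcHat_mul_piWord, rcHat, ut_mul, ut_apply, List.length_ofFn, zero_mul,
    add_zero, mul_smul_comm, PowerSeries.mul_X_mul]

/-- The sum of the operators under the traces in the transgression cochain. -/
lemma sum_tchOp {k : ℕ} (a : Fin (k + 1) → A) (n : ℕ) :
    ∑ i ∈ Finset.Nat.antidiagonalTuple (k + 2) n, ∑ l : Fin (k + 1),
      (-1 : ℂ) ^ (l : ℕ) • M.tchOp F D a i l =
      M.γ * PowerSeries.coeff n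
        (M.rc (a 0) * M.insWord F F D (List.ofFn fun j : Fin k => a j.succ)) := by
  have h1 : ∀ {k : ℕ} (x : Fin k → A), Rc F * ∑ l : Fin (k + 1), (-1 : ℂ) ^ (l : ℕ) •
      (List.ofFn fun j => PowerSeries.C (Fin.insertNth (α := fun _ => H →L[ℂ] H) l D
        (fun i : Fin k => M.comm F (x i)) j) * Rc F).prod = M.insWord F F D (List.ofFn x) := by
    intro k x
    induction k with
    | zero => simp [insWord, mul_assoc]
    | succ k ih =>
      rw [Fin.sum_univ_succ, List.ofFn_succ (f := x), insWord, ← ih, ← List.ofFn_succ,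
        mul_add, sub_eq_add_neg, piWord_eq_prod, Finset.mul_sum, Finset.mul_sum, Finset.mul_sum,
        ← Finset.sum_neg_distrib]
      congr 1
      · rw [Fin.insertNth_zero', List.ofFn_succ]
        simp [mul_assoc, dc]
      · refine Finset.sum_congr rfl fun l _ => ?_
        have h2 : (fun i : Fin (k + 1) => M.comm F (x i)) =
            Fin.cons (M.comm F (x 0)) fun i : Fin k => M.comm F (x i.succ) := by
          funext i
          refine Fin.cases ?_ (fun i => ?_) i <;> rfl
        rw [h2, Fin.insertNth_succ_cons, List.ofFn_succ]
        simp [mul_assoc, dc, pow_succ]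
  simp only [tchOp]
  rw [Finset.sum_comm]
  simp only [← Finset.smul_sum, ← mul_smul_comm, ← Finset.mul_sum, sum_word_eq_coeff,
    ← PowerSeries.coeff_smul, ← map_sum]
  rw [← h1, ← mul_assoc, Finset.mul_sum]
  congr 2
  refine Finset.sum_congr rfl fun l _ => ?_
  rw [factors, Fin.insertNth_succ_cons, List.ofFn_succ, List.prod_cons, mul_smul_comm]
  rfl

end hat

/-! ### Degrees and parities -/

section degrees

variable {M : GradedRep A H} {p : ℝ} {F G D : H →L[ℂ] H} {ε : ℤ} {α : Type*} {l : Filter α}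
  {Fs Gs Ds : α → H →L[ℂ] H}

lemma tendsto_insWord (hp : 0 < p)
    (hF : ∀ a, DegTendsto p 1 l (fun t => M.comm (Fs t) a) (M.comm F a))
    (hF' : DegTendsto p 2 l (fun t => 1 - Fs t ^ 2) (1 - F ^ 2))
    (hG : ∀ a, DegTendsto p 1 l (fun t => M.comm (Gs t) a) (M.comm G a))
    (hG' : DegTendsto p 2 l (fun t => 1 - Gs t ^ 2) (1 - G ^ 2))
    (hD : DegTendsto p ε l Ds D) (L : List A) :
    SerTendsto p (L.length + ε) l (fun t => M.insWord (Fs t) (Gs t) (Ds t) L)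
      (M.insWord F G D L) := by
  have hR := SerTendsto.resolvent hp hF'
  have hS := SerTendsto.resolvent hp hG'
  induction L with
  | nil => exact ((hR.mul hp (SerTendsto.C hp hD)).mul hp hS).mono hp (by simp)
  | cons x L ih =>
    refine SerTendsto.sub hp ?_ ?_
    · refine ((hR.mul hp (SerTendsto.C hp hD)).mul hp
        (hS.mul hp (tendsto_piWord hp hG hG' (x :: L)))).mono hp ?_
      simp only [List.length_cons]; push_cast; omega
    · refine ((hR.mul hp (SerTendsto.C hp (hF x))).mul hp ih).mono hp ?_
      simp only [List.length_cons]; push_cast; omega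

/-- Compared with the word itself one degree 1 is traded for ε: D takes the place of F in a letter
[F,x], or a factor X is compensated by [θ,x] beside an inserted D. -/
lemma tendsto_varWord (hp : 0 < p)
    (hF : ∀ a, DegTendsto p 1 l (fun t => M.comm (Fs t) a) (M.comm F a))
    (hF' : DegTendsto p 2 l (fun t => 1 - Fs t ^ 2) (1 - F ^ 2))
    (hG : ∀ a, DegTendsto p 1 l (fun t => M.comm (Gs t) a) (M.comm G a))
    (hG' : DegTendsto p 2 l (fun t => 1 - Gs t ^ 2) (1 - G ^ 2))
    (hD : DegTendsto p ε l Ds D) (L : List A) :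
    SerTendsto p (L.length - 1 + ε) l (fun t => M.varWord (Fs t) (Gs t) (Ds t) L)
      (M.varWord F G D L) := by
  have hR := SerTendsto.resolvent hp hF'
  have hS := SerTendsto.resolvent hp hG'
  have hD' := SerTendsto.C hp hD
  induction L with
  | nil => exact SerTendsto.const hp (SerMem.zero hp)
  | cons x L ih =>
    have hx := SerTendsto.const (l := l) hp (serMem_rc hp M x)
    have hy := tendsto_insWord hp hF hF' hG hG' hD L
    refine ((SerTendsto.add hp ?_ ?_).add hp ?_).add hp ?_
    · refine ((hR.mul hp (((hD'.mul hp hx).mono hp (by simp)).sub hp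
        ((hx.mul hp hD').mono hp (by simp)))).mul hp
        (hS.mul hp (tendsto_piWord hp hG hG' L))).mono hp (d := _) (e := 0 + ε + (0 + L.length)) ?_
      simp only [List.length_cons]; push_cast; omega
    · refine ((hR.mul hp (SerTendsto.C hp (hF x))).mul hp ih).mono hp ?_
      simp only [List.length_cons]; push_cast; omega
    · refine (((hR.mul hp (tendsto_commutator hp hF' x)).mul hp hy).X_mul hp).mono hp ?_
      simp only [List.length_cons]; push_cast; omega
    · refine (((hR.mul hp hD').mul hp
        (hS.mul hp (tendsto_kapWord hp hG hG' (x :: L)))).X_mul hp).mono hp ?_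
      simp only [List.length_cons]; push_cast; omega

lemma parity_insWord (hF : HasParity M.γ 1 F) (hD : HasParity M.γ 1 D) (L : List A) :
    HasParity (PowerSeries.C M.γ) (L.length + 1) (M.insWord F F D L) := by
  have hR : HasParity (PowerSeries.C M.γ) 0 (Rc F) := (hasParity_curvature hF).resolvent
  induction L with
  | nil => exact ((hR.mul hD.C).mul hR).congr (by simp)
  | cons x L ih =>
    refine HasParity.sub ?_ ?_
    · refine ((hR.mul hD.C).mul (hR.mul (parity_piWord hF (x :: L)))).congr ?_
      simp [add_comm]
    · refine ((hR.mul (hasParity_comm hF x).C).mul ih).congr ?_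
      simp only [List.length_cons]; congr 1; omega

lemma IsSummable.serMem_insWord (hp : 0 < p) (hF : M.IsSummable p F) (hD : DegMem p ε D)
    (L : List A) : SerMem p (L.length + ε) (M.insWord F F D L) :=
  (tendsto_insWord (l := (⊥ : Filter Unit)) hp
    (fun a => DegTendsto.const hp (hF.degMem_comm a))
    (DegTendsto.const hp (hF.degMem_curvature hp))
    (fun a => DegTendsto.const hp (hF.degMem_comm a))
    (DegTendsto.const hp (hF.degMem_curvature hp)) (DegTendsto.const hp hD) L).mem

end degrees

/-! ### The boundary of the transgression -/

section boundary

variable {M : GradedRep A H} {p : ℝ} {F D : H →L[ℂ] H} {ε : ℤ}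

/-- The functional on matrices given by the upper right corner. -/
def hatTrace (γ : H →L[ℂ] H) (n : ℕ) :
    Matrix (Fin 2) (Fin 2) (PowerSeries (H →L[ℂ] H)) →ₗ[ℂ] ℂ where
  toFun N := serTrace γ n (N 0 1)
  map_add' N N' := by rw [Matrix.add_apply, map_add]
  map_smul' c N := by rw [Matrix.smul_apply, map_smul, RingHom.id_apply]

lemma hatTrace_ut (γ : H →L[ℂ] H) (n : ℕ) (x y w : PowerSeries (H →L[ℂ] H)) :
    hatTrace γ n (ut x y w) = serTrace γ n y := rfl

/-- `b_chWord` applied to the triangular matrices. The corner carries a factor X, whence the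
coefficient n + 1; the rotated letter is even, so no sign arises. -/
lemma IsSummable.b_insWord (hp : 0 < p) (hF : M.IsSummable p F) (hD : DegMem p ε D) {k n : ℕ}
    (hk : Odd k) (hn : p ≤ (k + ε + 2 * n : ℤ)) (a : Fin (k + 2) → A) :
    b (fun x : Fin (k + 1) → A => serTrace M.γ n
      (M.rc (x 0) * M.insWord F F D (List.ofFn fun j : Fin k => x j.succ))) a =
    -serTrace M.γ n
      (M.rc (a 0) * M.varWord F F D (List.ofFn fun j : Fin (k + 1) => a j.succ)) := by
  have hW : ∀ x : Fin (k + 1) → A,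
      hatTrace M.γ (n + 1) (chWord M.rcHat (M.dcHat F) (RcHat F D) x) = -serTrace M.γ n
        (M.rc (x 0) * M.insWord F F D (List.ofFn fun j : Fin k => x j.succ)) := fun x => by
    change serTrace M.γ (n + 1) (chWord M.rcHat (M.dcHat F) (RcHat F D) x 0 1) = _
    rw [chWord_hat, hk.neg_one_pow, neg_one_smul, map_neg, serTrace_X_mul_succ]
  have h := b_chWord (r := M.rcHat) (δ := M.dcHat F) (R := RcHat F D) (θ := tcHat F D) (z := XHat)
    M.rcHat_mul (M.dcHat_mul F) (M.RcHat_commutator F D) XHat_mul (hatTrace M.γ (n + 1)) a ?_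
  · have e1 : b (fun x : Fin (k + 1) → A => serTrace M.γ n
        (M.rc (x 0) * M.insWord F F D (List.ofFn fun j : Fin k => x j.succ))) a =
        -b (fun x => hatTrace M.γ (n + 1) (chWord M.rcHat (M.dcHat F) (RcHat F D) x)) a := by
      simp only [hW]
      have := b_const_mul (-1) (fun x : Fin (k + 1) → A => serTrace M.γ n
        (M.rc (x 0) * M.insWord F F D (List.ofFn fun j : Fin k => x j.succ))) a
      simp only [neg_one_mul] at this
      rw [this, neg_neg]
    rw [e1, h, mul_assoc, RcHat_mul_kapWord, rcHat, ut_mul, XHat, ut_mul, hatTrace_ut,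
      List.length_ofFn, hk.add_one.neg_one_pow, one_smul]
    simp only [zero_mul, add_zero, mul_neg, neg_neg, neg_zero]
    rw [map_neg, serTrace_X_mul_succ]
  · set W := chWord M.rcHat (M.dcHat F) (RcHat F D) fun j : Fin (k + 1) => a j.castSucc with hWd
    set x := a (Fin.last (k + 1))
    have hmem : SerMem p (k + ε - 2) (W 0 1) := by
      rw [hWd, chWord_hat]
      refine ((((serMem_rc hp M _).mul hp (hF.serMem_insWord hp hD _)).X_mul hp).smul hp _).mono
        hp ?_
      simp
    have e1 : hatTrace M.γ (n + 1) (M.rcHat x * W) = serTrace M.γ (n + 1) (M.rc x * W 0 1) := by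
      change serTrace M.γ (n + 1) ((M.rcHat x * W) 0 1) = _
      simp [rcHat, ut, Matrix.mul_apply, Fin.sum_univ_two]
    have e2 : hatTrace M.γ (n + 1) (W * M.rcHat x) = serTrace M.γ (n + 1) (W 0 1 * M.rc x) := by
      change serTrace M.γ (n + 1) ((W * M.rcHat x) 0 1) = _
      simp [rcHat, ut, Matrix.mul_apply, Fin.sum_univ_two]
    rw [e1, e2, serTrace_mul_comm hp (j := 0) ?_ hmem (serMem_rc hp M x) (hasParity_ρ M x).C,
      pow_zero, one_mul]
    refine hn.trans (le_of_eq ?_)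
    push_cast
    ring

/-- `B_chWord` applied to the triangular matrices. In the coefficient n + 1 of a word with k + 1
letters, the Euler derivation and the length contribute (n + 1) + (k + 1). -/
lemma IsSummable.B_insWord (hp : 0 < p) (hF : M.IsSummable p F) (hD : DegMem p ε D)
    (hD' : HasParity M.γ 1 D) {k n : ℕ}
    (hk : Even k) (hn : p ≤ (k + 1 + ε + 2 * n : ℤ)) (a : Fin (k + 1) → A) :
    B (fun x : Fin (k + 2) → A => serTrace M.γ n
      (M.rc (x 0) * M.insWord F F D (List.ofFn fun j : Fin (k + 1) => x j.succ))) a =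
    -((n + k + 2) * serTrace M.γ n
      (M.dc F (a 0) * M.insWord F F D (List.ofFn fun j : Fin k => a j.succ))) := by
  have hpar := hasParity_of_odd hF.odd
  have hW : ∀ x : Fin (k + 2) → A,
      hatTrace M.γ (n + 1) (chWord M.rcHat (M.dcHat F) (RcHat F D) x) = -serTrace M.γ n
        (M.rc (x 0) * M.insWord F F D (List.ofFn fun j : Fin (k + 1) => x j.succ)) := fun x => by
    change serTrace M.γ (n + 1) (chWord M.rcHat (M.dcHat F) (RcHat F D) x 0 1) = _
    rw [chWord_hat, hk.add_one.neg_one_pow, neg_one_smul, map_neg, serTrace_X_mul_succ]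
  have h := B_chWord (r := M.rcHat) (δ := M.dcHat F) (R := RcHat F D)
    (D := fun N => N.map PowerSeries.euler) M.rcHat_one (M.dcHat_one F)
    (map_mul_of_derivation (map_add _) PowerSeries.euler_mul)
    (M.map_euler_dcHat F) (map_euler_RcHat F D) (hatTrace M.γ (n + 1)) a ?_
  · have e1 : B (fun x : Fin (k + 2) → A => serTrace M.γ n
        (M.rc (x 0) * M.insWord F F D (List.ofFn fun j : Fin (k + 1) => x j.succ))) a =
        -B (fun x => hatTrace M.γ (n + 1) (chWord M.rcHat (M.dcHat F) (RcHat F D) x)) a := by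
      simp only [hW]
      have := B_const_mul (-1) (fun x : Fin (k + 2) → A => serTrace M.γ n
        (M.rc (x 0) * M.insWord F F D (List.ofFn fun j : Fin (k + 1) => x j.succ))) a
      simp only [neg_one_mul] at this
      rw [this, neg_neg]
    rw [e1, h, List.ofFn_succ, piWord_hat_cons, ut_map _ (map_zero _), hatTrace_ut, hatTrace_ut,
      serTrace_euler, List.length_ofFn, hk.neg_one_pow, one_smul, serTrace_X_mul_succ]
    push_cast
    ring
  · intro L L' hL
    have hLL : Odd (L.length + L'.length) := by rw [hL]; exact hk.add_one
    -- As the lengths have odd sum, the rotation of matrix words required by `B_chWord` carries no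
    -- sign.
    have heven : Even (L.length * L'.length) := by
      rcases Nat.even_or_odd L.length with h | h
      · exact h.mul_right _
      · exact (Nat.odd_add.1 hLL).1 h |>.mul_left _
    rw [heven.neg_one_pow, one_mul, RcHat_mul_piWord]
    rcases L' with _ | ⟨x, L'⟩
    · rw [piWord, mul_one, one_mul]
    rw [piWord_hat_cons, ut_mul, ut_mul, hatTrace_ut, hatTrace_ut, map_add, map_add]
    simp only [List.length_cons] at hLL hL
    have hs1 : (-1 : ℂ) ^ L.length = (-1) ^ L'.length := by
      rcases Nat.even_or_odd L'.length with h | h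
      · have h' : Even L.length := by
          by_contra hc
          exact Nat.not_even_iff_odd.2 hLL ((Nat.not_even_iff_odd.1 hc).add_odd h.add_one)
        rw [h.neg_one_pow, h'.neg_one_pow]
      · have h' : Odd L.length := by
          by_contra hc
          exact Nat.not_even_iff_odd.2 hLL ((Nat.not_odd_iff_even.1 hc).add h.add_one)
        rw [h.neg_one_pow, h'.neg_one_pow]
    have hmem1 : SerMem p (L'.length + 1 + ε - 2)
        (PowerSeries.X * (M.dc F x * M.insWord F F D L')) := by
      refine (((SerMem.C hp (hF.degMem_comm x)).mul hp
        (hF.serMem_insWord hp hD L')).X_mul hp).mono hp ?_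
      omega
    have hpar1 : HasParity (PowerSeries.C M.γ) L'.length
        (PowerSeries.X * (M.dc F x * M.insWord F F D L')) := by
      refine (((hasParity_comm hpar x).C.mul (parity_insWord hpar hD' L')).X_mul).congr ?_
      rw [show 1 + (L'.length + 1) = L'.length + 2 by ring, pow_add]
      norm_num
    have hmem2 : SerMem p (L.length + ε - 2) (PowerSeries.X * M.insWord F F D L) :=
      (hF.serMem_insWord hp hD L).X_mul hp
    have hdeg : p ≤ (L.length + L'.length + ε + 2 * n + 1 : ℤ) := by
      refine hn.trans (le_of_eq ?_)
      have : (L.length + (L'.length + 1) : ℤ) = k + 1 := by exact_mod_cast hL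
      have h' : (k + 1 + ε + 2 * n : ℤ) = L.length + L'.length + ε + 2 * n + 1 := by omega
      exact_mod_cast h'
    -- The corner of the product has two terms, according to the factor that contains D. Each is
    -- rotated with the sign of the parity of its own second factor.
    have c1 := serTrace_mul_comm (n := n + 1) hp (γ := M.γ) (j := L'.length)
      (hdeg.trans (le_of_eq (by push_cast; ring)))
      ((hF.serMem_Rc hp).mul hp (hF.serMem_piWord hp L)) hmem1 hpar1
    have c2 := serTrace_mul_comm (n := n + 1) hp (γ := M.γ) (j := (x :: L').length)
      (hdeg.trans (le_of_eq (by simp only [List.length_cons]; push_cast; ring)))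
      hmem2 (hF.serMem_piWord hp (x :: L')) (parity_piWord hpar (x :: L'))
    simp only [mul_smul_comm, smul_mul_assoc, map_smul, smul_eq_mul]
    have hs2 : (-1 : ℂ) ^ L'.length * (-1) ^ L'.length = 1 := by
      rw [← mul_pow]; norm_num
    rw [List.length_cons] at c2
    rw [c1, c2, hs1, pow_succ]
    linear_combination (serTrace M.γ (n + 1) (piWord (M.dc F) (Rc F) (x :: L') *
      (PowerSeries.X * M.insWord F F D L)) * (-1 : ℂ) ^ L'.length) * hs2

end boundary

end GradedRep

namespace GradedRep

open CyclicCohomology Schatten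

variable {A H : Type*} [Ring A] [Algebra ℂ A]
  [NormedAddCommGroup H] [InnerProductSpace ℂ H] [CompleteSpace H]

/-! ### The derivative of the character along a family of operators -/

variable {M : GradedRep A H} {p : ℝ} {ε : ℤ} {α : Type*} {l : Filter α}
  {Fs Ds : α → H →L[ℂ] H} {c : α → ℂ} {G V : H →L[ℂ] H}

/-- The difference quotient of a word, up to an anticommutator. -/
lemma smul_X_mul_anticommutator (F : H →L[ℂ] H) {D : H →L[ℂ] H} {c : ℂ} (hD : c • D = F - G)
    (x : A) {L : List A} (hL : Even L.length) :
    c • (PowerSeries.X * (PowerSeries.C F * (M.rc x * M.insWord F G D L) +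
      M.rc x * M.insWord F G D L * PowerSeries.C G)) =
    c • (M.rc x * M.varWord F G D L + PowerSeries.X * (M.dc F x * M.insWord F G D L)) -
      (M.rc x * (Rc F * piWord (M.dc F) (Rc F) L) -
        M.rc x * (Rc G * piWord (M.dc G) (Rc G) L)) := by
  have h := word_sub_word M F G D hD L
  rw [hL.neg_one_pow, one_smul] at h
  have hx : PowerSeries.C F * M.rc x = M.dc F x + M.rc x * PowerSeries.C F := by
    simp [rc, dc, comm]
  rw [← mul_sub, h, mul_smul_comm, ← smul_sub, ← mul_assoc (PowerSeries.C F), hx, mul_sub,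
    PowerSeries.mul_X_mul]
  congr 1
  noncomm_ring

/-- `linTrace_anticommutator` reduces the trace to three error terms. Two of them tend to 0 because
F_t → G in norm and θ_t converges in degree 2, the degree that Y lacks. The third contains F_t - G =
c D and tends to 0 because c Z does. -/
lemma tendsto_anticommutator (hp : 0 < p) (hε : 0 ≤ ε) (hε' : ε ≤ 1) (hG : M.IsSummable p G)
    (hc : Tendsto c l (𝓝 0)) (hc' : ∀ᶠ t in l, c t ≠ 0) (hD : ∀ᶠ t in l, c t • Ds t = Fs t - G)
    (hpar : ∀ᶠ t in l, HasParity M.γ 1 (Fs t)) (hFn : Tendsto Fs l (𝓝 G))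
    (hF : ∀ a, DegTendsto p 1 l (fun t => M.comm (Fs t) a) (M.comm G a))
    (hF' : DegTendsto p 2 l (fun t => 1 - Fs t ^ 2) (1 - G ^ 2)) (hDs : DegTendsto p ε l Ds V)
    (x : A) {L : List A} (hL : Even L.length) {n : ℕ}
    (hn : p ≤ (L.length - 1 + ε + 2 * n : ℤ)) :
    Tendsto (fun t => serTrace M.γ n (PowerSeries.X *
      (PowerSeries.C (Fs t) * (M.rc x * M.insWord (Fs t) G (Ds t) L) +
        M.rc x * M.insWord (Fs t) G (Ds t) L * PowerSeries.C G))) l (𝓝 0) := by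
  rcases n with _ | n
  · simp only [serTrace_X_mul_zero]
    exact tendsto_const_nhds
  simp only [serTrace_X_mul_succ]
  have hGc : ∀ a, DegTendsto p 1 l (fun _ => M.comm G a) (M.comm G a) :=
    fun a => DegTendsto.const hp (hG.degMem_comm a)
  have hGθ : DegTendsto p 2 l (fun _ => 1 - G ^ 2) (1 - G ^ 2) :=
    DegTendsto.const hp (hG.degMem_curvature hp)
  have hx : SerTendsto p 0 l (fun _ => M.rc x) (M.rc x) := SerTendsto.const hp (serMem_rc hp M x)
  have hy := tendsto_insWord hp hF hF' hGc hGθ hDs L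
  have hq := tendsto_varWord hp hF hF' hGc hGθ hDs L
  set Y : α → PowerSeries (H →L[ℂ] H) := fun t => M.rc x * M.insWord (Fs t) G (Ds t) L with hYdef
  have hY : DegTendsto p (L.length + ε + 2 * n) l (fun t => PowerSeries.coeff n (Y t))
      (PowerSeries.coeff n (M.rc x * M.insWord G G V L)) :=
    ((hx.mul hp hy) n).mono hp (by omega)
  set Z : α → H →L[ℂ] H := fun t =>
    Fs t * PowerSeries.coeff n (Y t) + PowerSeries.coeff n (Y t) * G with hZdef
  have hZ : ∀ t, PowerSeries.coeff n (PowerSeries.C (Fs t) * Y t + Y t * PowerSeries.C G) = Z t :=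
    fun t => by rw [map_add, PowerSeries.coeff_C_mul, PowerSeries.coeff_mul_C]
  set N : ℤ := L.length - 1 + ε + 2 * (n + 1 : ℕ) with hN
  -- Z itself is not claimed to converge in degree N. Solving `smul_X_mul_anticommutator` expresses
  -- c Z by c times a convergent family and by differences of words, all of which tend to 0.
  have hcU : DegTendsto p N l (fun t => c t • Z t) 0 := by
    have hc1 : SerTendsto p 0 l (fun t => PowerSeries.C (c t • (1 : H →L[ℂ] H)))
        (PowerSeries.C 0) := by
      refine SerTendsto.C hp (degTendsto_of_nonpos le_rfl ?_)
      simpa using hc.smul_const (1 : H →L[ℂ] H)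
    have hω : ∀ {Ks : α → H →L[ℂ] H},
        (∀ a, DegTendsto p 1 l (fun t => M.comm (Ks t) a) (M.comm G a)) →
        DegTendsto p 2 l (fun t => 1 - Ks t ^ 2) (1 - G ^ 2) →
        SerTendsto p (L.length - 1 + ε) l
          (fun t => M.rc x * (Rc (Ks t) * piWord (M.dc (Ks t)) (Rc (Ks t)) L))
          (M.rc x * (Rc G * piWord (M.dc G) (Rc G) L)) := fun h1 h2 =>
      (hx.mul hp ((SerTendsto.resolvent hp h2).mul hp (tendsto_piWord hp h1 h2 L))).mono hp
        (by omega)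
    have h1 : SerTendsto p (L.length - 1 + ε) l (fun t => M.rc x * M.varWord (Fs t) G (Ds t) L +
        PowerSeries.X * (M.dc (Fs t) x * M.insWord (Fs t) G (Ds t) L))
        (M.rc x * M.varWord G G V L + PowerSeries.X * (M.dc G x * M.insWord G G V L)) :=
      ((hx.mul hp hq).mono hp (by omega)).add hp
        ((((SerTendsto.C hp (hF x)).mul hp hy).X_mul hp).mono hp (by omega))
    have h2 := ((hc1.mul hp h1).mono hp (d := L.length - 1 + ε) (by omega)).sub hp
      ((hω hF hF').sub hp (hω hGc hGθ)) (n + 1)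
    rw [map_zero, zero_mul, sub_self, sub_self, map_zero] at h2
    refine h2.congr' ?_
    filter_upwards [hD] with t ht
    have h3 := smul_X_mul_anticommutator (M := M) (Fs t) ht x hL
    have h4 : ∀ f : PowerSeries (H →L[ℂ] H), PowerSeries.C (c t • (1 : H →L[ℂ] H)) * f =
        c t • f := fun f => PowerSeries.ext fun i => by
      rw [PowerSeries.coeff_C_mul, PowerSeries.coeff_smul, smul_one_mul]
    rw [h4, ← h3, PowerSeries.coeff_smul, PowerSeries.coeff_succ_X_mul, hZ]
  have hdeg : p ≤ (L.length + ε + 2 * n + 2 : ℤ) := by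
    refine hn.trans ?_
    have : (L.length - 1 + ε + 2 * (n + 1 : ℕ) : ℤ) ≤ L.length + ε + 2 * n + 2 := by
      push_cast; omega
    exact_mod_cast this
  have h0 : ∀ T : H →L[ℂ] H, DegTendsto p 0 l (fun _ => T) T :=
    fun T => DegTendsto.const hp (degMem_of_nonpos le_rfl T)
  have hF0 : DegTendsto p 0 l Fs G := degTendsto_of_nonpos le_rfl hFn
  have hsub : DegTendsto p 0 l (fun t => Fs t - G) 0 := by
    simpa using hF0.sub hp (h0 G)
  have t1 := tendsto_linTrace hp (d := 0 + (0 + (2 + (L.length + ε + 2 * n))))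
    (by simpa [add_comm, add_left_comm] using hdeg)
    ((h0 M.γ).mul hp (hsub.mul hp (hF'.mul hp hY)))
  have t2 := tendsto_linTrace hp (d := 0 + (0 + (0 + N))) (by simpa using hn)
    ((h0 M.γ).mul hp ((hDs.mono hp hε).mul hp (hF0.mul hp hcU)))
  have t3 := tendsto_linTrace hp (d := 0 + (0 + ((L.length + ε + 2 * n) + 2)))
    (by simpa using hdeg)
    ((h0 M.γ).mul hp (hF0.mul hp (hY.mul hp (hGθ.sub hp hF'))))
  simp only [zero_mul, mul_zero, sub_self, map_zero] at t1 t2 t3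
  have t4 := (((t1.const_mul 2).add t2).add t3).const_mul (1 / 2 : ℂ)
  simp only [mul_zero, add_zero] at t4
  refine t4.congr' ?_
  filter_upwards [hc', hD, hpar, hF'.eventually_mem hp, hY.eventually_mem hp,
    hcU.eventually_mem hp] with t hct hDt hpt hθt hYt hUt
  have hZt : DegMem p N (Z t) := by
    have := hUt.smul hp (c t)⁻¹
    rwa [smul_smul, inv_mul_cancel₀ hct, one_smul] at this
  have h := linTrace_anticommutator hp hpt (hasParity_of_odd hG.odd) hθt hYt hdeg hZt hn
  rw [serTrace_apply, hZ]
  -- The scalar c moves from D to Z, so that a convergent family multiplies a null family.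
  have e2 : Ds t * (Fs t * c t • Z t) = (Fs t - G) * (Fs t * Z t) := by
    rw [← hDt, mul_smul_comm, mul_smul_comm, smul_mul_assoc]
  rw [e2]
  linear_combination -h / 2

/-- The words need not be differentiable in the trace class: their difference quotient is a
convergent family minus an anticommutator of which only the trace is shown to tend to 0. -/
lemma tendsto_slope_serTrace (hp : 0 < p) (hε : 0 ≤ ε) (hε' : ε ≤ 1) (hG : M.IsSummable p G)
    (hc : Tendsto c l (𝓝 0)) (hc' : ∀ᶠ t in l, c t ≠ 0) (hD : ∀ᶠ t in l, c t • Ds t = Fs t - G)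
    (hpar : ∀ᶠ t in l, HasParity M.γ 1 (Fs t)) (hFn : Tendsto Fs l (𝓝 G))
    (hF : ∀ a, DegTendsto p 1 l (fun t => M.comm (Fs t) a) (M.comm G a))
    (hF' : DegTendsto p 2 l (fun t => 1 - Fs t ^ 2) (1 - G ^ 2)) (hDs : DegTendsto p ε l Ds V)
    (x : A) {L : List A} (hL : Even L.length) {n : ℕ}
    (hn : p ≤ (L.length - 1 + ε + 2 * n : ℤ)) :
    Tendsto (fun t => (c t)⁻¹ *
      (serTrace M.γ n (M.rc x * (Rc (Fs t) * piWord (M.dc (Fs t)) (Rc (Fs t)) L)) -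
        serTrace M.γ n (M.rc x * (Rc G * piWord (M.dc G) (Rc G) L)))) l
      (𝓝 (serTrace M.γ n (M.rc x * M.varWord G G V L +
        PowerSeries.X * (M.dc G x * M.insWord G G V L)))) := by
  have hGc : ∀ a, DegTendsto p 1 l (fun _ => M.comm G a) (M.comm G a) :=
    fun a => DegTendsto.const hp (hG.degMem_comm a)
  have hGθ : DegTendsto p 2 l (fun _ => 1 - G ^ 2) (1 - G ^ 2) :=
    DegTendsto.const hp (hG.degMem_curvature hp)
  have hx : SerTendsto p 0 l (fun _ => M.rc x) (M.rc x) := SerTendsto.const hp (serMem_rc hp M x)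
  have hy := tendsto_insWord hp hF hF' hGc hGθ hDs L
  have hq := tendsto_varWord hp hF hF' hGc hGθ hDs L
  have h1 : SerTendsto p (L.length - 1 + ε) l (fun t => M.rc x * M.varWord (Fs t) G (Ds t) L +
      PowerSeries.X * (M.dc (Fs t) x * M.insWord (Fs t) G (Ds t) L))
      (M.rc x * M.varWord G G V L + PowerSeries.X * (M.dc G x * M.insWord G G V L)) :=
    ((hx.mul hp hq).mono hp (by omega)).add hp
      ((((SerTendsto.C hp (hF x)).mul hp hy).X_mul hp).mono hp (by omega))
  have h2 := (tendsto_serTrace hp M.γ hn h1).sub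
    (tendsto_anticommutator hp hε hε' hG hc hc' hD hpar hFn hF hF' hDs x hL hn)
  rw [sub_zero] at h2
  refine h2.congr' ?_
  filter_upwards [hc', hD] with t hct hDt
  have h3 := congrArg (serTrace M.γ n) (smul_X_mul_anticommutator (M := M) (Fs t) hDt x hL)
  rw [map_smul, map_sub, map_smul, map_sub, smul_eq_mul, smul_eq_mul] at h3
  rw [eq_inv_mul_iff_mul_eq₀ hct]
  linear_combination -h3

end GradedRep

/-! ### b, B and multilinearity under integrals -/

namespace CyclicCohomology

variable {A : Type*} [Ring A]

open MeasureTheory in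
lemma b_integral {k : ℕ} {φ : ℝ → (Fin (k + 1) → A) → ℂ} {s t : ℝ}
    (h : ∀ a, IntervalIntegrable (fun u => φ u a) volume s t) (a : Fin (k + 2) → A) :
    b (fun x => ∫ u in s..t, φ u x) a = ∫ u in s..t, b (φ u) a := by
  simp only [b]
  rw [intervalIntegral.integral_add, intervalIntegral.integral_finsetSum]
  · simp only [intervalIntegral.integral_const_mul]
  · exact fun j _ => (h _).const_mul _
  · have h1 := IntervalIntegrable.sum (μ := volume) (a := s) (b := t) Finset.univ
      (f := fun (j : Fin (k + 1)) u => (-1 : ℂ) ^ (j : ℕ) *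
        φ u (Fin.contractNth j.castSucc (· * ·) a)) fun j _ => (h _).const_mul _
    rwa [Finset.sum_fn] at h1
  · exact (h _).const_mul _

open MeasureTheory in
lemma B_integral {k : ℕ} {φ : ℝ → (Fin (k + 2) → A) → ℂ} {s t : ℝ}
    (h : ∀ a, IntervalIntegrable (fun u => φ u a) volume s t) (a : Fin (k + 1) → A) :
    B (fun x => ∫ u in s..t, φ u x) a = ∫ u in s..t, B (φ u) a := by
  simp only [B, B₀]
  rw [intervalIntegral.integral_finsetSum]
  · refine Finset.sum_congr rfl fun j _ => ?_
    rw [intervalIntegral.integral_const_mul, intervalIntegral.integral_sub (h _)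
      ((h _).const_mul _), intervalIntegral.integral_const_mul]
  · exact fun j _ => ((h _).sub ((h _).const_mul _)).const_mul _

open MeasureTheory in
lemma exists_multilinear_integral {r : ℕ} [Algebra ℂ A] {s t : ℝ}
    (g : ℝ → MultilinearMap ℂ (fun _ : Fin r => A) ℂ)
    (h : ∀ a, IntervalIntegrable (fun u => g u a) volume s t) :
    ∃ φ : MultilinearMap ℂ (fun _ : Fin r => A) ℂ, ∀ a, φ a = ∫ u in s..t, g u a :=
  ⟨{ toFun := fun a => ∫ u in s..t, g u a
     map_update_add' := fun a i x y => by
      simp only [MultilinearMap.map_update_add]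
      exact intervalIntegral.integral_add (h _) (h _)
     map_update_smul' := fun a i c x => by
      simp only [MultilinearMap.map_update_smul]
      exact intervalIntegral.integral_smul c _ }, fun _ => rfl⟩

end CyclicCohomology

/-! ### Homotopies with a velocity of degree ε and their transgression cochains -/

namespace GradedRep

open CyclicCohomology Schatten MeasureTheory

variable {A H : Type*} [Ring A] [Algebra ℂ A]
  [NormedAddCommGroup H] [InnerProductSpace ℂ H] [CompleteSpace H]

/-- A homotopy of summable Fredholm modules whose velocity is a continuous family of operators of
degree `ε`. -/
structure IsHomotopyOfDegree (M : GradedRep A H) (p : ℝ) (ε : ℤ) (F : ℝ → H →L[ℂ] H) : Prop where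
  degree_nonneg : 0 ≤ ε
  degree_le : ε ≤ 1
  summable : ∀ t ∈ Icc (0 : ℝ) 1, M.IsSummable p (F t)
  continuousOn : ContinuousOn F (Icc 0 1)
  tendsto_comm : ∀ s ∈ Icc (0 : ℝ) 1, ∀ a,
    DegTendsto p 1 (𝓝[Icc 0 1] s) (fun t => M.comm (F t) a) (M.comm (F s) a)
  tendsto_curvature : ∀ s ∈ Icc (0 : ℝ) 1,
    DegTendsto p 2 (𝓝[Icc 0 1] s) (fun t => 1 - F t ^ 2) (1 - F s ^ 2)
  parity_velocity : ∀ t ∈ Icc (0 : ℝ) 1, HasParity M.γ 1 (velocity F t)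
  tendsto_velocity : ∀ s ∈ Icc (0 : ℝ) 1,
    DegTendsto p ε (𝓝[Icc 0 1] s) (velocity F) (velocity F s)
  tendsto_slope : ∀ s ∈ Icc (0 : ℝ) 1, DegTendsto p ε (𝓝[Icc 0 1 \ {s}] s)
    (fun t => ((t - s : ℝ) : ℂ)⁻¹ • (F t - F s)) (velocity F s)

/-- The map `a ↦ γ a₀ (1-F²)^(i₀) ⋯ D ⋯` as a multilinear map. -/
def tchMultilinear (M : GradedRep A H) (F D : H →L[ℂ] H) {k : ℕ} (i : Fin (k + 2) → ℕ)
    (l : Fin (k + 1)) : MultilinearMap ℂ (fun _ : Fin (k + 1) => A) (H →L[ℂ] H) :=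
  (LinearMap.mulLeft ℂ M.γ).compMultilinearMap
    (((wordMultilinear (1 - F ^ 2) i).curryMid l.succ D).compLinearMap (M.factorsLinear F))

lemma tchMultilinear_apply (M : GradedRep A H) (F D : H →L[ℂ] H) {k : ℕ} (i : Fin (k + 2) → ℕ)
    (l : Fin (k + 1)) (a : Fin (k + 1) → A) : M.tchMultilinear F D i l a = M.tchOp F D a i l := by
  rw [tchOp, factors_eq, ← wordMultilinear_apply]
  rfl

/-- The k commutators, the velocity and the powers of θ have degrees k + ε + 2(m - (k+1)/2) = 2m - 1
+ ε. -/
lemma tendsto_tchOp {M : GradedRep A H} {p : ℝ} (hp : 0 < p) {ε : ℤ} {α : Type*} {l : Filter α}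
    {Fs Ds : α → H →L[ℂ] H} {F D : H →L[ℂ] H}
    (hF : ∀ a, DegTendsto p 1 l (fun t => M.comm (Fs t) a) (M.comm F a))
    (hF' : DegTendsto p 2 l (fun t => 1 - Fs t ^ 2) (1 - F ^ 2)) (hD : DegTendsto p ε l Ds D)
    {k m : ℕ} (hk : Odd k) (hkm : k + 1 ≤ 2 * m) (a : Fin (k + 1) → A) {i : Fin (k + 2) → ℕ}
    (hi : i ∈ Finset.Nat.antidiagonalTuple (k + 2) (m - (k + 1) / 2)) (j : Fin (k + 1)) :
    DegTendsto p (2 * m - 1 + ε) l (fun t => M.tchOp (Fs t) (Ds t) a i j)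
      (M.tchOp F D a i j) := by
  set d : Fin (k + 2) → ℤ :=
    Fin.insertNth (α := fun _ => ℤ) j.succ ε (Fin.cons 0 fun _ : Fin k => 1) with hd
  have h := tendsto_word (r := k + 2)
    (fs := fun t => Fin.insertNth (α := fun _ => H →L[ℂ] H) j.succ (Ds t) (M.factors (Fs t) a))
    (f := Fin.insertNth (α := fun _ => H →L[ℂ] H) j.succ D (M.factors F a)) hp hF' d ?_ i
  · rw [Finset.Nat.mem_antidiagonalTuple.1 hi] at h
    refine ((DegTendsto.const hp (degMem_of_nonpos le_rfl M.γ)).mul hp h).mono hp ?_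
    rw [Fin.sum_univ_succAbove d j.succ]
    simp only [hd, Fin.insertNth_apply_same, Fin.insertNth_apply_succAbove]
    rw [Fin.sum_univ_succ]
    simp only [Fin.cons_zero, Fin.cons_succ, Finset.sum_const, Finset.card_univ, Fintype.card_fin,
      nsmul_eq_mul, mul_one, zero_add]
    obtain ⟨j, rfl⟩ := hk
    omega
  · intro u
    refine Fin.succAboveCases j.succ ?_ (fun u => ?_) u
    · simpa [hd] using hD
    · simp only [hd, Fin.insertNth_apply_succAbove]
      exact tendsto_factors hp hF a u

namespace IsHomotopyOfDegree

variable {M : GradedRep A H} {p : ℝ} {ε : ℤ} {F : ℝ → H →L[ℂ] H} {m : ℕ}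

lemma tchDefined (hF : M.IsHomotopyOfDegree p ε F) (hp : 0 < p) (hm : p ≤ (2 * m - 1 + ε : ℤ)) :
    M.TchDefined m F := by
  intro k hk hkm a i hi l
  have h := fun s hs => tendsto_tchOp hp (hF.tendsto_comm s hs) (hF.tendsto_curvature s hs)
    (hF.tendsto_velocity s hs) hk hkm a hi l
  exact ⟨fun t ht => ((h t ht).1.eNorm_one hp hm).lt_top, fun t ht => (h t ht).trace hp hm⟩

/-- The integrand of the transgression cochain is continuous. -/
lemma continuousOn_insWord (hF : M.IsHomotopyOfDegree p ε F) (hp : 0 < p) (x : A) (L : List A)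
    {n : ℕ} (hn : p ≤ (L.length + ε + 2 * n : ℤ)) :
    ContinuousOn (fun t => serTrace M.γ n (M.rc x * M.insWord (F t) (F t) (velocity F t) L))
      (Icc 0 1) := fun s hs => by
  have h := (SerTendsto.const (l := 𝓝[Icc 0 1] s) hp (serMem_rc hp M x)).mul hp
    (tendsto_insWord hp (hF.tendsto_comm s hs) (hF.tendsto_curvature s hs)
      (hF.tendsto_comm s hs) (hF.tendsto_curvature s hs) (hF.tendsto_velocity s hs) L)
  exact tendsto_serTrace hp M.γ (by simpa using hn) h

lemma continuousOn_varWord (hF : M.IsHomotopyOfDegree p ε F) (hp : 0 < p) (x : A) (L : List A)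
    {n : ℕ} (hn : p ≤ (L.length - 1 + ε + 2 * n : ℤ)) :
    ContinuousOn (fun t => serTrace M.γ n (M.rc x * M.varWord (F t) (F t) (velocity F t) L))
      (Icc 0 1) := fun s hs => by
  have h := (SerTendsto.const (l := 𝓝[Icc 0 1] s) hp (serMem_rc hp M x)).mul hp
    (tendsto_varWord hp (hF.tendsto_comm s hs) (hF.tendsto_curvature s hs)
      (hF.tendsto_comm s hs) (hF.tendsto_curvature s hs) (hF.tendsto_velocity s hs) L)
  exact tendsto_serTrace hp M.γ (by simpa using hn) h

lemma continuousOn_X_mul_insWord (hF : M.IsHomotopyOfDegree p ε F) (hp : 0 < p) (x : A)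
    (L : List A) {n : ℕ} (hn : p ≤ (L.length - 1 + ε + 2 * n : ℤ)) :
    ContinuousOn (fun t => serTrace M.γ n (PowerSeries.X *
      (M.dc (F t) x * M.insWord (F t) (F t) (velocity F t) L))) (Icc 0 1) := fun s hs => by
  have h := ((SerTendsto.C hp (hF.tendsto_comm s hs x)).mul hp
    (tendsto_insWord hp (hF.tendsto_comm s hs) (hF.tendsto_curvature s hs)
      (hF.tendsto_comm s hs) (hF.tendsto_curvature s hs) (hF.tendsto_velocity s hs) L)).X_mul hp
  refine tendsto_serTrace hp M.γ ?_ (h.mono hp (d := L.length - 1 + ε) (by omega))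
  exact hn

lemma tch_eq_zero {k : ℕ} (h : ¬ (Odd k ∧ k + 1 ≤ 2 * m)) : M.Tch m F k = 0 := by
  funext a
  exact if_neg h

lemma linTrace_sum_tchOp (hF : M.IsHomotopyOfDegree p ε F) (hp : 0 < p)
    (hm : p ≤ (2 * m - 1 + ε : ℤ)) {k : ℕ} (hk : Odd k) (hkm : k + 1 ≤ 2 * m)
    (a : Fin (k + 1) → A) {t : ℝ} (ht : t ∈ Icc (0 : ℝ) 1) :
    ∑ i ∈ Finset.Nat.antidiagonalTuple (k + 2) (m - (k + 1) / 2), ∑ l : Fin (k + 1),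
      (-1 : ℂ) ^ (l : ℕ) * trace (M.tchOp (F t) (velocity F t) a i l) =
    ∑ i ∈ Finset.Nat.antidiagonalTuple (k + 2) (m - (k + 1) / 2), ∑ l : Fin (k + 1),
      (-1 : ℂ) ^ (l : ℕ) * linTrace H (M.tchOp (F t) (velocity F t) a i l) := by
  refine Finset.sum_congr rfl fun i hi => Finset.sum_congr rfl fun l _ => ?_
  rw [linTrace_eq]
  exact traceable_of_eNorm_one (((hF.tchDefined hp hm) k hk hkm a i hi l).1 t ht).ne

lemma sum_linTrace_tchOp {F D : H →L[ℂ] H} {k n : ℕ} (a : Fin (k + 1) → A) :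
    ∑ i ∈ Finset.Nat.antidiagonalTuple (k + 2) n, ∑ l : Fin (k + 1),
      (-1 : ℂ) ^ (l : ℕ) * linTrace H (M.tchOp F D a i l) =
    serTrace M.γ n (M.rc (a 0) * M.insWord F F D (List.ofFn fun j : Fin k => a j.succ)) := by
  rw [serTrace_apply, ← sum_tchOp, map_sum]
  refine Finset.sum_congr rfl fun i _ => ?_
  rw [map_sum]
  exact Finset.sum_congr rfl fun l _ => by rw [map_smul, smul_eq_mul]

lemma tch_eq (hF : M.IsHomotopyOfDegree p ε F) (hp : 0 < p) (hm : p ≤ (2 * m - 1 + ε : ℤ))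
    {j : ℕ} (hj : j + 1 ≤ m) : M.Tch m F (2 * j + 1) = fun a => -chConst m (j + 1) *
      ∫ t in (0 : ℝ)..1, serTrace M.γ (m - (j + 1)) (M.rc (a 0) *
        M.insWord (F t) (F t) (velocity F t)
          (List.ofFn fun i : Fin (2 * j + 1) => a i.succ)) := by
  funext a
  have hk : Odd (2 * j + 1) := odd_two_mul_add_one j
  have hkm : 2 * j + 1 + 1 ≤ 2 * m := by omega
  have h2 : (2 * j + 1 + 1) / 2 = j + 1 := by omega
  rw [Tch, if_pos ⟨hk, hkm⟩, chConst, h2]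
  congr 1
  refine intervalIntegral.integral_congr fun t ht => ?_
  rw [uIcc_of_le zero_le_one] at ht
  have h3 := hF.linTrace_sum_tchOp hp hm hk hkm a ht
  rw [h2] at h3
  exact h3.trans (sum_linTrace_tchOp a)

lemma intervalIntegrable_insWord (hF : M.IsHomotopyOfDegree p ε F) (hp : 0 < p)
    (hm : p ≤ (2 * m - 1 + ε : ℤ)) {j : ℕ} (hj : j + 1 ≤ m) (a : Fin (2 * j + 1 + 1) → A) :
    IntervalIntegrable (fun t => serTrace M.γ (m - (j + 1)) (M.rc (a 0) *
      M.insWord (F t) (F t) (velocity F t) (List.ofFn fun i : Fin (2 * j + 1) => a i.succ)))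
      volume 0 1 := by
  refine ContinuousOn.intervalIntegrable ?_
  rw [uIcc_of_le zero_le_one]
  refine hF.continuousOn_insWord hp _ _ (hm.trans (le_of_eq ?_))
  have : (2 * m - 1 + ε : ℤ) = (2 * j + 1 : ℕ) + ε + 2 * (m - (j + 1) : ℕ) := by omega
  rw [List.length_ofFn]
  exact_mod_cast this

lemma tch_mem_totCochains (hF : M.IsHomotopyOfDegree p ε F) (hp : 0 < p)
    (hm : p ≤ (2 * m - 1 + ε : ℤ)) : M.Tch m F ∈ totCochains A (2 * m - 1) := by
  intro k
  refine ⟨?_, fun h => tch_eq_zero fun h' => h ⟨by omega, ?_⟩⟩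
  · by_cases h : Odd k ∧ k + 1 ≤ 2 * m
    · obtain ⟨⟨j, rfl⟩, h'⟩ := h
      have hj : j + 1 ≤ m := by omega
      obtain ⟨φ, hφ⟩ := exists_multilinear_integral (s := 0) (t := 1) (fun t =>
        ∑ i ∈ Finset.Nat.antidiagonalTuple (2 * j + 1 + 2) (m - (j + 1)),
          ∑ l : Fin (2 * j + 1 + 1), (-1 : ℂ) ^ (l : ℕ) •
            (linTrace H).compMultilinearMap (M.tchMultilinear (F t) (velocity F t) i l))
        (by
          intro a
          refine (hF.intervalIntegrable_insWord hp hm hj a).congr fun t _ => ?_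
          simp only [sum_apply, smul_apply,
            LinearMap.compMultilinearMap_apply, tchMultilinear_apply, smul_eq_mul,
            sum_linTrace_tchOp])
      refine ⟨-chConst m (j + 1) • φ, ?_⟩
      funext a
      rw [hF.tch_eq hp hm hj, smul_apply, hφ, smul_eq_mul]
      simp only [sum_apply, smul_apply,
        LinearMap.compMultilinearMap_apply, tchMultilinear_apply, smul_eq_mul,
        sum_linTrace_tchOp]
    · rw [tch_eq_zero h]
      exact (cochains A k).zero_mem
  · obtain ⟨⟨j, rfl⟩, h'⟩ := h'
    rw [Nat.modEq_iff_dvd' (by omega)]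
    exact ⟨m - 1 - j, by omega⟩

end IsHomotopyOfDegree

end GradedRep

/-! ### The transgression formula -/

namespace GradedRep.IsHomotopyOfDegree

open CyclicCohomology Schatten MeasureTheory

variable {A H : Type*} [Ring A] [Algebra ℂ A]
  [NormedAddCommGroup H] [InnerProductSpace ℂ H] [CompleteSpace H]
  {M : GradedRep A H} {p : ℝ} {ε : ℤ} {F : ℝ → H →L[ℂ] H} {m : ℕ}

lemma degMem_velocity (hF : M.IsHomotopyOfDegree p ε F) {t : ℝ} (ht : t ∈ Icc (0 : ℝ) 1) :
    DegMem p ε (velocity F t) := (hF.tendsto_velocity t ht).1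

lemma b_tch (hF : M.IsHomotopyOfDegree p ε F) (hp : 0 < p) (hm : p ≤ (2 * m - 1 + ε : ℤ))
    {j : ℕ} (hj : j + 1 ≤ m) (a : Fin (2 * j + 1 + 2) → A) :
    b (M.Tch m F (2 * j + 1)) a = chConst m (j + 1) *
      ∫ t in (0 : ℝ)..1, serTrace M.γ (m - (j + 1)) (M.rc (a 0) *
        M.varWord (F t) (F t) (velocity F t)
          (List.ofFn fun i : Fin (2 * j + 1 + 1) => a i.succ)) := by
  rw [hF.tch_eq hp hm hj, b_const_mul, b_integral (hF.intervalIntegrable_insWord hp hm hj),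
    neg_mul, ← mul_neg, ← intervalIntegral.integral_neg]
  congr 1
  refine intervalIntegral.integral_congr fun t ht => ?_
  rw [uIcc_of_le zero_le_one] at ht
  rw [(hF.summable t ht).b_insWord hp (hF.degMem_velocity ht) (odd_two_mul_add_one j), neg_neg]
  refine hm.trans (le_of_eq ?_)
  have : (2 * m - 1 + ε : ℤ) = (2 * j + 1 : ℕ) + ε + 2 * (m - (j + 1) : ℕ) := by omega
  exact_mod_cast this

lemma B_tch (hF : M.IsHomotopyOfDegree p ε F) (hp : 0 < p) (hm : p ≤ (2 * m - 1 + ε : ℤ))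
    {j : ℕ} (hj : j + 1 ≤ m) (a : Fin (2 * j + 1) → A) :
    B (M.Tch m F (2 * j + 1)) a = chConst m j *
      ∫ t in (0 : ℝ)..1, serTrace M.γ (m - j) (PowerSeries.X * (M.dc (F t) (a 0) *
        M.insWord (F t) (F t) (velocity F t) (List.ofFn fun i : Fin (2 * j) => a i.succ))) := by
  have hmj : m - j = m - (j + 1) + 1 := by omega
  rw [hF.tch_eq hp hm hj, B_const_mul, B_integral (hF.intervalIntegrable_insWord hp hm hj),
    ← chConst_succ m j, neg_mul, ← mul_neg, ← intervalIntegral.integral_neg, mul_assoc, hmj]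
  congr 1
  rw [← intervalIntegral.integral_const_mul ((m : ℂ) + j + 1)]
  refine intervalIntegral.integral_congr fun t ht => ?_
  rw [uIcc_of_le zero_le_one] at ht
  rw [(hF.summable t ht).B_insWord hp (hF.degMem_velocity ht) (hF.parity_velocity t ht)
    (even_two_mul j), serTrace_X_mul_succ, neg_neg]
  · congr 1
    rw [Nat.cast_sub hj]
    push_cast
    ring
  · refine hm.trans (le_of_eq ?_)
    have : (2 * m - 1 + ε : ℤ) = (2 * j : ℕ) + 1 + ε + 2 * (m - (j + 1) : ℕ) := by omega
    exact_mod_cast this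

/-- The coboundary of the transgression cochain. -/
lemma d_tch (hF : M.IsHomotopyOfDegree p ε F) (hp : 0 < p) (hm : p ≤ (2 * m - 1 + ε : ℤ))
    {j : ℕ} (hj : j ≤ m) (a : Fin (2 * j + 1) → A) :
    d A (M.Tch m F) (2 * j) a = chConst m j *
      ∫ t in (0 : ℝ)..1, serTrace M.γ (m - j) (M.rc (a 0) *
        M.varWord (F t) (F t) (velocity F t) (List.ofFn fun i : Fin (2 * j) => a i.succ) +
        PowerSeries.X * (M.dc (F t) (a 0) * M.insWord (F t) (F t) (velocity F t)
          (List.ofFn fun i : Fin (2 * j) => a i.succ))) := by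
  have hdeg : p ≤ ((List.ofFn fun i : Fin (2 * j) => a i.succ).length - 1 + ε +
      2 * (m - j : ℕ) : ℤ) := by
    refine hm.trans (le_of_eq ?_)
    have : (2 * m - 1 + ε : ℤ) = (2 * j : ℕ) - 1 + ε + 2 * (m - j : ℕ) := by omega
    rw [List.length_ofFn]
    exact_mod_cast this
  have i1 : IntervalIntegrable (fun t => serTrace M.γ (m - j) (M.rc (a 0) *
      M.varWord (F t) (F t) (velocity F t) (List.ofFn fun i : Fin (2 * j) => a i.succ)))
      volume 0 1 := by
    refine ContinuousOn.intervalIntegrable ?_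
    rw [uIcc_of_le zero_le_one]
    exact hF.continuousOn_varWord hp _ _ hdeg
  have i2 : IntervalIntegrable (fun t => serTrace M.γ (m - j) (PowerSeries.X *
      (M.dc (F t) (a 0) * M.insWord (F t) (F t) (velocity F t)
        (List.ofFn fun i : Fin (2 * j) => a i.succ)))) volume 0 1 := by
    refine ContinuousOn.intervalIntegrable ?_
    rw [uIcc_of_le zero_le_one]
    exact hF.continuousOn_X_mul_insWord hp _ _ hdeg
  simp only [map_add]
  rw [intervalIntegral.integral_add i1 i2, mul_add]
  have hB : B (M.Tch m F (2 * j + 1)) a = chConst m j *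
      ∫ t in (0 : ℝ)..1, serTrace M.γ (m - j) (PowerSeries.X * (M.dc (F t) (a 0) *
        M.insWord (F t) (F t) (velocity F t) (List.ofFn fun i : Fin (2 * j) => a i.succ))) := by
    -- For j = m there is no component of degree 2m + 1; this matches the coefficient 0 of a
    -- multiple of X.
    rcases hj.lt_or_eq with hj' | rfl
    · exact hF.B_tch hp hm hj' a
    · rw [tch_eq_zero fun h => by omega, B_zero]
      simp only [Nat.sub_self, serTrace_X_mul_zero]
      simp
  rw [← hB]
  -- For j = 0 there is no b-term, in accordance with `varWord` of the empty list being 0.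
  rcases j with _ | j
  · change B (M.Tch m F 1) a = _
    simp [varWord]
  · change b (M.Tch m F (2 * j + 1)) a + B (M.Tch m F (2 * j + 3)) a = _
    rw [hF.b_tch hp hm hj]
    rfl

/-- The fundamental theorem of calculus: by `tendsto_slope_serTrace` the integrand is the derivative
of the trace of the word along F_t, and it is continuous on [0,1]. -/
lemma integral_variation (hF : M.IsHomotopyOfDegree p ε F) (hp : 0 < p) (x : A) {L : List A}
    (hL : Even L.length) {n : ℕ} (hn : p ≤ (L.length - 1 + ε + 2 * n : ℤ)) :
    ∫ t in (0 : ℝ)..1, serTrace M.γ n (M.rc x * M.varWord (F t) (F t) (velocity F t) L +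
        PowerSeries.X * (M.dc (F t) x * M.insWord (F t) (F t) (velocity F t) L)) =
      serTrace M.γ n (M.rc x * (Rc (F 1) * piWord (M.dc (F 1)) (Rc (F 1)) L)) -
        serTrace M.γ n (M.rc x * (Rc (F 0) * piWord (M.dc (F 0)) (Rc (F 0)) L)) := by
  set f : ℝ → ℂ := fun t =>
    serTrace M.γ n (M.rc x * (Rc (F t) * piWord (M.dc (F t)) (Rc (F t)) L)) with hf
  have hderiv : ∀ s ∈ Icc (0 : ℝ) 1, HasDerivWithinAt f
      (serTrace M.γ n (M.rc x * M.varWord (F s) (F s) (velocity F s) L +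
        PowerSeries.X * (M.dc (F s) x * M.insWord (F s) (F s) (velocity F s) L)))
      (Icc 0 1) s := by
    intro s hs
    have hle : 𝓝[Icc 0 1 \ {s}] s ≤ 𝓝[Icc 0 1] s := nhdsWithin_mono s sdiff_subset
    have hmem : ∀ᶠ t in 𝓝[Icc 0 1 \ {s}] s, t ∈ Icc (0 : ℝ) 1 \ {s} := self_mem_nhdsWithin
    have hne : ∀ᶠ t in 𝓝[Icc 0 1 \ {s}] s, ((t - s : ℝ) : ℂ) ≠ 0 := by
      filter_upwards [hmem] with t ht
      exact Complex.ofReal_ne_zero.2 (sub_ne_zero.2 ht.2)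
    rw [hasDerivWithinAt_iff_tendsto_slope]
    have h := tendsto_slope_serTrace (l := 𝓝[Icc 0 1 \ {s}] s) (Fs := F)
      (c := fun t => ((t - s : ℝ) : ℂ)) hp hF.degree_nonneg hF.degree_le (hF.summable s hs)
      (by
        have h1 : Tendsto (fun t : ℝ => ((t - s : ℝ) : ℂ)) (𝓝 s) (𝓝 ((s - s : ℝ) : ℂ)) :=
          (Complex.continuous_ofReal.tendsto _).comp (tendsto_id.sub_const s)
        rw [sub_self, Complex.ofReal_zero] at h1
        exact h1.mono_left nhdsWithin_le_nhds)
      hne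
      (by
        filter_upwards [hne] with t ht
        rw [smul_smul, mul_inv_cancel₀ ht, one_smul])
      (by
        filter_upwards [hmem] with t ht
        exact hasParity_of_odd (hF.summable t ht.1).odd)
      ((hF.continuousOn s hs).mono_left hle)
      (fun a => ⟨(hF.tendsto_comm s hs a).1, (hF.tendsto_comm s hs a).2.mono_left hle⟩)
      ⟨(hF.tendsto_curvature s hs).1, (hF.tendsto_curvature s hs).2.mono_left hle⟩
      (hF.tendsto_slope s hs) x hL hn
    refine h.congr fun t => ?_
    rw [slope_def_module, Complex.real_smul, Complex.ofReal_inv]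
  refine intervalIntegral.integral_eq_sub_of_hasDerivAt_of_le zero_le_one
    (fun s hs => (hderiv s hs).continuousWithinAt)
    (fun s hs => (hderiv s (Ioo_subset_Icc_self hs)).hasDerivAt (Icc_mem_nhds hs.1 hs.2)) ?_
  refine ContinuousOn.intervalIntegrable ?_
  rw [uIcc_of_le zero_le_one]
  simp only [map_add]
  exact (hF.continuousOn_varWord hp _ _ hn).add (hF.continuousOn_X_mul_insWord hp _ _ hn)

/-- The transgression formula. -/
lemma ch_sub_ch (hF : M.IsHomotopyOfDegree p ε F) (hp : 0 < p) (hm : p ≤ (2 * m - 1 + ε : ℤ)) :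
    M.Ch m (F 1) - M.Ch m (F 0) = d A (M.Tch m F) := by
  have hm2 : p ≤ 2 * m := by
    have h1 := hF.degree_le
    have h2 : (2 * m - 1 + ε : ℤ) ≤ (2 * m : ℕ) := by push_cast; omega
    refine hm.trans ?_
    exact_mod_cast h2
  have h0 := hF.summable 0 (left_mem_Icc.2 zero_le_one)
  have h1 := hF.summable 1 (right_mem_Icc.2 zero_le_one)
  funext k
  by_cases hk : Even k ∧ k ≤ 2 * m
  · obtain ⟨hk, hkm⟩ := hk
    obtain ⟨j, rfl⟩ := hk.two_dvd
    have hj : j ≤ m := by omega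
    funext a
    have hdeg : p ≤ ((List.ofFn fun i : Fin (2 * j) => a i.succ).length - 1 + ε +
        2 * (m - j : ℕ) : ℤ) := by
      refine hm.trans (le_of_eq ?_)
      have : (2 * m - 1 + ε : ℤ) = (2 * j : ℕ) - 1 + ε + 2 * (m - j : ℕ) := by omega
      rw [List.length_ofFn]
      exact_mod_cast this
    rw [hF.d_tch hp hm hj, hF.integral_variation hp _ (by simp) hdeg, Pi.sub_apply, Pi.sub_apply,
      h0.ch_eq hp hm2 hj, h1.ch_eq hp hm2 hj, mul_sub]
    simp only [chWord, mul_assoc]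
  · rw [Pi.sub_apply, ch_eq_zero hk, ch_eq_zero hk, sub_zero]
    rcases k with _ | k
    · exact absurd ⟨Even.zero, Nat.zero_le _⟩ hk
    · change 0 = b (M.Tch m F k) + B (M.Tch m F (k + 2))
      have h2 : ¬ (Odd k ∧ k + 1 ≤ 2 * m) := fun h => hk ⟨h.1.add_one, h.2⟩
      have h3 : ¬ (Odd (k + 2) ∧ k + 2 + 1 ≤ 2 * m) := fun h => h2
        ⟨by obtain ⟨⟨i, hi⟩, _⟩ := h; exact ⟨i - 1, by omega⟩, by omega⟩
      rw [tch_eq_zero h2, tch_eq_zero h3, b_zero, B_zero, add_zero]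

end GradedRep.IsHomotopyOfDegree

/-! ### Difference quotients in ℒ^p -/

namespace Schatten

variable {H : Type*} [NormedAddCommGroup H] [InnerProductSpace ℂ H] [CompleteSpace H]

lemma ContinuousOnUnit.degTendsto {p q : ℝ} {d : ℕ} (hd : d ≠ 0) (hq : q = p / d)
    {X : ℝ → H →L[ℂ] H} (h : ContinuousOnUnit q X) {s : ℝ} (hs : s ∈ Icc (0 : ℝ) 1) :
    DegTendsto p d (𝓝[Icc 0 1] s) X (X s) := by
  subst hq
  refine ⟨GradedRep.degMem_of_mem hd (h.1 s hs), ?_⟩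
  simp only [Int.toNat_natCast, degNorm_of_ne_zero p hd]
  exact h.2 s hs

open MeasureTheory in
/-- If the derivative of a family of operators is continuous in `ℒ^p`, then the difference
quotients converge in `ℒ^p`. -/
lemma degTendsto_slope {p : ℝ} (hp : 1 < p) {F V : ℝ → H →L[ℂ] H} (hF : ContinuousOn F (Icc 0 1))
    (hV : ContinuousOn V (Icc 0 1)) (hFV : ∀ u ∈ Ioo (0 : ℝ) 1, HasDerivAt F (V u) u)
    {s : ℝ} (hs : s ∈ Icc (0 : ℝ) 1) (h : DegTendsto p 1 (𝓝[Icc 0 1] s) V (V s)) :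
    DegTendsto p 1 (𝓝[Icc 0 1 \ {s}] s) (fun t => ((t - s : ℝ) : ℂ)⁻¹ • (F t - F s)) (V s) := by
  have hp0 : 0 < p := one_pos.trans hp
  have hnorm : ∀ T : H →L[ℂ] H, degNorm p (1 : ℤ).toNat T = eNorm p T := fun T => by
    simp [degNorm]
  refine ⟨h.1, ?_⟩
  have h2 := h.2
  simp only [hnorm] at h2 ⊢
  obtain ⟨C, hC, hint⟩ := exists_eNorm_integral_le (H := H) hp
  rw [ENNReal.tendsto_nhds_zero]
  intro η hη
  -- The minimum with 1 keeps b finite even if η = ∞, and the denominator C + 1 is not 0.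
  set b : ℝ≥0∞ := min 1 (η / (C + 1)) with hb
  have hb0 : 0 < b := lt_min one_pos (ENNReal.div_pos hη.ne' (by simpa using hC))
  have hbtop : b ≠ ∞ := ((min_le_left _ _).trans_lt ENNReal.one_lt_top).ne
  have hCb : C * b ≤ η :=
    (mul_le_mul' (le_self_add (b := 1)) (min_le_right _ _)).trans ENNReal.mul_div_le
  obtain ⟨δ, hδ, hball⟩ := Metric.mem_nhdsWithin_iff.1 (ENNReal.tendsto_nhds_zero.1 h2 b hb0)
  have hmem : Metric.ball s δ ∩ (Icc 0 1 \ {s}) ∈ 𝓝[Icc 0 1 \ {s}] s :=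
    inter_mem (mem_nhdsWithin_of_mem_nhds (Metric.ball_mem_nhds s hδ)) self_mem_nhdsWithin
  filter_upwards [hmem] with t ht
  have hts : t - s ≠ 0 := sub_ne_zero.2 ht.2.2
  have hsub : uIcc s t ⊆ Icc 0 1 := ordConnected_Icc.uIcc_subset hs ht.2.1
  have hsub' : uIcc s t ⊆ Metric.ball s δ := by
    have h1 := Metric.mem_ball_self (x := s) hδ
    have h3 := ht.1
    rw [Real.ball_eq_Ioo] at h1 h3 ⊢
    exact ordConnected_Ioo.uIcc_subset h1 h3
  have hVint : IntervalIntegrable V volume s t := (hV.mono hsub).intervalIntegrable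
  -- The difference quotient minus V s is the mean value of V u - V s between s and t, so the ℒ^p
  -- bound for integrals applies.
  have hftc : ∫ u in s..t, (V u - V s) = F t - F s - (t - s) • V s := by
    rw [intervalIntegral.integral_sub hVint intervalIntegrable_const,
      intervalIntegral.integral_const,
      intervalIntegral.integral_eq_sub_of_hasDeriv_right (hF.mono hsub) (fun u hu => ?_) hVint]
    have hu' : u ∈ Ioo (0 : ℝ) 1 :=
      ⟨(le_min hs.1 ht.2.1.1).trans_lt hu.1, hu.2.trans_le (max_le hs.2 ht.2.1.2)⟩
    exact (hFV u hu').hasDerivWithinAt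
  have hbound := hint s t (fun u => V u - V s) b hbtop (hVint.sub intervalIntegrable_const)
    fun u hu => hball ⟨hsub' hu, hsub hu⟩
  have hc : ((t - s : ℝ) : ℂ) ≠ 0 := Complex.ofReal_ne_zero.2 hts
  have heq : ((t - s : ℝ) : ℂ)⁻¹ • (F t - F s) - V s =
      (((t - s : ℝ) : ℂ)⁻¹ • (1 : H →L[ℂ] H)) * ∫ u in s..t, (V u - V s) := by
    rw [hftc, smul_one_mul, smul_sub _ (F t - F s), ← Complex.coe_smul (t - s) (V s),
      inv_smul_smul₀ hc]
  have hone : ‖(((t - s : ℝ) : ℂ)⁻¹ • (1 : H →L[ℂ] H))‖ₑ ≤ (ENNReal.ofReal |t - s|)⁻¹ := by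
    rw [← ofReal_norm, ← ENNReal.ofReal_inv_of_pos (abs_pos.2 hts)]
    refine ENNReal.ofReal_le_ofReal ?_
    rw [norm_smul, norm_inv, Complex.norm_real, Real.norm_eq_abs]
    exact mul_le_of_le_one_right (by positivity) ContinuousLinearMap.norm_id_le
  rw [heq]
  refine (eNorm_mul_le_enorm_mul hp0 _ _).trans ?_
  refine (mul_le_mul' hone hbound).trans ?_
  rw [mul_comm, mul_assoc, ENNReal.mul_inv_cancel, mul_one]
  · exact hCb
  · simpa using hts
  · exact ENNReal.ofReal_ne_top

end Schatten

/-! ### From operator homotopies to velocities of degree 0 or 1 -/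

namespace GradedRep

open CyclicCohomology Schatten

variable {A H : Type*} [Ring A] [Algebra ℂ A]
  [NormedAddCommGroup H] [InnerProductSpace ℂ H] [CompleteSpace H]

namespace IsOperatorHomotopy

variable {M : GradedRep A H} {p : ℝ} {F₀ F₁ : H →L[ℂ] H} {F : ℝ → H →L[ℂ] H}

lemma hasDerivWithinAt (hF : M.IsOperatorHomotopy p F₀ F₁ F) {s : ℝ} (hs : s ∈ Icc (0 : ℝ) 1) :
    HasDerivWithinAt F (velocity F s) (Icc 0 1) s :=
  ((hF.contDiffOn.differentiableOn one_ne_zero) s hs).hasDerivWithinAt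

/-- Oddness is the vanishing of the continuous real-linear map X ↦ γX + Xγ, and such a condition
passes to the derivative. -/
lemma hasParity_velocity (hF : M.IsOperatorHomotopy p F₀ F₁ F) {s : ℝ}
    (hs : s ∈ Icc (0 : ℝ) 1) : HasParity M.γ 1 (velocity F s) := by
  refine hasParity_of_odd ?_
  set T : (H →L[ℂ] H) →L[ℝ] (H →L[ℂ] H) :=
    (ContinuousLinearMap.mul ℂ (H →L[ℂ] H) M.γ +
      (ContinuousLinearMap.mul ℂ (H →L[ℂ] H)).flip M.γ).restrictScalars ℝ
  have hT : ∀ X, T X = M.γ * X + X * M.γ := fun X => rfl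
  have h1 := T.hasFDerivAt.comp_hasDerivWithinAt s (hF.hasDerivWithinAt hs)
  have h2 : HasDerivWithinAt (fun _ : ℝ => (0 : H →L[ℂ] H)) (T (velocity F s)) (Icc 0 1) s :=
    h1.congr (fun t ht => by rw [Function.comp_apply, hT, hF.odd t ht, neg_add_cancel])
      (by rw [Function.comp_apply, hT, hF.odd s hs, neg_add_cancel])
  have h3 : T (velocity F s) = 0 := by
    rw [← h2.derivWithin (uniqueDiffOn_Icc zero_lt_one s hs), derivWithin_fun_const]
    rfl
  rw [hT] at h3
  exact eq_neg_of_add_eq_zero_left h3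

lemma continuousOn_velocity (hF : M.IsOperatorHomotopy p F₀ F₁ F) :
    ContinuousOn (velocity F) (Icc 0 1) :=
  hF.contDiffOn.continuousOn_derivWithin (uniqueDiffOn_Icc zero_lt_one) le_rfl

lemma isSummable (hF : M.IsOperatorHomotopy p F₀ F₁ F) {t : ℝ} (ht : t ∈ Icc (0 : ℝ) 1) :
    M.IsSummable p (F t) :=
  ⟨hF.odd t ht, fun a => (hF.comm_continuous a).1 t ht, hF.curvature_continuous.1 t ht⟩

lemma tendsto_comm (hF : M.IsOperatorHomotopy p F₀ F₁ F) {s : ℝ} (hs : s ∈ Icc (0 : ℝ) 1)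
    (a : A) : DegTendsto p 1 (𝓝[Icc 0 1] s) (fun t => M.comm (F t) a) (M.comm (F s) a) :=
  (hF.comm_continuous a).degTendsto (d := 1) one_ne_zero (by simp) hs

lemma tendsto_curvature (hF : M.IsOperatorHomotopy p F₀ F₁ F) (hp : 0 < p) {s : ℝ}
    (hs : s ∈ Icc (0 : ℝ) 1) :
    DegTendsto p 2 (𝓝[Icc 0 1] s) (fun t => 1 - F t ^ 2) (1 - F s ^ 2) := by
  simpa using (hF.curvature_continuous.degTendsto (d := 2) two_ne_zero (by simp) hs).neg hp

lemma isHomotopyOfDegree_zero (hF : M.IsOperatorHomotopy p F₀ F₁ F) (hp : 0 < p) :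
    M.IsHomotopyOfDegree p 0 F where
  degree_nonneg := le_rfl
  degree_le := zero_le_one
  summable _ ht := hF.isSummable ht
  continuousOn := hF.contDiffOn.continuousOn
  tendsto_comm _ hs a := hF.tendsto_comm hs a
  tendsto_curvature _ hs := hF.tendsto_curvature hp hs
  parity_velocity _ ht := hF.hasParity_velocity ht
  tendsto_velocity s hs := degTendsto_of_nonpos le_rfl (hF.continuousOn_velocity s hs)
  tendsto_slope s hs := by
    refine degTendsto_of_nonpos le_rfl ?_
    refine (hasDerivWithinAt_iff_tendsto_slope.1 (hF.hasDerivWithinAt hs)).congr fun t => ?_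
    rw [slope_def_module, ← Complex.coe_smul, Complex.ofReal_inv]

lemma isHomotopyOfDegree_one (hF : M.IsOperatorHomotopy p F₀ F₁ F) (hp : 1 < p)
    (hV : ContinuousOnUnit p (velocity F)) : M.IsHomotopyOfDegree p 1 F where
  degree_nonneg := zero_le_one
  degree_le := le_rfl
  summable _ ht := hF.isSummable ht
  continuousOn := hF.contDiffOn.continuousOn
  tendsto_comm _ hs a := hF.tendsto_comm hs a
  tendsto_curvature _ hs := hF.tendsto_curvature (one_pos.trans hp) hs
  parity_velocity _ ht := hF.hasParity_velocity ht
  tendsto_velocity s hs := hV.degTendsto (d := 1) one_ne_zero (by simp) hs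
  tendsto_slope s hs := degTendsto_slope hp hF.contDiffOn.continuousOn hF.continuousOn_velocity
    (fun _ hu => (hF.hasDerivWithinAt (Ioo_subset_Icc_self hu)).hasDerivAt
      (Icc_mem_nhds hu.1 hu.2)) hs (hV.degTendsto (d := 1) one_ne_zero (by simp) hs)

/-- The degree of the velocity that is available under the hypotheses on `m`. -/
lemma exists_isHomotopyOfDegree (hF : M.IsOperatorHomotopy p F₀ F₁ F) (hp : 0 < p) {m : ℕ}
    (hm : p + 1 ≤ 2 * (m : ℝ) ∨ (p ≤ 2 * (m : ℝ) ∧ ContinuousOnUnit p (velocity F))) :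
    ∃ ε : ℤ, M.IsHomotopyOfDegree p ε F ∧ p ≤ (2 * m - 1 + ε : ℤ) := by
  by_cases h : p + 1 ≤ 2 * (m : ℝ)
  · refine ⟨0, hF.isHomotopyOfDegree_zero hp, ?_⟩
    push_cast
    linarith
  · obtain ⟨h1, h2⟩ := hm.resolve_left h
    refine ⟨1, hF.isHomotopyOfDegree_one ?_ h2, by push_cast; linarith⟩
    -- If p ≤ 1, then m ≥ 1 gives 2m ≥ 2 ≥ p + 1, and the first alternative would have applied.
    by_contra hp1
    have hm0 : 0 < m := by
      rcases Nat.eq_zero_or_pos m with rfl | h0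
      · norm_num at h1
        linarith
      · exact h0
    have hm1 : (1 : ℝ) ≤ m := by exact_mod_cast hm0
    exact h (by linarith [not_lt.1 hp1])

end IsOperatorHomotopy

lemma d_mem_coboundaries {n : ℕ} (hn : n ≠ 0) {φ : Family A} (hφ : φ ∈ totCochains A (n - 1)) :
    d A φ ∈ coboundaries A n := by
  obtain ⟨n, rfl⟩ := Nat.exists_eq_succ_of_ne_zero hn
  exact Submodule.mem_map_of_mem hφ

end GradedRep

end

/-! ### Homotopy invariance of the character -/

theorem mainTheorem4 {A H : Type*} [Ring A] [Algebra ℂ A]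
    [NormedAddCommGroup H] [InnerProductSpace ℂ H] [CompleteSpace H]
    (M : GradedRep A H) (p : ℝ) (hp : 0 < p) (F₀ F₁ : H →L[ℂ] H)
    (h₀ : M.IsFredholmModule p F₀) (h₁ : M.IsFredholmModule p F₁)
    (F : ℝ → H →L[ℂ] H) (hF : M.IsOperatorHomotopy p F₀ F₁ F)
    (m : ℕ)
    (hm : p + 1 ≤ 2 * (m : ℝ) ∨
      (p ≤ 2 * (m : ℝ) ∧ Schatten.ContinuousOnUnit p (GradedRep.velocity F))) :
    M.ChDefined m F₀ ∧ M.ChDefined m F₁ ∧ M.TchDefined m F ∧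
    (∃ (c₀ : M.Ch m F₀ ∈ CyclicCohomology.cocycles A (2 * m))
       (c₁ : M.Ch m F₁ ∈ CyclicCohomology.cocycles A (2 * m)),
        CyclicCohomology.HC.mk (M.Ch m F₀) c₀ = CyclicCohomology.HC.mk (M.Ch m F₁) c₁) ∧
    M.Tch m F ∈ CyclicCohomology.totCochains A (2 * m - 1) ∧
    M.Ch m F₁ - M.Ch m F₀ = CyclicCohomology.d A (M.Tch m F) := by
  obtain ⟨ε, hε, hdeg⟩ := hF.exists_isHomotopyOfDegree hp hm
  have hm2 : p ≤ 2 * m := by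
    rcases hm with h | h
    · linarith
    · exact h.1
  -- In degree 0 the coboundaries are zero by definition; p > 0 excludes m = 0.
  have hm0 : 2 * m ≠ 0 := by
    rintro h
    have h' : (2 * m : ℝ) = 0 := by exact_mod_cast h
    linarith
  have hsum₀ := h₀.toIsSummable
  have hsum₁ := h₁.toIsSummable
  have htch := hε.tch_mem_totCochains hp hdeg
  have hd : M.Ch m F₁ - M.Ch m F₀ = CyclicCohomology.d A (M.Tch m F) := by
    have h := hε.ch_sub_ch hp hdeg
    rwa [hF.at_zero, hF.at_one] at h
  have c₀ : M.Ch m F₀ ∈ CyclicCohomology.cocycles A (2 * m) :=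
    ⟨hsum₀.ch_mem_totCochains hp hm2, hsum₀.d_ch hp hm2⟩
  have c₁ : M.Ch m F₁ ∈ CyclicCohomology.cocycles A (2 * m) :=
    ⟨hsum₁.ch_mem_totCochains hp hm2, hsum₁.d_ch hp hm2⟩
  refine ⟨hsum₀.chDefined hp hm2, hsum₁.chDefined hp hm2, hε.tchDefined hp hdeg, ⟨c₀, c₁, ?_⟩,
    htch, hd⟩
  refine ((Submodule.Quotient.eq _).2 ?_).symm
  change M.Ch m F₁ - M.Ch m F₀ ∈ CyclicCohomology.coboundaries A (2 * m)
  rw [hd]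
  exact GradedRep.d_mem_coboundaries hm0 htch
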